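/- Let $n\ge1$, $N\ge0$, $M\ge 0$ be integers and let $K$ be a field of characteristic $0$ (for instance $\mathbb C$). **Fock space.** Let $q\in K^\times$ and let $\alpha:\mathbb Z/n\to K$ satisfy $\alpha(0)=1$ and $\alpha(a)\alpha(-a)=1$ for all $a$. Put $g(0)=-q^2$ and $g(a)=-q\,\alpha(a)$ for $a\neq0$. The metaplectic Fock space $\mathcal F_{q,\alpha}$ has as basis the normally ordered semi-infinite wedges $u_{m_1}\wedge u_{m_2}\wedge\cdots$ ($m_1>m_2>\cdots$ integers, $m_{i+1}=m_i-1$ for large $i$); other wedges are expanded in this basis by $u_m\wedge u_m=0$ and, for $l<m$, by $u_l\wedge u_m=-u_m\wedge u_l$ if $l\equiv m \bmod n$, and otherwise, with $0<i<n$, $m-i\equiv l \bmod n$, $$u_l\wedge u_m=g(l-m)\,u_m\wedge u_l+(q^2-1)\sum_{t\ge0}q^{2t}\bigl(u_{m-i-tn}\wedge u_{l+i+tn}+g(l-m)\,u_{m-(t+1)n}\wedge u_{l+(t+1)n}\bigr),$$ where only normally ordered wedges are kept in the sum. For $k\ge1$ let $J_k(u_{m_1}\wedge u_{m_2}\wedge\cdots)=\sum_{i}u_{m_1}\wedge\cdots\wedge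 u_{m_i-kn}\wedge u_{m_{i+1}}\wedge\cdots$, and $L_+(\theta)=\sum_{k\ge1}\sum_{j=1}^N\frac1k\theta_j^kJ_k$. For a partition $\lambda=(\lambda_1\ge\dots\ge\lambda_\ell\ge0)$ of length $\ell$ let $\lambda+\rho=(\lambda_1+\ell-1,\lambda_2+\ell-2,\dots,\lambda_\ell)$, and for a strict partition $\kappa$ of length $\ell$ let $|\kappa\rangle=u_{\kappa_1}\wedge\cdots\wedge u_{\kappa_\ell}\wedge u_{-1}\wedge u_{-2}\wedge\cdots$, with dual basis $\langle\kappa|$. For partitions $\lambda,\mu$ of the same length, the supersymmetric LLT polynomial (for the fixed twist $\alpha$) is $$\mathcal G_{\lambda/\mu}(\theta|\pi;q)=\langle\mu+\rho|\,e^{L_+(\theta)-L_+(\pi)}\,|\lambda+\rho\rangle\qquad\text{in }\mathcal F_{q,\alpha}.$$ **Models.** Let $x_i,y_i,A_i,B_i\in K^\times$ ($1\le i\le N$) and $f,h:\mathbb Z/n\to K^\times$. A horizontal edge carries the spin $+$ or a spin $-$ with a charge in $\mathbb Z/n$; a vertical edge carries $+$ or $-$. List the spins at a vertex as (left, top, right,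 bottom), a charge being written as a subscript. The model $\mathfrak S^q$ has the admissible vertices $a_1=(+,+,+,+)$, $a_2(a)=(-_{a+1},-,-_a,-)$, $b_1=(+,-,+,-)$, $b_2(a)=(-_{a+1},+,-_a,+)$, $c_1=(-_1,+,+,-)$, $c_2=(+,-,-_0,+)$, whose weights in row $i$ are $$A_i,\quad h(a)y_iA_iB_i,\quad A_iB_i,\quad f(a)x_iA_i,\quad (f(0)x_i+h(0)y_i)A_iB_i,\quad A_i .$$ The model $\mathfrak S^{*,q}$ has the admissible vertices $a_1=(+,+,+,+)$, $a_2(a)=(-_a,-,-_{a+1},-)$, $b_1=(+,-,+,-)$, $b_2(a)=(-_a,+,-_{a+1},+)$, $c_1=(+,+,-_1,-)$, $c_2=(-_0,-,+,+)$, whose weights in row $i$ are $$A_i^{-1},\quad f(a)x_iA_i^{-1}B_i^{-1},\quad A_i^{-1}B_i^{-1},\quad h(a)y_iA_i^{-1},\quad (f(0)x_i+h(0)y_i)A_i^{-1},\quad A_i^{-1}B_i^{-1}.$$ For strict partitions $\kappa,\nu$ with all parts at most $M$, both models have $N$ rows, columns $0,\dots,M$ from left to right, and $+$ on the left and right boundary.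 $\mathfrak S^q_{\kappa/\nu}$ has rows numbered from bottom to top, with $-$ exactly on the parts of $\kappa$ at the bottom and exactly on the parts of $\nu$ at the top; $\mathfrak S^{*,q}_{\kappa/\nu}$ has rows numbered from top to bottom, with $\kappa$ at the top and $\nu$ at the bottom. $Z$ is the sum over all admissible states of the product of the vertex weights. **Theorem.** Suppose that the weights of $\mathfrak S^q$ are generalized free fermionic, i.e. in every row $a_1a_2(0)+b_1b_2(0)=c_1c_2$ and $$\frac{a_1a_2(a)a_2(-a)}{b_1b_2(a)b_2(-a)}=-\frac{a_2(0)}{b_2(0)}\qquad\text{for all } a\not\equiv0 \bmod n$$ (equivalently, the weights of $\mathfrak S^{*,q}$ are so), and let $\mathcal F_{q,\alpha}$ be their Fock space, i.e. $\frac{a_1a_2(a)}{b_1b_2(a)}=g(a)$ in every row of $\mathfrak S^q$ for all $a\not\equiv0 \bmod n$. Put $F=\prod_{a}f(a)$ and $H=\prod_{a}h(a)$, products over $a\in\mathbb Z/n$. Then for all partitions $\lambda,\mu$ of length $\ell$ such that the parts of $\lambda+\rho$ and $\mu+\rho$ are at most $M$, $$Z(\mathfrak S^q_{\lambda+\rho/\mu+\rho})=\prod_{i=1}^NA_i^{M+1}B_i^{\ell}\cdot\mathcal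 G_{\lambda/\mu}(\theta|\pi;q),\qquad \theta_i=x_i^nF,\quad \pi_i=-\tfrac{h(0)}{f(0)}x_i^{n-1}y_iF,$$ $$Z(\mathfrak S^{*,q}_{\lambda+\rho/\mu+\rho})=\prod_{i=1}^NA_i^{-(M+1)}B_i^{-\ell}\cdot\mathcal G_{\lambda/\mu}(\eta|\tau;q^{-1}),\qquad \eta_i=y_i^nH,\quad \tau_i=-\tfrac{f(0)}{h(0)}y_i^{n-1}x_iH,$$ where both polynomials are taken with the same twist $\alpha$. -/

import Mathlib

open scoped BigOperators

/-! ## Metaplectic Fock spaces -/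

/-- The data of a shift-invariant twist of `q`-Fock space: the quantum parameter `q ≠ 0` and the
twist `α_{ij} = α (i - j)`, which satisfies `α_{ii} = 1` and `α_{ij} α_{ji} = 1`. -/
structure MetaplecticData (n : ℕ) (K : Type*) [Field K] where
  q : K
  q_ne_zero : q ≠ 0
  α : ZMod n → K
  α_zero : α 0 = 1
  α_mul_neg : ∀ a, α a * α (-a) = 1

namespace MetaplecticData

variable {n : ℕ} {K : Type*} [Field K]

/-- The function `g` on charges: `g(0) = -q²` and `g(a) = -q α(a)` for `a ≠ 0`. -/
def g (F : MetaplecticData n K) (a : ZMod n) : K :=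
  if a = 0 then -F.q ^ 2 else -F.q * F.α a

/-- The data with `q` replaced by `q⁻¹` (and the same twist `α`). -/
def inv (F : MetaplecticData n K) : MetaplecticData n K where
  q := F.q⁻¹
  q_ne_zero := inv_ne_zero F.q_ne_zero
  α := F.α
  α_zero := F.α_zero
  α_mul_neg := F.α_mul_neg

/-- `g_*(a) = g(-a)⁻¹`. -/
theorem inv_g (F : MetaplecticData n K) (a : ZMod n) : F.inv.g a = (F.g (-a))⁻¹ := by
  by_cases ha : a = 0
  · simp [g, inv, ha, inv_neg]
  · have h := eq_inv_of_mul_eq_one_left (F.α_mul_neg a)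
    simp [g, inv, ha, h, inv_neg, mul_comm]

/-- The right-hand side of the normal ordering relation for `u_l ∧ u_m`, `l < m`, where `U a b`
stands for `u_a ∧ u_b`:
* `-u_m ∧ u_l` if `l ≡ m mod n`;
* otherwise, with `0 < i < n`, `m - i ≡ l mod n`,
  `g(l-m) u_m∧u_l + (q²-1) (u_{m-i}∧u_{l+i} + g(l-m) u_{m-n}∧u_{l+n}
    + q² u_{m-n-i}∧u_{l+n+i} + q² g(l-m) u_{m-2n}∧u_{l+2n} + ⋯)`,
  where the sum continues as long as the wedges are normally ordered. -/
def normalOrder (F : MetaplecticData n K) {E : Type*} [AddCommGroup E] [Module K E]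
    (l m : ℤ) (U : ℤ → ℤ → E) : E :=
  let i : ℤ := (m - l) % n
  let γ : K := F.g ((l - m : ℤ) : ZMod n)
  if i = 0 then -U m l
  else
    γ • U m l + (F.q ^ 2 - 1) • ∑ t ∈ Finset.range (m - l).toNat, (F.q ^ 2) ^ t •
      ((if l + i + t * n < m - i - t * n then U (m - i - t * n) (l + i + t * n) else 0) +
        (if l + (t + 1) * n < m - (t + 1) * n then
          γ • U (m - (t + 1) * n) (l + (t + 1) * n) else 0))

end MetaplecticData

/-- A normally ordered semi-infinite wedge `u_{m 0} ∧ u_{m 1} ∧ u_{m 2} ∧ ⋯`: a strictly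
decreasing sequence of integers which eventually decreases by one at each step. -/
@[ext]
structure NormalWedge where
  m : ℕ → ℤ
  strictAnti : StrictAnti m
  eventually : ∃ R, ∀ i, R ≤ i → m (i + 1) = m i - 1

namespace NormalWedge

/-- Remove the first factor. -/
def tail (w : NormalWedge) : NormalWedge where
  m := fun i => w.m (i + 1)
  strictAnti := fun _ _ h => w.strictAnti (Nat.succ_lt_succ h)
  eventually := by
    obtain ⟨R, hR⟩ := w.eventually
    exact ⟨R, fun i hi => hR (i + 1) (by omega)⟩

/-- Put a larger factor in front. -/
def cons (j : ℤ) (w : NormalWedge) (h : w.m 0 < j) : NormalWedge where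
  m := fun i => Nat.casesOn i j w.m
  strictAnti := by
    refine strictAnti_nat_of_succ_lt fun i => ?_
    cases i with
    | zero => exact h
    | succ i => exact w.strictAnti (Nat.lt_succ_self i)
  eventually := by
    obtain ⟨R, hR⟩ := w.eventually
    refine ⟨R + 1, fun i hi => ?_⟩
    cases i with
    | zero => omega
    | succ i => exact hR i (by omega)

/-- The normally ordered wedge
`u_{κ 0} ∧ ⋯ ∧ u_{κ (ℓ-1)} ∧ u_{-1} ∧ u_{-2} ∧ ⋯` of a strict partition `κ` of length `ℓ`. -/
def ofStrict {ℓ : ℕ} (κ : Fin ℓ → ℕ) (hκ : StrictAnti κ) : NormalWedge where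
  m := fun i => if h : i < ℓ then (κ ⟨i, h⟩ : ℤ) else (ℓ : ℤ) - 1 - i
  strictAnti := by
    refine strictAnti_nat_of_succ_lt fun i => ?_
    by_cases h1 : i + 1 < ℓ
    · have h0 : i < ℓ := by omega
      have : κ ⟨i + 1, h1⟩ < κ ⟨i, h0⟩ := hκ (by simp [Fin.lt_def])
      simp only [h1, h0, dif_pos]
      exact_mod_cast this
    · by_cases h0 : i < ℓ
      · simp only [h1, h0, dif_pos, dif_neg, not_false_eq_true]
        push_cast
        omega
      · simp only [h1, h0, dif_neg, not_false_eq_true]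
        push_cast
        omega
  eventually := by
    refine ⟨ℓ, fun i hi => ?_⟩
    have h1 : ¬ i + 1 < ℓ := by omega
    have h0 : ¬ i < ℓ := by omega
    simp only [h1, h0, dif_neg, not_false_eq_true]
    push_cast
    ring

end NormalWedge

/-- The Fock space: the vector space with basis the normally ordered wedges. -/
abbrev FockSpace (K : Type*) [Field K] := NormalWedge →₀ K

namespace MetaplecticData

variable {n : ℕ} {K : Type*} [Field K]

/-- Normal ordering of `u_j ∧ w`, for `w` normally ordered.  If `j` exceeds the first index `m` of
`w`, then `u_j ∧ w` is normally ordered; if `j = m` it is zero; and if `j < m`, the normal ordering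
relation is applied to the first two factors `u_j ∧ u_m`, and the resulting wedges
`u_a ∧ (u_b ∧ w.tail)` are normally ordered from the right.  Each step decreases `m - j`, so that
`m - j` recursion steps (the first argument) suffice. -/
noncomputable def insertAux (F : MetaplecticData n K) : ℕ → ℤ → NormalWedge → FockSpace K
  | 0, j, w => if h : w.m 0 < j then Finsupp.single (w.cons j h) 1 else 0
  | d + 1, j, w =>
      if h : w.m 0 < j then Finsupp.single (w.cons j h) 1
      else if j = w.m 0 then 0
      else F.normalOrder j (w.m 0) fun a b =>
        Finsupp.linearCombination K (insertAux F d a) (insertAux F d b w.tail)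

/-- The operator `u_j ∧ ·` on the Fock space. -/
noncomputable def wedge (F : MetaplecticData n K) (j : ℤ) : FockSpace K →ₗ[K] FockSpace K :=
  Finsupp.linearCombination K fun w => F.insertAux (w.m 0 - j).toNat j w

/-- The wedge `u_{m 0} ∧ ⋯ ∧ u_{m (i-1)} ∧ u_{m i - k n} ∧ u_{m (i+1)} ∧ ⋯`. -/
noncomputable def moveFactor (F : MetaplecticData n K) (k : ℤ) : ℕ → NormalWedge → FockSpace K
  | 0, w => F.wedge (w.m 0 - k * n) (Finsupp.single w.tail 1)
  | i + 1, w => F.wedge (w.m 0) (moveFactor F k i w.tail)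

/-- The current operator `J_k` (`k ≠ 0`): it moves one factor by `k n`, summed over all factors.
On each basis vector all but finitely many summands vanish. -/
noncomputable def current (F : MetaplecticData n K) (k : ℤ) : FockSpace K →ₗ[K] FockSpace K :=
  Finsupp.linearCombination K fun w => ∑ᶠ i : ℕ, F.moveFactor k i w

/-- The Hamiltonian `H = ∑_{k ≥ 1} s_k J_k`; a locally finite sum. -/
noncomputable def hamiltonian (F : MetaplecticData n K) (s : ℕ → K) :
    FockSpace K →ₗ[K] FockSpace K :=
  Finsupp.linearCombination K fun w =>
    ∑ᶠ k : ℕ, s (k + 1) • F.current ((k : ℤ) + 1) (Finsupp.single w 1)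

/-- `e^H |w⟩ = ∑_r H^r |w⟩ / r!`; the operator `H` is locally nilpotent. -/
noncomputable def expHamiltonian (F : MetaplecticData n K) (s : ℕ → K) (w : NormalWedge) :
    FockSpace K :=
  ∑ᶠ r : ℕ, (r.factorial : K)⁻¹ • (F.hamiltonian s ^ r) (Finsupp.single w 1)

end MetaplecticData

/-! ## Partitions and supersymmetric LLT polynomials -/

/-- `λ + ρ`, where `ρ = (ℓ - 1, …, 1, 0)`. -/
def addRho {ℓ : ℕ} (lam : Fin ℓ → ℕ) (i : Fin ℓ) : ℕ := lam i + (ℓ - 1 - i)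

theorem addRho_strictAnti {ℓ : ℕ} {lam : Fin ℓ → ℕ} (h : Antitone lam) :
    StrictAnti (addRho lam) := by
  intro i j hij
  have h1 := h hij.le
  have h2 : (i : ℕ) < j := hij
  have h3 := j.isLt
  unfold addRho
  omega

/-- The supersymmetric LLT polynomial
`𝒢_{λ/μ}(θ|π; q) = ⟨μ+ρ| e^{L₊(θ) - L₊(π)} |λ+ρ⟩`, where `L₊(θ) = ∑_{k≥1} ∑_j (θ_j^k / k) J_k`,
in the Fock space with data `F` (the parameter `q` is `F.q`). -/
noncomputable def superLLT {n : ℕ} {K : Type*} [Field K] (F : MetaplecticData n K) {N ℓ : ℕ}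
    (lam mu : Fin ℓ → ℕ) (hlam : Antitone lam) (hmu : Antitone mu) (θ π : Fin N → K) : K :=
  F.expHamiltonian (fun k => ∑ j, θ j ^ k / k - ∑ j, π j ^ k / k)
    (NormalWedge.ofStrict (addRho lam) (addRho_strictAnti hlam))
    (NormalWedge.ofStrict (addRho mu) (addRho_strictAnti hmu))

/-! ## Six-vertex models with charge -/

/-- The Boltzmann weights of one row. -/
structure BoltzmannWeights (n : ℕ) (K : Type*) where
  a₁ : K
  a₂ : ZMod n → K
  b₁ : K
  b₂ : ZMod n → K
  c₁ : K
  c₂ : K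

/-- A decorated horizontal spin: `none` is the spin `+`, and `some a` is the spin `-` with
charge `a`. -/
abbrev DecoratedSpin (n : ℕ) := Option (ZMod n)

namespace BoltzmannWeights

variable {n : ℕ} {K : Type*} [Field K]

/-- The weight of a vertex of the model `𝔖^q` with the given left, top, right and bottom spins
(for vertical spins, `true` is `-` and `false` is `+`).  Inadmissible vertices have weight `0`. -/
def deltaVertex (W : BoltzmannWeights n K) : DecoratedSpin n → Bool → DecoratedSpin n → Bool → K
  | none, false, none, false => W.a₁
  | some b, true, some a, true => if b = a + 1 then W.a₂ a else 0
  | none, true, none, true => W.b₁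
  | some b, false, some a, false => if b = a + 1 then W.b₂ a else 0
  | some b, false, none, true => if b = 1 then W.c₁ else 0
  | none, true, some a, false => if a = 0 then W.c₂ else 0
  | _, _, _, _ => 0

/-- The weight of a vertex of the model `𝔖^{*,q}` with the given left, top, right and bottom
spins. -/
def gammaVertex (W : BoltzmannWeights n K) : DecoratedSpin n → Bool → DecoratedSpin n → Bool → K
  | none, false, none, false => W.a₁
  | some a, true, some b, true => if b = a + 1 then W.a₂ a else 0
  | none, true, none, true => W.b₁
  | some a, false, some b, false => if b = a + 1 then W.b₂ a else 0
  | none, false, some b, true => if b = 1 then W.c₁ else 0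
  | some a, true, none, false => if a = 0 then W.c₂ else 0
  | _, _, _, _ => 0

end BoltzmannWeights

section FreeFermion

variable {n N : ℕ} {K : Type*} [Field K]

/-- The generalized free fermion condition: in every row, the zero-charge free fermion condition
and the charge condition. -/
def GeneralizedFreeFermionic (W : Fin N → BoltzmannWeights n K) : Prop :=
  ∀ i, (W i).a₁ * (W i).a₂ 0 + (W i).b₁ * (W i).b₂ 0 - (W i).c₁ * (W i).c₂ = 0 ∧
    ∀ a : ZMod n, a ≠ 0 →
      ((W i).a₁ * (W i).a₂ a * (W i).a₂ (-a)) / ((W i).b₁ * (W i).b₂ a * (W i).b₂ (-a)) =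
        -((W i).a₂ 0 / (W i).b₂ 0)

/-- The metaplectic Fock space given by `F` is that of the generalized free fermionic weights `W`:
`a₁ a₂(a) / (b₁ b₂(a)) = g(a)` in every row, for all nonzero charges `a`.  For `n ≥ 2` the same
equation for `a = 0` follows from the charge condition; for `n = 1` there is no condition, the Fock
space being the classical one for all `q`. -/
def MetaplecticData.IsFockSpaceOf (F : MetaplecticData n K) (W : Fin N → BoltzmannWeights n K) :
    Prop :=
  ∀ i, ∀ a : ZMod n, a ≠ 0 → ((W i).a₁ * (W i).a₂ a) / ((W i).b₁ * (W i).b₂ a) = F.g a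

end FreeFermion

/-- The parameters of the charged models with `N` rows. -/
structure ChargedParams (n N : ℕ) (K : Type*) where
  x : Fin N → K
  y : Fin N → K
  A : Fin N → K
  B : Fin N → K
  f : ZMod n → K
  h : ZMod n → K

namespace ChargedParams

variable {n N : ℕ} {K : Type*} [Field K]

/-- All parameters are nonzero. -/
def Nondegenerate (P : ChargedParams n N K) : Prop :=
  (∀ i, P.x i ≠ 0 ∧ P.y i ≠ 0 ∧ P.A i ≠ 0 ∧ P.B i ≠ 0) ∧ ∀ a, P.f a ≠ 0 ∧ P.h a ≠ 0

/-- The Boltzmann weights of `𝔖^q` in row `i`. -/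
def deltaWeights (P : ChargedParams n N K) (i : Fin N) : BoltzmannWeights n K where
  a₁ := P.A i
  a₂ := fun a => P.h a * P.y i * P.A i * P.B i
  b₁ := P.A i * P.B i
  b₂ := fun a => P.f a * P.x i * P.A i
  c₁ := (P.f 0 * P.x i + P.h 0 * P.y i) * P.A i * P.B i
  c₂ := P.A i

/-- The Boltzmann weights of `𝔖^{*,q}` in row `i`. -/
def gammaWeights (P : ChargedParams n N K) (i : Fin N) : BoltzmannWeights n K where
  a₁ := (P.A i)⁻¹
  a₂ := fun a => P.f a * P.x i * (P.A i)⁻¹ * (P.B i)⁻¹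
  b₁ := (P.A i)⁻¹ * (P.B i)⁻¹
  b₂ := fun a => P.h a * P.y i * (P.A i)⁻¹
  c₁ := (P.f 0 * P.x i + P.h 0 * P.y i) * (P.A i)⁻¹
  c₂ := (P.A i)⁻¹ * (P.B i)⁻¹

end ChargedParams

/-- A spin configuration on a grid with `N` rows and columns `0, …, M` (from left to right).
`vert r c` is the spin of the vertical edge in column `c` at level `r`; row `i` lies between the
levels `i` and `i + 1`.  The edge `horiz i c` is to the left of column `c` in row `i`, and
`horiz i (c + 1)` is to its right. -/
abbrev Configuration (n N M : ℕ) :=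
  (Fin (N + 1) → Fin (M + 1) → Bool) × (Fin N → Fin (M + 2) → DecoratedSpin n)

namespace Configuration

variable {n N M : ℕ}

/-- The vertical edge in column `c` at level `r`. -/
def vert (s : Configuration n N M) (r : Fin (N + 1)) (c : Fin (M + 1)) : Bool := s.1 r c

/-- The horizontal edge number `c` of row `i`. -/
def horiz (s : Configuration n N M) (i : Fin N) (c : Fin (M + 2)) : DecoratedSpin n := s.2 i c

end Configuration

/-- The boundary spins given by a strict partition: `-` on its parts, `+` elsewhere. -/
def boundarySpins (M : ℕ) {ℓ : ℕ} (κ : Fin ℓ → ℕ) (c : Fin (M + 1)) : Bool :=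
  decide (∃ i, κ i = c)

/-- The configurations with boundary spins `κ` at level `0`, `ν` at level `N`, and `+` on the left
and right boundary edges. -/
def boundaryConfigurations (n N M : ℕ) [NeZero n] {ℓ : ℕ} (κ ν : Fin ℓ → ℕ) :
    Finset (Configuration n N M) :=
  Finset.univ.filter fun s =>
    s.vert 0 = boundarySpins M κ ∧ s.vert (Fin.last N) = boundarySpins M ν ∧
      ∀ i, s.horiz i 0 = none ∧ s.horiz i (Fin.last (M + 1)) = none

namespace ChargedParams

variable {n N : ℕ} [NeZero n] {K : Type*} [Field K]

/-- The partition function `Z(𝔖^q_{κ/ν})` with `M + 1` columns.  Rows and levels are counted from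
bottom to top, so that `κ` is the bottom boundary and `ν` the top boundary. -/
def deltaZ (P : ChargedParams n N K) (M : ℕ) {ℓ : ℕ} (κ ν : Fin ℓ → ℕ) : K :=
  ∑ s ∈ boundaryConfigurations n N M κ ν, ∏ i : Fin N, ∏ c : Fin (M + 1),
    (P.deltaWeights i).deltaVertex
      (s.horiz i c.castSucc) (s.vert i.succ c) (s.horiz i c.succ) (s.vert i.castSucc c)

/-- The partition function `Z(𝔖^{*,q}_{κ/ν})` with `M + 1` columns.  Rows and levels are counted
from top to bottom, so that `κ` is the top boundary and `ν` the bottom boundary. -/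
def gammaZ (P : ChargedParams n N K) (M : ℕ) {ℓ : ℕ} (κ ν : Fin ℓ → ℕ) : K :=
  ∑ s ∈ boundaryConfigurations n N M κ ν, ∏ i : Fin N, ∏ c : Fin (M + 1),
    (P.gammaWeights i).gammaVertex
      (s.horiz i c.castSucc) (s.vert i.castSucc c) (s.horiz i c.succ) (s.vert i.succ c)

/-- `θ_i = x_i^n F`, where `F = ∏_a f(a)`. -/
def theta (P : ChargedParams n N K) (i : Fin N) : K := P.x i ^ n * ∏ a, P.f a

/-- `π_i = -(h(0)/f(0)) x_i^{n-1} y_i F`. -/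
def pi (P : ChargedParams n N K) (i : Fin N) : K :=
  -(P.h 0 / P.f 0) * P.x i ^ (n - 1) * P.y i * ∏ a, P.f a

/-- `η_i = y_i^n H`, where `H = ∏_a h(a)`. -/
def eta (P : ChargedParams n N K) (i : Fin N) : K := P.y i ^ n * ∏ a, P.h a

/-- `τ_i = -(f(0)/h(0)) y_i^{n-1} x_i H`. -/
def tau (P : ChargedParams n N K) (i : Fin N) : K :=
  -(P.f 0 / P.h 0) * P.y i ^ (n - 1) * P.x i * ∏ a, P.h a

end ChargedParams

namespace ChargedParams

variable {n N : ℕ} {K : Type*} [Field K]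

/-- The weights of `𝔖^{*,q}` are generalized free fermionic iff those of `𝔖^q` are. -/
theorem gammaWeights_generalizedFreeFermionic_iff (P : ChargedParams n N K)
    (hP : P.Nondegenerate) :
    GeneralizedFreeFermionic P.gammaWeights ↔ GeneralizedFreeFermionic P.deltaWeights := by
  obtain ⟨h1, h2⟩ := hP
  refine forall_congr' fun i => and_congr ?_ (forall_congr' fun a => imp_congr_right fun _ => ?_)
  · refine iff_of_true ?_ ?_ <;> simp only [gammaWeights, deltaWeights] <;> ring
  · obtain ⟨hx, hy, hA, hB⟩ := h1 i
    have ha := h2 a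
    have hb := h2 (-a)
    have hc := h2 0
    obtain ⟨ha1, ha2⟩ := ha
    obtain ⟨hb1, hb2⟩ := hb
    obtain ⟨hc1, hc2⟩ := hc
    simp only [gammaWeights, deltaWeights]
    field_simp
    constructor <;> intro h <;> linear_combination h

/-- Over an algebraically closed field, generalized free fermionic weights have a metaplectic Fock
space. -/
theorem exists_isFockSpaceOf [IsAlgClosed K] (P : ChargedParams n N K)
    (hP : P.Nondegenerate) (hFF : GeneralizedFreeFermionic P.deltaWeights) :
    ∃ F : MetaplecticData n K, F.IsFockSpaceOf P.deltaWeights := by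
  classical
  obtain ⟨h1, h2⟩ := hP
  by_cases hN : Nonempty (Fin N)
  swap
  · exact ⟨⟨1, one_ne_zero, 1, rfl, fun _ => by simp⟩, fun i => (hN ⟨i⟩).elim⟩
  obtain ⟨i₀⟩ := hN
  obtain ⟨q, hq⟩ := IsAlgClosed.exists_pow_nat_eq
    (-(P.h 0 * P.y i₀ / (P.f 0 * P.x i₀))) (n := 2) (by norm_num)
  have hcond : ∀ i, ∀ a : ZMod n, a ≠ 0 →
      P.h a * P.h (-a) * P.y i * P.f 0 = -(P.h 0 * P.f a * P.f (-a) * P.x i) := by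
    intro i a ha
    obtain ⟨hx, hy, hA, hB⟩ := h1 i
    obtain ⟨ha1, ha2⟩ := h2 a
    obtain ⟨hb1, hb2⟩ := h2 (-a)
    obtain ⟨hc1, hc2⟩ := h2 0
    have := (hFF i).2 a ha
    simp only [deltaWeights] at this
    field_simp at this
    linear_combination this
  obtain ⟨hx, hy, hA, hB⟩ := h1 i₀
  obtain ⟨hc1, hc2⟩ := h2 0
  have hq0 : q ≠ 0 := by
    rintro rfl
    have : P.h 0 * P.y i₀ / (P.f 0 * P.x i₀) ≠ 0 := by positivity
    apply this
    linear_combination hq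
  refine ⟨⟨q, hq0, fun a => if a = 0 then 1 else -(P.h a * P.y i₀ / (P.f a * P.x i₀)) / q,
    by simp, fun a => ?_⟩, fun i a ha => ?_⟩
  · by_cases ha : a = 0
    · simp [ha]
    · obtain ⟨ha1, ha2⟩ := h2 a
      obtain ⟨hb1, hb2⟩ := h2 (-a)
      have := hcond i₀ a ha
      simp only [ha, neg_eq_zero, if_false]
      field_simp
      rw [hq]
      field_simp
      linear_combination this
  · obtain ⟨hx', hy', hA', hB'⟩ := h1 i
    obtain ⟨ha1, ha2⟩ := h2 a
    obtain ⟨hb1, hb2⟩ := h2 (-a)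
    have e1 := hcond i a ha
    have e2 := hcond i₀ a ha
    have key : P.y i * P.x i₀ = P.y i₀ * P.x i := by
      have hne : P.h a * P.h (-a) * P.f 0 ≠ 0 := by positivity
      apply mul_left_cancel₀ hne
      linear_combination P.x i₀ * e1 - P.x i * e2
    simp only [deltaWeights, MetaplecticData.g, ha, if_false]
    field_simp
    linear_combination key

end ChargedParams

/-! Column by column, one row of the lattice model acts on wedges (spins `-` are the factors with
nonnegative index) as a linear operator `T`, the row operator with spin `+` at both ends. Both `T`
and the exponential `e^H` of the one-row Hamiltonian fix the vacuum, and both satisfy the exchange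
relation `T (u_c - θ u_{c-n}) v = (u_c - π u_{c-n}) T v` whenever all factors of `v` are in columns
`< c`. Since every packed wedge is built from the vacuum by adding factors in increasing columns,
this relation determines the operator, so `T = e^H` (`rowOp_none_eq_expSeries`). Stacking rows
multiplies exponentials of commuting Hamiltonians, and the matrix coefficient at the boundary wedges
gives the partition function (`pathSum_rowSum_eq`).

For `e^H` the relation follows from `[J_k, u_m] = u_{m-kn}` (`current_wedge`): conjugation by `e^H`
multiplies the generating series of the `u_{m-kn}` by `exp(∑ (θ^k - π^k) X^k / k) = (1 - πX)/(1 -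
θX)`. For `T` it comes from the lattice. A row with charge `a` on its right edge equals, up to the
factor `1 - Q`, a product of the remaining `x_b` times the `Q`-commutator of the uncharged row with
one `u_s` (`rowOp_some_eq`); the case `a = 1` is the exchange relation (`rowOp_none_wedge`).

The algebraic difficulty is that `u_j ∧ w` is defined by normal ordering from the right. By
construction the relation for `u_l ∧ u_m ∧ v` is known only if `v` starts below `m`, and likewise
`[J_k, u_m]` only if `v` starts below `m`. Both are extended to all `v` together, by induction on
how far the first index of `v` may exceed `m` (`CommutesBelow`). The induction uses only `J₁` and
`E₂ = (J₁² - J₂)/2`. The commutators with them turn a two-factor relation into the relation with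
both factors lowered by `n` (`CommutesBelow.wedge_wedge`), while compatibility of normal ordering
with moving one factor (`normalOrder_move`) extends the range of the commutators
(`CommutesBelow.add_one`). The higher `J_k` then follow from Newton's identities in two variables
(`pairShift_powerSum_mem`).

Both models fit one row operator: `IsRowVertex` lists what is needed of the vertex weights. The
second model is turned upside down, its charges are reflected by `r ↦ 1 - r`, and `g(a)` is replaced
by `g(-a)⁻¹`, which is the Fock space with `q⁻¹` and the same twist. -/

/-! ## Normal ordering of wedges -/

theorem finsum_nat_succ {E : Type*} [AddCommMonoid E] {f : ℕ → E}
    (hf : (Function.support f).Finite) : ∑ᶠ i, f i = f 0 + ∑ᶠ i, f (i + 1) := by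
  obtain ⟨N, hN⟩ := hf.bddAbove
  have h1 : Function.support f ⊆ (Finset.range (N + 1) : Set ℕ) := fun i hi => by
    have := hN hi
    simp only [Finset.coe_range, Set.mem_Iio]
    omega
  have h2 : (Function.support fun i => f (i + 1)) ⊆ (Finset.range N : Set ℕ) := fun i hi => by
    have : i + 1 ≤ N := hN hi
    simp only [Finset.coe_range, Set.mem_Iio]
    omega
  rw [finsum_eq_sum_of_support_subset _ h1, finsum_eq_sum_of_support_subset _ h2,
    Finset.sum_range_succ', add_comm]

namespace MetaplecticData

variable {n : ℕ} {K : Type*} [Field K] (F : MetaplecticData n K)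

section NormalOrder

variable {E E' : Type*} [AddCommGroup E] [Module K E] [AddCommGroup E'] [Module K E']

theorem normalOrder_of_emod_eq_zero {l m : ℤ} (h : (m - l) % n = 0) (U : ℤ → ℤ → E) :
    F.normalOrder l m U = -U m l := by
  simp [normalOrder, h]

theorem normalOrder_of_emod_ne_zero {l m : ℤ} (h : (m - l) % n ≠ 0) (U : ℤ → ℤ → E) :
    F.normalOrder l m U = F.g ((l - m : ℤ) : ZMod n) • U m l +
      (F.q ^ 2 - 1) • ∑ t ∈ Finset.range (m - l).toNat, (F.q ^ 2) ^ t •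
      ((if l + (m - l) % n + t * n < m - (m - l) % n - t * n then
          U (m - (m - l) % n - t * n) (l + (m - l) % n + t * n) else 0) +
        (if l + (t + 1) * n < m - (t + 1) * n then
          F.g ((l - m : ℤ) : ZMod n) • U (m - (t + 1) * n) (l + (t + 1) * n) else 0)) := by
  simp [normalOrder, h]

theorem normalOrder_map (φ : E →ₗ[K] E') (l m : ℤ) (U : ℤ → ℤ → E) :
    φ (F.normalOrder l m U) = F.normalOrder l m fun a b => φ (U a b) := by
  by_cases h : (m - l) % n = 0
  · simp [normalOrder_of_emod_eq_zero F h]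
  · rw [normalOrder_of_emod_ne_zero F h, normalOrder_of_emod_ne_zero F h]
    simp [apply_ite φ]

/-- Naturality under linear maps gives additivity: apply it on `E × E` to both projections and to
their sum. -/
theorem normalOrder_add (l m : ℤ) (U V : ℤ → ℤ → E) :
    F.normalOrder l m (fun a b => U a b + V a b) =
      F.normalOrder l m U + F.normalOrder l m V := by
  have h := normalOrder_map F (LinearMap.fst K E E + LinearMap.snd K E E) l m
    fun a b => (U a b, V a b)
  have h1 := normalOrder_map F (LinearMap.fst K E E) l m fun a b => (U a b, V a b)
  have h2 := normalOrder_map F (LinearMap.snd K E E) l m fun a b => (U a b, V a b)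
  simp only [LinearMap.add_apply, LinearMap.fst_apply, LinearMap.snd_apply] at h h1 h2
  rw [← h, h1, h2]

theorem normalOrder_shift (k l m : ℤ) (U : ℤ → ℤ → E) :
    F.normalOrder (l - k) (m - k) U = F.normalOrder l m fun a b => U (a - k) (b - k) := by
  have e : m - k - (l - k) = m - l := by ring
  have e' : l - k - (m - k) = l - m := by ring
  by_cases h : (m - l) % n = 0
  · rw [normalOrder_of_emod_eq_zero F h, normalOrder_of_emod_eq_zero F (by rw [e]; exact h)]
  · rw [normalOrder_of_emod_ne_zero F h, normalOrder_of_emod_ne_zero F (by rw [e]; exact h),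
      e, e']
    congr 2
    refine Finset.sum_congr rfl fun t _ => ?_
    congr 2
    · congr 1
      · exact propext ⟨fun h => by linarith, fun h => by linarith⟩
      · congr 1 <;> ring
    · congr 1
      · exact propext ⟨fun h => by linarith, fun h => by linarith⟩
      · congr 2 <;> ring

variable [NeZero n]

/-- Straightening moves two indices towards each other and keeps their sum. Inductions on indices
use this to invoke a hypothesis only for the pairs that really occur. -/
theorem normalOrder_congr {l m : ℤ} (hlm : l < m) {U V : ℤ → ℤ → E}
    (h : ∀ a b, l ≤ b → b < a → a ≤ m → a + b = l + m → U a b = V a b) :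
    F.normalOrder l m U = F.normalOrder l m V := by
  have hn : (0 : ℤ) < n := by exact_mod_cast Nat.pos_of_ne_zero (NeZero.ne n)
  by_cases h0 : (m - l) % n = 0
  · rw [normalOrder_of_emod_eq_zero F h0, normalOrder_of_emod_eq_zero F h0,
      h m l le_rfl hlm le_rfl (by ring)]
  · rw [normalOrder_of_emod_ne_zero F h0, normalOrder_of_emod_ne_zero F h0,
      h m l le_rfl hlm le_rfl (by ring)]
    congr 2
    refine Finset.sum_congr rfl fun t _ => ?_
    have hi : 0 ≤ (m - l) % (n : ℤ) := Int.emod_nonneg _ hn.ne'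
    have ht : (0 : ℤ) ≤ t * n := by positivity
    congr 2
    · split_ifs with h1
      · exact h _ _ (by linarith) h1 (by linarith) (by ring)
      · rfl
    · split_ifs with h1
      · rw [h _ _ (by nlinarith) h1 (by nlinarith) (by ring)]
      · rfl

theorem normalOrder_mem {l m : ℤ} (hlm : l < m) {U : ℤ → ℤ → E} (S : Submodule K E)
    (h : ∀ a b, l ≤ b → b < a → a ≤ m → a + b = l + m → U a b ∈ S) :
    F.normalOrder l m U ∈ S := by
  -- Modulo `S` all wedges that occur vanish, and normal ordering commutes with the quotient map.
  have h1 := F.normalOrder_congr hlm (U := fun a b => S.mkQ (U a b)) (V := fun _ _ => 0)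
    fun a b h1 h2 h3 h4 => by simpa using h a b h1 h2 h3 h4
  rw [← normalOrder_map] at h1
  rw [← Submodule.Quotient.mk_eq_zero, ← Submodule.mkQ_apply, h1]
  have := F.normalOrder_map (0 : E →ₗ[K] E ⧸ S) l m U
  simpa using this.symm

end NormalOrder

/-! ## The filtration by the first index -/

variable (K) in
/-- The span of the normally ordered wedges whose first index is less than `c`. -/
noncomputable def firstLT (c : ℤ) : Submodule K (FockSpace K) :=
  Finsupp.supported K K {w : NormalWedge | w.m 0 < c}

theorem single_mem_firstLT {w : NormalWedge} {c : ℤ} (h : w.m 0 < c) (x : K) :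
    Finsupp.single w x ∈ firstLT K c :=
  Finsupp.single_mem_supported K x h

theorem firstLT_mono {c d : ℤ} (h : c ≤ d) : firstLT K c ≤ firstLT K d :=
  Finsupp.supported_mono fun _ hw => lt_of_lt_of_le hw h

theorem firstLT_eq_span (c : ℤ) : firstLT K c =
    Submodule.span K ((fun w => Finsupp.single w 1) '' {w : NormalWedge | w.m 0 < c}) :=
  Finsupp.supported_eq_span_single K _

theorem firstLT_induction {c : ℤ} {S : Submodule K (FockSpace K)}
    (h : ∀ w : NormalWedge, w.m 0 < c → Finsupp.single w (1 : K) ∈ S) : firstLT K c ≤ S := by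
  rw [firstLT_eq_span, Submodule.span_le]
  rintro _ ⟨w, hw, rfl⟩
  exact h w hw

theorem exists_mem_firstLT (v : FockSpace K) : ∃ c, v ∈ firstLT K c := by
  induction v using Finsupp.induction_linear with
  | zero => exact ⟨0, Submodule.zero_mem _⟩
  | add f g hf hg =>
    obtain ⟨c, hc⟩ := hf
    obtain ⟨d, hd⟩ := hg
    exact ⟨max c d, Submodule.add_mem _ (firstLT_mono (le_max_left _ _) hc)
      (firstLT_mono (le_max_right _ _) hd)⟩
  | single w x => exact ⟨w.m 0 + 1, single_mem_firstLT (by omega) x⟩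

theorem _root_.NormalWedge.tail_lt (w : NormalWedge) : w.tail.m 0 < w.m 0 :=
  w.strictAnti Nat.zero_lt_one

@[simp] theorem _root_.NormalWedge.cons_tail (w : NormalWedge) :
    w.tail.cons (w.m 0) w.tail_lt = w := by
  ext i
  cases i <;> rfl

@[simp] theorem _root_.NormalWedge.tail_cons (w : NormalWedge) (j : ℤ) (h : w.m 0 < j) :
    (w.cons j h).tail = w := rfl

@[simp] theorem _root_.NormalWedge.cons_zero (w : NormalWedge) (j : ℤ) (h : w.m 0 < j) :
    (w.cons j h).m 0 = j := rfl

theorem linearCombination_congr_of_mem {c : ℤ} {f g : NormalWedge → FockSpace K}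
    (h : ∀ w, w.m 0 < c → f w = g w) {v : FockSpace K} (hv : v ∈ firstLT K c) :
    Finsupp.linearCombination K f v = Finsupp.linearCombination K g v := by
  have : firstLT K c ≤ LinearMap.eqLocus (Finsupp.linearCombination K f)
      (Finsupp.linearCombination K g) :=
    firstLT_induction fun w hw => by simp [LinearMap.mem_eqLocus, h w hw]
  exact this hv

/-! ### The insertion recursion and the operators `u_j ∧ ·` -/

section Insert

variable [NeZero n]

theorem insertAux_mem (d : ℕ) : ∀ (j : ℤ) (w : NormalWedge) (c : ℤ), w.m 0 < c → j < c →
    F.insertAux d j w ∈ firstLT K c := by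
  induction d with
  | zero =>
    intro j w c hw hj
    unfold insertAux
    split_ifs with h
    · exact single_mem_firstLT hj _
    · exact Submodule.zero_mem _
  | succ d ih =>
    intro j w c hw hj
    unfold insertAux
    split_ifs with h h'
    · exact single_mem_firstLT hj _
    · exact Submodule.zero_mem _
    · refine F.normalOrder_mem (by omega) _ fun a b h1 h2 h3 _ => ?_
      have hle : firstLT K c ≤ (firstLT K c).comap
          (Finsupp.linearCombination K (F.insertAux d a)) :=
        firstLT_induction fun w' hw' => by simpa using ih a w' c hw' (by omega)
      exact hle (ih b w.tail c (w.tail_lt.trans hw) (by omega))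

/-- Each recursive call lowers the gap between the first index and the inserted index. The inner
call inserts `b ≥ j` into a tail that starts lower; the outer one inserts `a > b` into wedges that
still start below `w.m 0`. Fuel beyond the initial gap is therefore never spent. -/
theorem insertAux_succ_eq (d : ℕ) : ∀ (j : ℤ) (w : NormalWedge), w.m 0 - j ≤ d →
    F.insertAux (d + 1) j w = F.insertAux d j w := by
  induction d with
  | zero =>
    intro j w h
    by_cases h1 : w.m 0 < j
    · simp [insertAux, h1]
    · have : j = w.m 0 := by push_cast at h; omega
      simp [insertAux, this]
  | succ d ih =>
    intro j w h
    push_cast at h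
    rw [insertAux, insertAux]
    split_ifs with h1 h2
    · rfl
    · rfl
    · have ht := w.tail_lt
      refine F.normalOrder_congr (by omega) fun a b ha hb hab _ => ?_
      rw [ih b w.tail (by omega)]
      exact linearCombination_congr_of_mem (c := w.m 0) (fun w' hw' => ih a w' (by omega))
        (F.insertAux_mem d b _ _ ht (by omega))

theorem insertAux_eq_of_le {d : ℕ} {j : ℤ} {w : NormalWedge} (h : w.m 0 - j ≤ d) :
    F.insertAux d j w = F.wedge j (Finsupp.single w 1) := by
  rw [wedge, Finsupp.linearCombination_single, one_smul]
  have h0 : (w.m 0 - j).toNat ≤ d := by omega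
  induction d, h0 using Nat.le_induction with
  | base => rfl
  | succ d hd ih => rw [insertAux_succ_eq F d j w (by omega), ih (by omega)]

theorem wedge_single_of_lt {j : ℤ} {w : NormalWedge} (h : w.m 0 < j) :
    F.wedge j (Finsupp.single w 1) = Finsupp.single (w.cons j h) 1 := by
  rw [← insertAux_eq_of_le F (d := 0) (by push_cast; omega), insertAux, dif_pos h]

theorem wedge_tail (w : NormalWedge) :
    F.wedge (w.m 0) (Finsupp.single w.tail 1) = Finsupp.single w 1 := by
  rw [F.wedge_single_of_lt w.tail_lt, NormalWedge.cons_tail]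

theorem wedge_single_self (w : NormalWedge) :
    F.wedge (w.m 0) (Finsupp.single w 1) = 0 := by
  rw [← insertAux_eq_of_le F (d := 0) (by push_cast; omega), insertAux, dif_neg (lt_irrefl _)]

theorem wedge_mem {j c : ℤ} (hj : j < c) {v : FockSpace K} (hv : v ∈ firstLT K c) :
    F.wedge j v ∈ firstLT K c := by
  have hle : firstLT K c ≤ (firstLT K c).comap (F.wedge j) :=
    firstLT_induction fun w' hw' => by
      simpa [wedge] using F.insertAux_mem _ j w' c hw' hj
  exact hle hv

theorem wedge_single_of_gt {j : ℤ} {w : NormalWedge} (h : j < w.m 0) :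
    F.wedge j (Finsupp.single w 1) =
      F.normalOrder j (w.m 0) fun a b => F.wedge a (F.wedge b (Finsupp.single w.tail 1)) := by
  obtain ⟨d, hd⟩ : ∃ d : ℕ, w.m 0 - j = d + 1 := ⟨(w.m 0 - j - 1).toNat, by omega⟩
  rw [← insertAux_eq_of_le F (d := d + 1) (by push_cast; omega), insertAux,
    dif_neg (by omega), if_neg (by omega)]
  have ht := w.tail_lt
  refine F.normalOrder_congr h fun a b ha hb hab _ => ?_
  rw [insertAux_eq_of_le F (by omega), wedge]
  refine linearCombination_congr_of_mem (c := w.m 0) (fun w' hw' => ?_)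
        (F.wedge_mem (by omega) (single_mem_firstLT ht _))
  rw [insertAux_eq_of_le F (by omega), wedge, Finsupp.linearCombination_single, one_smul]

theorem wedge_wedge_self {m : ℤ} {v : FockSpace K} (hv : v ∈ firstLT K m) :
    F.wedge m (F.wedge m v) = 0 := by
  have hle : firstLT K m ≤ LinearMap.ker (F.wedge m ∘ₗ F.wedge m) :=
    firstLT_induction fun w hw => by
      rw [LinearMap.mem_ker, LinearMap.comp_apply, F.wedge_single_of_lt hw]
      exact F.wedge_single_self (w.cons m hw)
  exact hle hv

/-- This is the definition of insertion, because `u_m ∧ v` is already normally ordered. Removing the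
bound on `v` is the consistency statement `wedge_wedge_eq_normalOrder`. -/
theorem wedge_wedge {l m : ℤ} (hlm : l < m) {v : FockSpace K} (hv : v ∈ firstLT K m) :
    F.wedge l (F.wedge m v) = F.normalOrder l m fun a b => F.wedge a (F.wedge b v) := by
  have e : ∀ v, F.normalOrder l m (fun a b => F.wedge a (F.wedge b v)) =
      (F.normalOrder l m fun a b => F.wedge a ∘ₗ F.wedge b) v := fun v =>
    (F.normalOrder_map (LinearMap.applyₗ v) l m fun a b => F.wedge a ∘ₗ F.wedge b).symm
  have hle : firstLT K m ≤ LinearMap.eqLocus (F.wedge l ∘ₗ F.wedge m)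
      (F.normalOrder l m fun a b => F.wedge a ∘ₗ F.wedge b) :=
    firstLT_induction fun w hw => by
      rw [LinearMap.mem_eqLocus, ← e, LinearMap.comp_apply, F.wedge_single_of_lt hw]
      exact F.wedge_single_of_gt (w := w.cons m hw) hlm
  rw [e]
  exact hle hv

/-- Induction on wedges with first index in `[d, c)`. -/
theorem eqOn_firstLT_of_wedge {E : Type*} [AddCommGroup E] [Module K E]
    {f g : FockSpace K →ₗ[K] E} {c d : ℤ}
    (base : ∀ v ∈ firstLT K d, f v = g v)
    (step : ∀ p, d ≤ p → p < c → (∀ v ∈ firstLT K p, f v = g v) →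
      ∀ v ∈ firstLT K p, f (F.wedge p v) = g (F.wedge p v)) :
    ∀ v ∈ firstLT K c, f v = g v := by
  have key : ∀ k : ℕ, d + k ≤ c → ∀ v ∈ firstLT K (d + k), f v = g v := by
    intro k
    induction k with
    | zero => intro _ v hv; exact base v (by simpa using hv)
    | succ k ih =>
      intro hk
      push_cast at hk
      have ih := ih (by omega)
      have hle : firstLT K (d + (k + 1 : ℕ)) ≤ LinearMap.eqLocus f g :=
        firstLT_induction fun w hw => by
          rw [LinearMap.mem_eqLocus]
          push_cast at hw
          by_cases h : w.m 0 < d + k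
          · exact ih _ (single_mem_firstLT h 1)
          · have h' : w.m 0 = d + k := by omega
            have ht := w.tail_lt
            rw [← F.wedge_tail w, h']
            exact step _ (by omega) (by omega) ih _ (single_mem_firstLT (by omega) 1)
      exact fun v hv => hle hv
  intro v hv
  by_cases h : c ≤ d
  · exact base v (firstLT_mono h hv)
  · exact key (c - d).toNat (by omega) v (by convert hv using 2; omega)

end Insert

/-! ## Vacua -/

end MetaplecticData

namespace NormalWedge

/-- A vacuum: the indices decrease by one at each step. -/
def IsVacuum (w : NormalWedge) : Prop := ∀ i, w.m (i + 1) = w.m i - 1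

theorem IsVacuum.tail {w : NormalWedge} (h : w.IsVacuum) : w.tail.IsVacuum :=
  fun i => h (i + 1)

/-- Every wedge is obtained from a vacuum by putting finitely many factors in front. -/
theorem induction_tail {P : NormalWedge → Prop} (base : ∀ w, w.IsVacuum → P w)
    (step : ∀ w, P w.tail → P w) (w : NormalWedge) : P w := by
  obtain ⟨R, hR⟩ := w.eventually
  induction R generalizing w with
  | zero => exact base w fun i => hR i (Nat.zero_le i)
  | succ R ih => exact step w (ih w.tail fun i hi => hR (i + 1) (by omega))

end NormalWedge

namespace MetaplecticData

variable {n : ℕ} {K : Type*} [Field K] (F : MetaplecticData n K)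

theorem current_single (k : ℤ) (w : NormalWedge) :
    F.current k (Finsupp.single w 1) = ∑ᶠ i : ℕ, F.moveFactor k i w := by
  simp [current]

variable [NeZero n]

/-- In each term `u_a ∧ u_b ∧ w.tail` of the normal ordering, `b < a ≤ w.m 0` puts `b` at or below
the first index of the vacuum `w.tail`, with a smaller gap; so the inner wedge is already zero. -/
theorem wedge_vacuum {w : NormalWedge} (hw : w.IsVacuum) {j : ℤ} (hj : j ≤ w.m 0) :
    F.wedge j (Finsupp.single w 1) = 0 := by
  obtain ⟨d, hd⟩ : ∃ d : ℕ, w.m 0 - j = d := ⟨(w.m 0 - j).toNat, by omega⟩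
  induction d using Nat.strong_induction_on generalizing w j with
  | _ d ih =>
    rcases hj.eq_or_lt with h | h
    · rw [h, wedge_single_self]
    · rw [F.wedge_single_of_gt h]
      have ht : w.tail.m 0 = w.m 0 - 1 := hw 0
      refine (Submodule.mem_bot K).1 (F.normalOrder_mem h _ fun a b h1 h2 h3 _ => ?_)
      rw [ih (w.tail.m 0 - b).toNat (by omega) hw.tail (by omega) (by omega), map_zero]
      exact Submodule.zero_mem _

/-- Two linear maps agree if they agree on vacua and agreement is preserved by putting a larger
factor in front. -/
theorem linearMap_ext_of_wedge {E : Type*} [AddCommGroup E] [Module K E]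
    {f g : FockSpace K →ₗ[K] E}
    (base : ∀ w : NormalWedge, w.IsVacuum → f (Finsupp.single w 1) = g (Finsupp.single w 1))
    (step : ∀ p, ∀ v ∈ firstLT K p, f v = g v → f (F.wedge p v) = g (F.wedge p v)) :
    f = g := by
  refine Finsupp.lhom_ext' fun w => LinearMap.ext_ring ?_
  change f (Finsupp.single w 1) = g (Finsupp.single w 1)
  induction w using NormalWedge.induction_tail with
  | base w hw => exact base w hw
  | step w ih =>
    rw [← F.wedge_tail w]
    exact step _ _ (single_mem_firstLT w.tail_lt 1) ih

/-! ## The current operators -/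

theorem moveFactor_vacuum {k : ℤ} (hk : 0 < k) (i : ℕ) {w : NormalWedge} (hw : w.IsVacuum) :
    F.moveFactor k i w = 0 := by
  have hn : (0 : ℤ) < n := by exact_mod_cast Nat.pos_of_ne_zero (NeZero.ne n)
  induction i generalizing w with
  | zero =>
    have ht : w.tail.m 0 = w.m 0 - 1 := hw 0
    rw [moveFactor, F.wedge_vacuum hw.tail]
    nlinarith [mul_pos hk hn]
  | succ i ih => rw [moveFactor, ih hw.tail, map_zero]

theorem moveFactor_support_finite {k : ℤ} (hk : 0 < k) (w : NormalWedge) :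
    (Function.support fun i => F.moveFactor k i w).Finite := by
  induction w using NormalWedge.induction_tail with
  | base w hw =>
    convert Set.finite_empty (α := ℕ)
    ext i
    simp [F.moveFactor_vacuum hk i hw]
  | step w ih =>
    refine Set.Finite.subset ((Set.finite_singleton 0).union (ih.image Nat.succ)) fun i hi => ?_
    cases i with
    | zero => exact Or.inl rfl
    | succ i =>
      refine Or.inr ⟨i, ?_, rfl⟩
      intro h
      apply hi
      simp only [moveFactor]
      change F.moveFactor k i w.tail = 0 at h
      rw [h, map_zero]

theorem current_vacuum {k : ℤ} (hk : 0 < k) {w : NormalWedge} (hw : w.IsVacuum) :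
    F.current k (Finsupp.single w 1) = 0 := by
  rw [current_single]
  simp [F.moveFactor_vacuum hk _ hw]

/-- Here `u_p ∧ v` is normally ordered, so the sum over factors in the definition of `J_k` splits
into its first term and the rest. -/
theorem current_wedge_of_mem {k : ℤ} (hk : 0 < k) {p : ℤ} {v : FockSpace K}
    (hv : v ∈ firstLT K p) :
    F.current k (F.wedge p v) = F.wedge (p - k * n) v + F.wedge p (F.current k v) := by
  have hle : firstLT K p ≤ LinearMap.eqLocus (F.current k ∘ₗ F.wedge p)
      (F.wedge (p - k * n) + F.wedge p ∘ₗ F.current k) :=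
    firstLT_induction fun w hw => by
      rw [LinearMap.mem_eqLocus, LinearMap.comp_apply, F.wedge_single_of_lt hw, current_single,
        LinearMap.add_apply, LinearMap.comp_apply, current_single,
        finsum_nat_succ (F.moveFactor_support_finite hk _),
        map_finsum (F.wedge p) (F.moveFactor_support_finite hk w)]
      rfl
  exact hle hv

theorem current_mem {k : ℤ} (hk : 0 < k) {c : ℤ} {v : FockSpace K} (hv : v ∈ firstLT K c) :
    F.current k v ∈ firstLT K c := by
  have hn : (0 : ℤ) < n := by exact_mod_cast Nat.pos_of_ne_zero (NeZero.ne n)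
  have hle : firstLT K c ≤ (firstLT K c).comap (F.current k) :=
    firstLT_induction fun w hw => by
      rw [Submodule.mem_comap]
      clear hv
      induction w using NormalWedge.induction_tail generalizing c with
      | base w hw' => rw [F.current_vacuum hk hw']; exact Submodule.zero_mem _
      | step w ih =>
        have hm := single_mem_firstLT w.tail_lt (1 : K)
        rw [← F.wedge_tail w, F.current_wedge_of_mem hk hm]
        have h1 : 0 < k * n := mul_pos hk hn
        refine Submodule.add_mem _ (F.wedge_mem (by omega) (firstLT_mono hw.le hm)) ?_
        exact F.wedge_mem hw (firstLT_mono hw.le (ih w.tail_lt))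
  exact hle hv

end MetaplecticData

/-! ## Relations between wedge operators with close indices -/

namespace MetaplecticData

variable {n : ℕ} {K : Type*} [Field K] (F : MetaplecticData n K)

theorem g_mul_g_neg {a : ZMod n} (ha : a ≠ 0) : F.g a * F.g (-a) = F.q ^ 2 := by
  have h := F.α_mul_neg a
  simp only [g, ha, neg_eq_zero, if_false]
  linear_combination F.q ^ 2 * h

theorem intCast_ne_zero_of_lt {a : ℤ} (h0 : 0 < a) (h1 : a < n) : (a : ZMod n) ≠ 0 := by
  rw [Ne, ZMod.intCast_zmod_eq_zero_iff_dvd]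
  exact fun h => absurd (Int.le_of_dvd h0 h) (by omega)

theorem g_sub_mul_g_sub {a b : ℤ} (h0 : a < b) (h1 : b < a + n) :
    F.g ((a - b : ℤ) : ZMod n) * F.g ((b - a : ℤ) : ZMod n) = F.q ^ 2 := by
  have h := F.g_mul_g_neg (intCast_ne_zero_of_lt (n := n) (a := b - a) (by omega) (by omega))
  rw [mul_comm, ← h, ← Int.cast_neg, neg_sub]

theorem intCast_sub_natCast (a : ℤ) : ((a - n : ℤ) : ZMod n) = a := by simp

section NormalOrder

variable {E : Type*} [AddCommGroup E] [Module K E]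

theorem normalOrder_near {l m : ℤ} (h0 : l < m) (h1 : m < l + n) (U : ℤ → ℤ → E) :
    F.normalOrder l m U = F.g ((l - m : ℤ) : ZMod n) • U m l := by
  have hi : (m - l) % (n : ℤ) = m - l := Int.emod_eq_of_lt (by omega) (by omega)
  rw [F.normalOrder_of_emod_ne_zero (by omega), hi, Finset.sum_eq_zero, smul_zero, add_zero]
  intro t _
  have ht : (0 : ℤ) ≤ t * n := by positivity
  rw [if_neg (by omega), if_neg (by linarith), add_zero, smul_zero]

theorem normalOrder_add_natCast (l : ℤ) (U : ℤ → ℤ → E) :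
    F.normalOrder l (l + n) U = - U (l + n) l :=
  F.normalOrder_of_emod_eq_zero (by simp) U

/-- For a difference strictly between `n` and `2n` the term `t = 0` of the first kind is the only
correction still in normal order. -/
theorem normalOrder_second {l m : ℤ} (h0 : l + n < m) (h1 : m < l + 2 * n) (U : ℤ → ℤ → E) :
    F.normalOrder l m U =
      F.g ((l - m : ℤ) : ZMod n) • U m l + (F.q ^ 2 - 1) • U (l + n) (m - n) := by
  have hi : (m - l) % (n : ℤ) = m - l - n := by
    rw [← Int.sub_emod_right]
    exact Int.emod_eq_of_lt (by omega) (by omega)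
  rw [F.normalOrder_of_emod_ne_zero (by omega), hi,
    Finset.sum_eq_single_of_mem 0 (by simp; omega)]
  · rw [if_pos (by push_cast; linarith), if_neg (by push_cast; linarith)]
    simp only [pow_zero, one_smul, add_zero, Nat.cast_zero, zero_mul, sub_zero]
    congr 3 <;> ring
  · intro t _ ht
    have ht : (1 : ℤ) ≤ t := by omega
    have ht' : (n : ℤ) ≤ t * n := by nlinarith
    rw [if_neg (by linarith), if_neg (by linarith), add_zero, smul_zero]

end NormalOrder

variable [NeZero n]

theorem wedge_near_of_mem {l m : ℤ} (h0 : l < m) (h1 : m < l + n) {v : FockSpace K}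
    (hv : v ∈ firstLT K m) :
    F.wedge l (F.wedge m v) = F.g ((l - m : ℤ) : ZMod n) • F.wedge m (F.wedge l v) := by
  rw [F.wedge_wedge h0 hv, F.normalOrder_near h0 h1]

theorem wedge_sub_natCast_of_mem {m : ℤ} {v : FockSpace K} (hv : v ∈ firstLT K m) :
    F.wedge (m - n) (F.wedge m v) = -F.wedge m (F.wedge (m - n) v) := by
  have hn : (0 : ℤ) < n := by exact_mod_cast Nat.pos_of_ne_zero (NeZero.ne n)
  rw [F.wedge_wedge (by omega) hv]
  have h := F.normalOrder_add_natCast (m - n) fun a b => F.wedge a (F.wedge b v)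
  rwa [sub_add_cancel] at h

theorem wedge_second_of_mem {l m : ℤ} (h0 : l + n < m) (h1 : m < l + 2 * n) {v : FockSpace K}
    (hv : v ∈ firstLT K m) :
    F.wedge l (F.wedge m v) = F.g ((l - m : ℤ) : ZMod n) • F.wedge m (F.wedge l v) +
      (F.q ^ 2 - 1) • F.wedge (l + n) (F.wedge (m - n) v) := by
  rw [F.wedge_wedge (by omega) hv, F.normalOrder_second h0 h1]

/-- A first factor `u_p` with `b < p < a + n` is close to both `a` and `b`, so both operators pass
it at the cost of scalars, which are the same on the two sides. For `p = b` both sides vanish. -/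
theorem wedge_near_of_mem_left {a b : ℤ} (h0 : a < b) (h1 : b < a + n) :
    ∀ v ∈ firstLT K (a + n),
    F.wedge a (F.wedge b v) = F.g ((a - b : ℤ) : ZMod n) • F.wedge b (F.wedge a v) := by
  refine F.eqOn_firstLT_of_wedge (f := F.wedge a ∘ₗ F.wedge b)
    (g := F.g ((a - b : ℤ) : ZMod n) • (F.wedge b ∘ₗ F.wedge a)) (d := b)
    (fun v hv => F.wedge_near_of_mem h0 h1 hv) fun p hp hpa ih v hv => ?_
  simp only [LinearMap.comp_apply, LinearMap.smul_apply] at ih ⊢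
  rcases hp.eq_or_lt with rfl | hp
  · rw [F.wedge_wedge_self hv, map_zero, F.wedge_near_of_mem h0 h1 hv, map_smul,
      F.wedge_wedge_self (F.wedge_mem h0 hv), smul_zero, smul_zero]
  · rw [F.wedge_near_of_mem hp (by omega) hv, F.wedge_near_of_mem (by omega) (by omega) hv,
      map_smul, map_smul, F.wedge_near_of_mem (by omega) (by omega) (F.wedge_mem hp hv),
      F.wedge_near_of_mem hp (by omega) (F.wedge_mem (by omega) hv), ih v hv, map_smul]
    module

theorem wedge_wedge_self_of_mem {a : ℤ} :
    ∀ v ∈ firstLT K (a + n), F.wedge a (F.wedge a v) = 0 := by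
  refine F.eqOn_firstLT_of_wedge (f := F.wedge a ∘ₗ F.wedge a) (g := 0) (d := a)
    (fun v hv => F.wedge_wedge_self hv) fun p hp hpa ih v hv => ?_
  simp only [LinearMap.comp_apply, LinearMap.zero_apply] at ih ⊢
  rcases hp.eq_or_lt with rfl | hp
  · rw [F.wedge_wedge_self hv, map_zero]
  · rw [F.wedge_near_of_mem hp (by omega) hv, map_smul,
      F.wedge_near_of_mem hp (by omega) (F.wedge_mem hp hv), ih v hv, map_zero, smul_zero,
      smul_zero]

theorem current_one_wedge_of_mem {p : ℤ} {v : FockSpace K} (hv : v ∈ firstLT K p) :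
    F.current 1 (F.wedge p v) = F.wedge (p - n) v + F.wedge p (F.current 1 v) := by
  simpa using F.current_wedge_of_mem one_pos hv

theorem current_one_mem {c : ℤ} {v : FockSpace K} (hv : v ∈ firstLT K c) :
    F.current 1 v ∈ firstLT K c :=
  F.current_mem one_pos hv

/-- The commutation relation of `J₁` and `u_l` on wedges with first index less than `l + n`. -/
theorem current_one_wedge_near {l : ℤ} : ∀ v ∈ firstLT K (l + n),
    F.current 1 (F.wedge l v) = F.wedge (l - n) v + F.wedge l (F.current 1 v) := by
  have hn : (0 : ℤ) < n := by exact_mod_cast Nat.pos_of_ne_zero (NeZero.ne n)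
  refine F.eqOn_firstLT_of_wedge (f := F.current 1 ∘ₗ F.wedge l)
    (g := F.wedge (l - n) + F.wedge l ∘ₗ F.current 1) (d := l)
    (fun v hv => F.current_one_wedge_of_mem hv) fun p hp hpl ih v hv => ?_
  simp only [LinearMap.comp_apply, LinearMap.add_apply] at ih ⊢
  rw [F.current_one_wedge_of_mem hv]
  rcases hp.eq_or_lt with rfl | hp
  · rw [F.wedge_wedge_self hv, map_zero, F.wedge_sub_natCast_of_mem hv, map_add,
      F.wedge_wedge_self (F.current_one_mem hv)]
    abel
  -- Moving `u_p` in `g(l-p) u_p ∧ u_l` gives `g(l-p) g(p-l) = q²` copies of `u_l ∧ u_{p-n}`. One of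
  -- them is the wanted term; the other `q² - 1` are the correction in the straightening of `u_{l-n}
  -- ∧ u_p`.
  · have h1 := F.wedge_near_of_mem_left (a := p - n) (b := l) (by omega) (by omega) v
      (by simpa using hv)
    have h2 := F.wedge_second_of_mem (l := l - n) (m := p) (by omega) (by omega) hv
    have h3 := F.g_sub_mul_g_sub hp hpl
    rw [show p - n - l = p - l - n by ring, intCast_sub_natCast] at h1
    rw [show l - n - p = l - p - n by ring, intCast_sub_natCast, sub_add_cancel] at h2
    rw [F.wedge_near_of_mem hp (by omega) hv, map_smul,
      F.current_one_wedge_of_mem (F.wedge_mem hp hv), ih v hv, map_add, map_add, h1, h2,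
      F.wedge_near_of_mem hp (by omega) (F.current_one_mem hv), smul_add, smul_smul, h3]
    module

/-- The new first factors `u_r`, `a + n ≤ r < b + n`, are far from `a` but close to `b`, so passing
`u_a` over `u_r` creates correction terms on both sides. This range is needed for the commutation of
`E₂`, where both factors have been lowered by `n`. -/
theorem wedge_near_of_mem_right {a b : ℤ} (h0 : a < b) (h1 : b < a + n) :
    ∀ v ∈ firstLT K (b + n),
    F.wedge a (F.wedge b v) = F.g ((a - b : ℤ) : ZMod n) • F.wedge b (F.wedge a v) := by
  refine F.eqOn_firstLT_of_wedge (f := F.wedge a ∘ₗ F.wedge b)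
    (g := F.g ((a - b : ℤ) : ZMod n) • (F.wedge b ∘ₗ F.wedge a)) (d := a + n)
    (F.wedge_near_of_mem_left h0 h1) fun r hr hrb ih v hv => ?_
  simp only [LinearMap.comp_apply, LinearMap.smul_apply] at ih ⊢
  have hbr : b < r := by omega
  rcases hr.eq_or_lt with rfl | hr
  · have h2 := F.wedge_sub_natCast_of_mem hv
    have h3 := F.wedge_sub_natCast_of_mem (F.wedge_mem hbr hv)
    rw [add_sub_cancel_right] at h2 h3
    rw [F.wedge_near_of_mem hbr (by omega) hv, map_smul, h3, h2, map_neg,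
      F.wedge_near_of_mem hbr (by omega) (F.wedge_mem (by omega) hv), ih v hv, map_smul]
    module
  · have h2 := F.wedge_second_of_mem (l := a) (m := r) hr (by omega) hv
    have h3 := F.wedge_second_of_mem (l := a) (m := r) hr (by omega) (F.wedge_mem hbr hv)
    have h4 := F.wedge_near_of_mem_left (a := r - n) (b := b) (by omega) (by omega) v
      (by simpa using hv)
    have h5 := F.wedge_near_of_mem_left (a := b) (b := a + n) (by omega) (by omega)
      (F.wedge (r - n) v) (F.wedge_mem (by omega) (firstLT_mono hrb.le hv))
    have h6 := F.g_sub_mul_g_sub h0 h1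
    have h7 := F.g_sub_mul_g_sub hbr hrb
    rw [show r - n - b = r - b - n by ring, intCast_sub_natCast] at h4
    rw [show b - (a + n) = b - a - n by ring, intCast_sub_natCast] at h5
    rw [F.wedge_near_of_mem hbr (by omega) hv, map_smul, h3, h2, map_add, map_smul, map_smul,
      F.wedge_near_of_mem hbr (by omega) (F.wedge_mem (by omega) hv), ih v hv, h4, h5, map_smul,
      map_smul]
    simp only [smul_add, smul_smul]
    -- The coefficients of the two correction terms agree: each is `(q² - 1) q²`.
    have h8 : F.g ((b - r : ℤ) : ZMod n) * ((F.q ^ 2 - 1) * F.g ((r - b : ℤ) : ZMod n)) =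
        F.g ((a - b : ℤ) : ZMod n) * ((F.q ^ 2 - 1) * F.g ((b - a : ℤ) : ZMod n)) := by
      linear_combination (F.q ^ 2 - 1) * (h7 - h6)
    rw [h8]
    module

/-! ## The second elementary symmetric function of the currents -/

/-- The operator `(J₁² - J₂) / 2`, which moves two distinct factors by `n`. -/
noncomputable def currentE₂ : FockSpace K →ₗ[K] FockSpace K :=
  (2 : K)⁻¹ • (F.current 1 ∘ₗ F.current 1 - F.current 2)

theorem currentE₂_mem {c : ℤ} {v : FockSpace K} (hv : v ∈ firstLT K c) :
    F.currentE₂ v ∈ firstLT K c :=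
  Submodule.smul_mem _ _ (Submodule.sub_mem _ (F.current_one_mem (F.current_one_mem hv))
    (F.current_mem two_pos hv))

variable [CharZero K]

/-- A single factor can be moved only once by `e₂`: the terms `u_{p-2n} ∧ v` of `J₁²` and `J₂`
cancel, and the two mixed terms of `J₁²` are halved into one. Applying `J₁` to `u_{p-n} ∧ v` is
covered by `current_one_wedge_near`, since `p = (p - n) + n`. -/
theorem currentE₂_wedge_of_mem {p : ℤ} {v : FockSpace K} (hv : v ∈ firstLT K p) :
    F.currentE₂ (F.wedge p v) =
      F.wedge p (F.currentE₂ v) + F.wedge (p - n) (F.current 1 v) := by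
  have h1 := F.current_one_wedge_near (l := p - n) v (by simpa using hv)
  have h2 := F.current_wedge_of_mem two_pos hv
  rw [show p - 2 * (n : ℤ) = p - n - n by ring] at h2
  simp only [currentE₂, LinearMap.smul_apply, LinearMap.sub_apply, LinearMap.comp_apply,
    F.current_one_wedge_of_mem hv, h2, map_add, map_sub, map_smul, h1,
    F.current_one_wedge_of_mem (F.current_one_mem hv)]
  module

theorem currentE₂_wedge_near {l : ℤ} : ∀ v ∈ firstLT K (l + n),
    F.currentE₂ (F.wedge l v) =
      F.wedge l (F.currentE₂ v) + F.wedge (l - n) (F.current 1 v) := by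
  have hn : (0 : ℤ) < n := by exact_mod_cast Nat.pos_of_ne_zero (NeZero.ne n)
  refine F.eqOn_firstLT_of_wedge (f := F.currentE₂ ∘ₗ F.wedge l)
    (g := F.wedge l ∘ₗ F.currentE₂ + F.wedge (l - n) ∘ₗ F.current 1) (d := l)
    (fun v hv => F.currentE₂_wedge_of_mem hv) fun p hp hpl ih v hv => ?_
  simp only [LinearMap.comp_apply, LinearMap.add_apply] at ih ⊢
  rw [F.current_one_wedge_of_mem hv, F.currentE₂_wedge_of_mem hv]
  rcases hp.eq_or_lt with rfl | hp
  · rw [F.wedge_wedge_self hv, map_zero, map_add, map_add,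
      F.wedge_wedge_self (F.currentE₂_mem hv), F.wedge_sub_natCast_of_mem (F.current_one_mem hv),
      F.wedge_wedge_self_of_mem (a := l - n) v (by simpa using hv)]
    abel
  · have hv1 := F.current_one_mem hv
    have h1 := F.wedge_near_of_mem_left (a := p - n) (b := l) (by omega) (by omega)
      (F.current 1 v) (by simpa using hv1)
    have h2 := F.wedge_second_of_mem (l := l - n) (m := p) (by omega) (by omega) hv1
    have h3 := F.g_sub_mul_g_sub hp hpl
    have h4 := F.wedge_near_of_mem_right (a := l - n) (b := p - n) (by omega) (by omega) v
      (by simpa using hv)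
    rw [show p - n - l = p - l - n by ring, intCast_sub_natCast] at h1
    rw [show l - n - p = l - p - n by ring, intCast_sub_natCast, sub_add_cancel] at h2
    rw [show l - n - (p - n) = l - p by ring] at h4
    rw [F.wedge_near_of_mem hp (by omega) hv, map_smul,
      F.currentE₂_wedge_of_mem (F.wedge_mem hp hv), ih v hv,
      F.current_one_wedge_near v (firstLT_mono hpl.le hv)]
    simp only [map_add]
    rw [h1, h2, h4, F.wedge_near_of_mem hp (by omega) (F.currentE₂_mem hv)]
    simp only [smul_add, smul_smul, h3]
    module

/-- The commutators with `u_p` are symmetric in the two operators, so commutativity propagates from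
the vacuum, where both vanish. It is needed before the commutation relations are known in general,
in `CommutesBelow.add_one`. -/
theorem current_one_comp_currentE₂ :
    F.current 1 ∘ₗ F.currentE₂ = F.currentE₂ ∘ₗ F.current 1 := by
  refine F.linearMap_ext_of_wedge (fun w hw => ?_) fun p v hv ih => ?_
  · simp [currentE₂, F.current_vacuum one_pos hw, F.current_vacuum two_pos hw]
  · simp only [LinearMap.comp_apply] at ih ⊢
    have hv1 := F.current_one_mem hv
    rw [F.currentE₂_wedge_of_mem hv, map_add,
      F.current_one_wedge_of_mem (F.currentE₂_mem hv),
      F.current_one_wedge_near (l := p - n) _ (by simpa using hv1), ih,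
      F.current_one_wedge_of_mem hv, map_add, F.currentE₂_wedge_of_mem hv1,
      F.currentE₂_wedge_near (l := p - n) _ (by simpa using hv)]
    abel

end MetaplecticData

/-! ## Two-factor relations -/

namespace MetaplecticData

variable {n : ℕ} {K : Type*} [Field K] (F : MetaplecticData n K)

section NormalOrder

variable {E : Type*} [AddCommGroup E] [Module K E]

/-- The normal ordering relation with the conditions for normal order solved for the summation
index. -/
theorem normalOrder_eq_sum {l i : ℤ} {N : ℕ} (hi0 : 0 < i) (hin : i < n) {R : ℕ}
    (hR : N ≤ R) (U : ℤ → ℤ → E) :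
    F.normalOrder l (l + N * n + i) U = F.g ((-i : ℤ) : ZMod n) • U (l + N * n + i) l +
      (F.q ^ 2 - 1) • ∑ t ∈ Finset.range R, (F.q ^ 2) ^ t •
      ((if 2 * t < N then U (l + N * n - t * n) (l + i + t * n) else 0) +
        (if 2 * t + 2 ≤ N then
          F.g ((-i : ℤ) : ZMod n) •
            U (l + N * n + i - (t + 1) * n) (l + (t + 1) * n) else 0)) := by
  have hn : (0 : ℤ) < n := by omega
  have hmod : (l + N * n + i - l) % (n : ℤ) = i := by
    rw [show l + N * n + i - l = i + N * n by ring, Int.add_mul_emod_self_right]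
    exact Int.emod_eq_of_lt hi0.le hin
  have hg : ((l - (l + N * n + i) : ℤ) : ZMod n) = ((-i : ℤ) : ZMod n) := by
    push_cast
    simp
  rw [F.normalOrder_of_emod_ne_zero (by omega), hmod, hg]
  have hA : ∀ t : ℕ, (l + i + t * n < l + N * n + i - i - t * n) ↔ 2 * t < N := by
    intro t
    constructor
    · intro h
      by_contra h'
      have : (N : ℤ) ≤ 2 * t := by omega
      nlinarith
    · intro h
      have : (2 * t + 1 : ℤ) ≤ N := by omega
      nlinarith
  have hB : ∀ t : ℕ, (l + (t + 1) * n < l + N * n + i - (t + 1) * n) ↔ 2 * t + 2 ≤ N := by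
    intro t
    constructor
    · intro h
      by_contra h'
      have : (N : ℤ) + 1 ≤ 2 * t + 2 := by omega
      nlinarith
    · intro h
      have : (2 * t + 2 : ℤ) ≤ N := by omega
      nlinarith
  simp only [hA, hB]
  congr 2
  have hN : N ≤ (l + N * n + i - l).toNat := by
    have : (N : ℤ) ≤ N * n := by nlinarith [Int.natCast_nonneg N]
    omega
  have hz : ∀ (S : ℕ), N ≤ S → ∀ V : ℕ → E, (∀ t, N ≤ t → V t = 0) →
      ∑ t ∈ Finset.range S, V t = ∑ t ∈ Finset.range N, V t := by
    intro S hS V hV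
    refine (Finset.sum_subset (by simpa using hS) fun t _ ht => hV t ?_).symm
    simpa using ht
  rw [hz _ hN, hz _ hR]
  · refine Finset.sum_congr rfl fun t _ => ?_
    congr 3
    congr 1
    ring
  all_goals
    intro t ht
    by_cases h0 : t = 0
    · rw [if_neg (by omega), if_neg (by omega), add_zero, smul_zero]
    · rw [if_neg (by omega), if_neg (by omega), add_zero, smul_zero]

variable [NeZero n]

/-- Moving either of the two factors is compatible with normal ordering. -/
theorem normalOrder_move {m p : ℤ} (hmp : m + n < p) {U : ℤ → ℤ → E}
    (hU : ∀ x y : ℤ, y < x → x < y + n → x + y = m + p - n →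
      U y x = F.g ((y - x : ℤ) : ZMod n) • U x y) :
    F.normalOrder m p (fun a b => U (a - n) b + U a (b - n)) =
      F.normalOrder (m - n) p U + F.normalOrder m (p - n) U := by
  have hn : (0 : ℤ) < n := by exact_mod_cast Nat.pos_of_ne_zero (NeZero.ne n)
  by_cases h0 : (p - m) % (n : ℤ) = 0
  · rw [F.normalOrder_of_emod_eq_zero h0, F.normalOrder_of_emod_eq_zero,
      F.normalOrder_of_emod_eq_zero]
    · abel
    · rw [show p - n - m = p - m - n by ring, Int.sub_emod_right, h0]
    · rw [show p - (m - n) = p - m + n by ring, Int.add_emod_right, h0]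
  set i := (p - m) % (n : ℤ) with hi
  have hi0 : 0 < i := lt_of_le_of_ne (Int.emod_nonneg _ hn.ne') (Ne.symm h0)
  have hin : i < n := Int.emod_lt_of_pos _ hn
  -- The three normal orderings involve gaps `(N+1)n + i`, `(N+2)n + i` and `Nn + i`; the hypothesis
  -- `m + n < p` makes `N` a natural number.
  obtain ⟨N, hN⟩ : ∃ N : ℕ, p = m + (N + 1 : ℕ) * n + i := by
    have h1 := Int.emod_add_mul_ediv (p - m) n
    have h2 : 1 ≤ (p - m) / n := (Int.le_ediv_iff_mul_le hn).2 (by linarith)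
    refine ⟨((p - m) / n - 1).toNat, ?_⟩
    push_cast
    rw [Int.toNat_of_nonneg (by omega)]
    linarith
  clear_value i
  subst hN
  set γ := F.g ((-i : ℤ) : ZMod n)
  -- All pairs that occur have sum `m + p - n` and entries in the two residue classes of `m` and
  -- `p`. They form two sequences: in `α` the first entry is congruent to `m`, in `β` to `p`.
  set α : ℕ → E := fun t => U (m + (N + 1 : ℕ) * n - t * n) (m - n + i + t * n) with hα
  set β : ℕ → E := fun t => U (m + (N + 1 : ℕ) * n + i - t * n) (m - n + t * n) with hβ
  have e1 := F.normalOrder_eq_sum (l := m) (N := N + 1) hi0 hin (R := N + 2) (by omega)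
    (fun a b => U (a - n) b + U a (b - n))
  have e2 := F.normalOrder_eq_sum (l := m - n) (N := N + 2) hi0 hin (R := N + 2) (by omega) U
  have e3 := F.normalOrder_eq_sum (l := m) (N := N) hi0 hin (R := N + 2) (by omega) U
  have f2 : m + (N + 1 : ℕ) * (n : ℤ) + i = m - n + (N + 2 : ℕ) * n + i := by
    push_cast; ring
  have f3 : m + (N + 1 : ℕ) * (n : ℤ) + i - n = m + N * n + i := by
    push_cast; ring
  rw [← f2] at e2
  rw [f3, e3, e1, e2]
  have a0 : ∀ t : ℕ, U (m + (N + 1 : ℕ) * n - t * n - n) (m + i + t * n) = α (t + 1) := by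
    intro t; simp only [hα]; congr 1 <;> push_cast <;> ring
  have a1 : ∀ t : ℕ, U (m + (N + 1 : ℕ) * n - t * n) (m + i + t * n - n) = α t := by
    intro t; simp only [hα]; congr 1; ring
  have a2 : ∀ t : ℕ, U (m - n + (N + 2 : ℕ) * n - t * n) (m - n + i + t * n) = α t := by
    intro t; simp only [hα]; congr 1; push_cast; ring
  have a3 : ∀ t : ℕ, U (m + N * n - t * n) (m + i + t * n) = α (t + 1) := by
    intro t; simp only [hα]; congr 1 <;> push_cast <;> ring
  have b0 : ∀ t : ℕ, U (m + (N + 1 : ℕ) * n + i - (t + 1) * n - n) (m + (t + 1) * n) =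
      β (t + 2) := by
    intro t; simp only [hβ]; congr 1 <;> push_cast <;> ring
  have b1 : ∀ t : ℕ, U (m + (N + 1 : ℕ) * n + i - (t + 1) * n) (m + (t + 1) * n - n) =
      β (t + 1) := by
    intro t; simp only [hβ]; congr 1; push_cast; ring
  have b2 : ∀ t : ℕ, U (m + (N + 1 : ℕ) * n + i - (t + 1) * n) (m - n + (t + 1) * n) =
      β (t + 1) := by
    intro t; simp only [hβ]; congr 1
  have b3 : ∀ t : ℕ, U (m + N * n + i - (t + 1) * n) (m + (t + 1) * n) = β (t + 2) := by
    intro t; simp only [hβ]; congr 1 <;> push_cast <;> ring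
  have c0 : U (m + (N + 1 : ℕ) * n + i - n) m = β 1 := by
    simp only [hβ]; congr 1 <;> push_cast <;> ring
  have c1 : U (m + (N + 1 : ℕ) * n + i) (m - n) = β 0 := by
    simp only [hβ]; congr 1 <;> push_cast <;> ring
  have c3 : U (m + N * n + i) m = β 1 := by
    simp only [hβ]; congr 1 <;> push_cast <;> ring
  simp only [a0, a1, a2, a3, b0, b1, b2, b3, c0, c1, c3]
  -- Termwise the two sides agree except near `2t = N`, where the three normal-order cutoffs differ.
  -- For `N = 2k` the mismatch is `α (k+1)` against `γ • β (k+1)`, a single close pair in its two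
  -- orders, and `hU` identifies them.
  have key : ∑ t ∈ Finset.range (N + 2), (F.q ^ 2) ^ t •
      ((if 2 * t < N + 1 then α (t + 1) + α t else 0) +
        if 2 * t + 2 ≤ N + 1 then γ • (β (t + 2) + β (t + 1)) else 0) =
      ∑ t ∈ Finset.range (N + 2), (F.q ^ 2) ^ t •
      ((if 2 * t < N + 2 then α t else 0) + if 2 * t + 2 ≤ N + 2 then γ • β (t + 1) else 0) +
      ∑ t ∈ Finset.range (N + 2), (F.q ^ 2) ^ t •
      ((if 2 * t < N then α (t + 1) else 0) + if 2 * t + 2 ≤ N then γ • β (t + 2) else 0) := by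
    rw [← Finset.sum_add_distrib, ← sub_eq_zero, ← Finset.sum_sub_distrib]
    rcases Nat.even_or_odd' N with ⟨k, hk | hk⟩
    · refine Finset.sum_eq_zero fun t _ => ?_
      by_cases htk : t = k
      · have hs := hU (m - n + i + (k + 1 : ℕ) * n) (m + (N + 1 : ℕ) * n - (k + 1 : ℕ) * n)
          (by rw [hk]; push_cast; linarith) (by rw [hk]; push_cast; linarith)
          (by push_cast; ring)
        have hs1 : ((m + (N + 1 : ℕ) * n - (k + 1 : ℕ) * n - (m - n + i + (k + 1 : ℕ) * n) : ℤ) :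
            ZMod n) = ((-i : ℤ) : ZMod n) := by
          push_cast; simp
        have hs2 : U (m - n + i + (k + 1 : ℕ) * n) (m + (N + 1 : ℕ) * n - (k + 1 : ℕ) * n) =
            β (k + 1) := by
          simp only [hβ, hk]; congr 1 <;> push_cast <;> ring
        rw [hs1, hs2] at hs
        change α (k + 1) = γ • β (k + 1) at hs
        rw [htk, if_pos (by omega), if_neg (by omega), if_pos (by omega), if_pos (by omega),
          if_neg (by omega), if_neg (by omega), hs]
        module
      · by_cases hlt : t < k
        · rw [if_pos (by omega), if_pos (by omega), if_pos (by omega), if_pos (by omega),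
            if_pos (by omega), if_pos (by omega)]
          module
        · rw [if_neg (by omega), if_neg (by omega), if_neg (by omega), if_neg (by omega),
            if_neg (by omega), if_neg (by omega)]
          module
    -- For `N = 2k + 1` the mismatch sits in two consecutive terms: `γ • β (k+2)` at `t = k` against
    -- `q² • α (k+1)` at `t = k + 1`. They cancel by `hU` for the opposite residue, because `g(-i)
    -- g(i) = q²`.
    · have hterm : ∀ t : ℕ, (F.q ^ 2) ^ t •
          ((if 2 * t < N + 1 then α (t + 1) + α t else 0) +
            if 2 * t + 2 ≤ N + 1 then γ • (β (t + 2) + β (t + 1)) else 0) -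
          ((F.q ^ 2) ^ t •
          ((if 2 * t < N + 2 then α t else 0) + if 2 * t + 2 ≤ N + 2 then γ • β (t + 1) else 0) +
          (F.q ^ 2) ^ t •
          ((if 2 * t < N then α (t + 1) else 0) + if 2 * t + 2 ≤ N then γ • β (t + 2) else 0)) =
          (if t = k then ((F.q ^ 2) ^ k * γ) • β (k + 2) else 0) +
            if t = k + 1 then -((F.q ^ 2) ^ (k + 1) • α (k + 1)) else 0 := by
        intro t
        rcases lt_trichotomy t k with h | h | h
        · rw [if_pos (by omega), if_pos (by omega), if_pos (by omega), if_pos (by omega),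
            if_pos (by omega), if_pos (by omega), if_neg (by omega), if_neg (by omega)]
          module
        · subst h
          rw [if_pos (by omega), if_pos (by omega), if_pos (by omega), if_pos (by omega),
            if_pos (by omega), if_neg (by omega), if_pos rfl, if_neg (by omega)]
          module
        · by_cases h' : t = k + 1
          · subst h'
            rw [if_neg (by omega), if_neg (by omega), if_pos (by omega), if_neg (by omega),
              if_neg (by omega), if_neg (by omega), if_neg (by omega), if_pos rfl]
            module
          · rw [if_neg (by omega), if_neg (by omega), if_neg (by omega), if_neg (by omega),
              if_neg (by omega), if_neg (by omega), if_neg (by omega), if_neg h']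
            module
      rw [Finset.sum_congr rfl fun t _ => hterm t, Finset.sum_add_distrib, Finset.sum_ite_eq',
        Finset.sum_ite_eq', if_pos (by simp; omega), if_pos (by simp; omega)]
      have hs := hU (m + (N + 1 : ℕ) * n - (k + 1 : ℕ) * n) (m - n + i + (k + 1 : ℕ) * n)
          (by rw [hk]; push_cast; linarith) (by rw [hk]; push_cast; linarith)
          (by push_cast; ring)
      have hs1 : ((m - n + i + (k + 1 : ℕ) * n - (m + (N + 1 : ℕ) * n - (k + 1 : ℕ) * n) : ℤ) :
            ZMod n) = (i : ZMod n) := by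
          push_cast; simp
      have hs2 : U (m - n + i + (k + 1 : ℕ) * n) (m + (N + 1 : ℕ) * n - (k + 1 : ℕ) * n) =
            β (k + 2) := by
          simp only [hβ, hk]; congr 1 <;> push_cast <;> ring
      rw [hs1, hs2] at hs
      change β (k + 2) = F.g (i : ZMod n) • α (k + 1) at hs
      have hg : γ * F.g (i : ZMod n) = F.q ^ 2 := by
        have := F.g_mul_g_neg (intCast_ne_zero_of_lt hi0 hin)
        rw [← this, mul_comm, ← Int.cast_neg]
      rw [hs, smul_smul, mul_assoc, hg, pow_succ]
      module
  rw [key]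
  module

end NormalOrder

end MetaplecticData

/-! ## Formal combinations of pairs of factors -/

namespace MetaplecticData

variable {n : ℕ} {K : Type*} [Field K] (F : MetaplecticData n K)

/-- The wedge `u_a ∧ u_b ∧ v`, linearly in the pair `(a, b)`. -/
noncomputable def pairWedge (v : FockSpace K) : (ℤ × ℤ →₀ K) →ₗ[K] FockSpace K :=
  Finsupp.linearCombination K fun ab => F.wedge ab.1 (F.wedge ab.2 v)

variable (K) in
/-- The shift of the pair `(a, b)` to `(a - s, b - t)`. -/
noncomputable def pairShift (s t : ℤ) : (ℤ × ℤ →₀ K) →ₗ[K] (ℤ × ℤ →₀ K) :=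
  Finsupp.lmapDomain K K fun ab => (ab.1 - s, ab.2 - t)

theorem pairShift_pairShift (s t s' t' : ℤ) (c : ℤ × ℤ →₀ K) :
    pairShift K s t (pairShift K s' t' c) = pairShift K (s + s') (t + t') c := by
  simp only [pairShift, Finsupp.lmapDomain_apply, ← Finsupp.mapDomain_comp]
  congr 1
  funext ab
  simp only [Function.comp_apply]
  congr 1 <;> ring

/-- The relations between the wedges `u_a ∧ u_b`. -/
noncomputable def pairRelations : Submodule K (ℤ × ℤ →₀ K) :=
  ⨅ v : FockSpace K, LinearMap.ker (F.pairWedge v)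

theorem mem_pairRelations {c : ℤ × ℤ →₀ K} :
    c ∈ F.pairRelations ↔ ∀ v, F.pairWedge v c = 0 := by
  simp [pairRelations, Submodule.mem_iInf]

end MetaplecticData

/-! ## The exchange relations and the commutation relations with the currents -/

namespace MetaplecticData

variable {n : ℕ} {K : Type*} [Field K] (F : MetaplecticData n K) [NeZero n]

/-- The commutation relations of `u_m` with `J₁` and `(J₁² - J₂) / 2`, for all `m`, on wedges with
first index less than `m + k`. -/
def CommutesBelow (k : ℤ) : Prop :=
  ∀ m, ∀ v ∈ firstLT K (m + k),
    F.current 1 (F.wedge m v) = F.wedge (m - n) v + F.wedge m (F.current 1 v) ∧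
    F.currentE₂ (F.wedge m v) = F.wedge m (F.currentE₂ v) + F.wedge (m - n) (F.current 1 v)

variable {F} in
theorem CommutesBelow.current_one_wedge_wedge {k : ℤ} (hk : F.CommutesBelow k) {a b c : ℤ}
    (hb : c ≤ b + k) (ha : c ≤ a + k) (hba : b < a + k) {v : FockSpace K}
    (hv : v ∈ firstLT K c) :
    F.current 1 (F.wedge a (F.wedge b v)) =
      (F.wedge (a - n) (F.wedge b v) + F.wedge a (F.wedge (b - n) v)) +
        F.wedge a (F.wedge b (F.current 1 v)) := by
  rw [(hk a _ (F.wedge_mem hba (firstLT_mono ha hv))).1, (hk b v (firstLT_mono hb hv)).1,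
    map_add, add_assoc]

variable {F} in
theorem CommutesBelow.currentE₂_wedge_wedge {k : ℤ} (hk : F.CommutesBelow k) {a b c : ℤ}
    (hb : c ≤ b + k) (ha : c ≤ a + k) (hba : b < a + k) {v : FockSpace K}
    (hv : v ∈ firstLT K c) :
    F.currentE₂ (F.wedge a (F.wedge b v)) =
      (F.wedge (a - n) (F.wedge (b - n) v) +
        (F.wedge (a - n) (F.wedge b (F.current 1 v)) +
          F.wedge a (F.wedge (b - n) (F.current 1 v)))) +
        F.wedge a (F.wedge b (F.currentE₂ v)) := by
  rw [(hk a _ (F.wedge_mem hba (firstLT_mono ha hv))).2, (hk b v (firstLT_mono hb hv)).1,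
    (hk b v (firstLT_mono hb hv)).2, map_add, map_add]
  abel

variable {F} in
-- The relation for `(l, m)` is the relation for `(l+n, m+n)` with both factors moved, and `E₂`
-- moves both. Applying `E₂` also yields terms with one factor moved, on `J₁ v`, and with none
-- moved, on `E₂ v`. These cancel by the relation for `(l+n, m+n)` and by its image under `J₁`.
theorem CommutesBelow.wedge_wedge {k : ℤ} (hk : F.CommutesBelow k) {l m c : ℤ}
    (hlm : l < m) (hml : m < l + k) (hc : c ≤ l + n + k) :
    ∀ v ∈ firstLT K c,
      F.wedge l (F.wedge m v) = F.normalOrder l m fun a b => F.wedge a (F.wedge b v) := by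
  have hn : (0 : ℤ) < n := by exact_mod_cast Nat.pos_of_ne_zero (NeZero.ne n)
  -- The induction raises `m` in steps of `n` until `c ≤ m`, where the relation is the definition.
  obtain ⟨j, hj⟩ : ∃ j : ℕ, c ≤ m + j := ⟨(c - m).toNat, by omega⟩
  induction j using Nat.strong_induction_on generalizing l m with
  | _ j ih =>
    intro v hv
    by_cases hcm : c ≤ m
    · exact F.wedge_wedge hlm (firstLT_mono hcm hv)
    have ih' : ∀ v ∈ firstLT K c, F.wedge (l + n) (F.wedge (m + n) v) =
        F.normalOrder (l + n) (m + n) fun a b => F.wedge a (F.wedge b v) := by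
      by_cases h : c ≤ m + n
      · exact fun v hv => F.wedge_wedge (by omega) (firstLT_mono h hv)
      · exact ih (c - (m + n)).toNat (by omega) (by omega) (by omega) (by omega) (by omega)
    have h1 : ∀ u ∈ firstLT K c,
        F.wedge (l + n - n) (F.wedge (m + n) u) + F.wedge (l + n) (F.wedge (m + n - n) u) =
        F.normalOrder (l + n) (m + n) fun a b =>
          F.wedge (a - n) (F.wedge b u) + F.wedge a (F.wedge (b - n) u) := by
      intro u hu
      have h := congrArg (F.current 1) (ih' u hu)
      rw [F.normalOrder_map, F.normalOrder_congr (by omega) fun a b ha hb hab _ =>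
        hk.current_one_wedge_wedge (c := c) (by omega) (by omega) (by omega) hu,
        F.normalOrder_add, ← ih' _ (F.current_one_mem hu),
        hk.current_one_wedge_wedge (c := c) (by omega) (by omega) (by omega) hu] at h
      exact add_right_cancel h
    have h := congrArg F.currentE₂ (ih' v hv)
    rw [F.normalOrder_map, F.normalOrder_congr (by omega) fun a b ha hb hab _ =>
        hk.currentE₂_wedge_wedge (c := c) (by omega) (by omega) (by omega) hv,
        F.normalOrder_add, ← ih' _ (F.currentE₂_mem hv), F.normalOrder_add,
        ← h1 _ (F.current_one_mem hv),
        hk.currentE₂_wedge_wedge (c := c) (by omega) (by omega) (by omega) hv] at h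
    have h := add_right_cancel (add_right_cancel h)
    rw [← F.normalOrder_shift n (l + n) (m + n) fun a b => F.wedge a (F.wedge b v),
      add_sub_cancel_right, add_sub_cancel_right] at h
    exact h

variable [CharZero K]

theorem commutesBelow_natCast : F.CommutesBelow n := fun _ v hv =>
  ⟨F.current_one_wedge_near v hv, F.currentE₂_wedge_near v hv⟩

variable {F} in
-- Only `v` with first factor `u_{m+k}` is new. For `J₁`, straighten `u_m ∧ u_{m+k}`; every
-- resulting pair is within reach of the hypothesis, and `normalOrder_move` reassembles the moved
-- pairs. For `E₂`, write `u_m` as the commutator of `J₁` with `u_{m+n}`, for which the hypothesis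
-- already reaches far enough.
theorem CommutesBelow.add_one {k : ℤ} (hk : F.CommutesBelow k) (hnk : n ≤ k) :
    F.CommutesBelow (k + 1) := by
  have hn : (0 : ℤ) < n := by exact_mod_cast Nat.pos_of_ne_zero (NeZero.ne n)
  have h1 : ∀ m, ∀ v ∈ firstLT K (m + (k + 1)),
      F.current 1 (F.wedge m v) = F.wedge (m - n) v + F.wedge m (F.current 1 v) := by
    intro m
    refine F.eqOn_firstLT_of_wedge (f := F.current 1 ∘ₗ F.wedge m)
      (g := F.wedge (m - n) + F.wedge m ∘ₗ F.current 1) (d := m + k)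
      (fun v hv => (hk m v hv).1) fun p hp hpm _ v hv => ?_
    obtain rfl : p = m + k := by omega
    simp only [LinearMap.comp_apply, LinearMap.add_apply]
    -- The two straightened pairs are `(m-n, m+k)`, a relation known by definition since `v` starts
    -- below `m + k`, and `(m, m+k-n)`, whose gap `k - n` is small enough for `hk`. For `k = n` the
    -- second pair is `(m, m)` and its wedge vanishes.
    have hmove : F.normalOrder m (m + k) (fun a b =>
          F.wedge (a - n) (F.wedge b v) + F.wedge a (F.wedge (b - n) v)) =
        F.wedge (m - n) (F.wedge (m + k) v) + F.wedge m (F.wedge (m + k - n) v) := by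
      rcases hnk.eq_or_lt with rfl | hnk
      · rw [F.normalOrder_add_natCast, F.wedge_wedge (by omega) hv,
          F.normalOrder_of_emod_eq_zero, add_sub_cancel_right,
          F.wedge_wedge_self_of_mem v hv]
        · abel
        · rw [show m + (n : ℤ) - (m - n) = 2 * n by ring, Int.mul_emod_left]
      · rw [F.normalOrder_move (U := fun a b => F.wedge a (F.wedge b v)) (by omega),
          F.wedge_wedge (by omega) hv,
          hk.wedge_wedge (c := m + k) (by omega) (by omega) (by omega) v hv]
        intro x y hyx hxy hsum
        rw [hk.wedge_wedge (c := m + k) hyx (by omega) (by omega) v hv,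
          F.normalOrder_near hyx hxy]
    rw [F.wedge_wedge (by omega) hv, F.normalOrder_map,
      F.normalOrder_congr (by omega) fun a b ha hb hab _ =>
        hk.current_one_wedge_wedge (c := m + k) (by omega) (by omega) (by omega) hv,
      F.normalOrder_add, ← F.wedge_wedge (by omega) (F.current_one_mem hv), hmove,
      F.current_one_wedge_of_mem hv, map_add, add_assoc]
  refine fun m v hv => ⟨h1 m v hv, ?_⟩
  have hle : firstLT K (m + (k + 1)) ≤ firstLT K (m + n + k) := firstLT_mono (by omega)
  have hv1 := F.current_one_mem hv
  have hc : ∀ u, F.current 1 (F.currentE₂ u) = F.currentE₂ (F.current 1 u) :=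
    fun u => LinearMap.congr_fun F.current_one_comp_currentE₂ u
  have a1 := (hk (m + n) v (hle hv)).1
  have a2 := (hk (m + n) v (hle hv)).2
  have a3 := (hk (m + n) _ (hle (F.currentE₂_mem hv))).1
  have a4 := (hk (m + n) _ (hle hv1)).2
  have a5 := h1 m _ hv1
  rw [add_sub_cancel_right] at a1 a2 a3 a4
  -- Apply `E₂` to `u_m v = J₁ u_{m+n} v - u_{m+n} J₁ v` and move `E₂` past `J₁`, which commutes
  -- with it.
  have b1 := congrArg F.currentE₂ a1
  rw [← hc, a2, map_add, map_add, a3, a4, a5, hc] at b1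
  rw [← sub_eq_zero] at b1 ⊢
  rw [← neg_eq_zero, ← b1]
  abel

theorem commutesBelow (k : ℤ) : F.CommutesBelow k := by
  have h : ∀ j : ℕ, F.CommutesBelow (n + j) := by
    intro j
    induction j with
    | zero => simpa using F.commutesBelow_natCast
    | succ j ih =>
      have := ih.add_one (by omega)
      rwa [add_assoc] at this
  intro m v hv
  exact h (k - n).toNat m v (firstLT_mono (by omega) hv)

/-- The normal ordering relations hold on the whole Fock space. -/
theorem wedge_wedge_eq_normalOrder {l m : ℤ} (hlm : l < m) (v : FockSpace K) :
    F.wedge l (F.wedge m v) = F.normalOrder l m fun a b => F.wedge a (F.wedge b v) := by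
  obtain ⟨c, hc⟩ := exists_mem_firstLT v
  exact (F.commutesBelow (max (m - l + 1) (c - l - n))).wedge_wedge hlm (by omega) (by omega) v hc

theorem current_one_wedge (m : ℤ) (v : FockSpace K) :
    F.current 1 (F.wedge m v) = F.wedge (m - n) v + F.wedge m (F.current 1 v) := by
  obtain ⟨c, hc⟩ := exists_mem_firstLT v
  exact (F.commutesBelow (c - m) m v (by simpa using hc)).1

theorem currentE₂_wedge (m : ℤ) (v : FockSpace K) :
    F.currentE₂ (F.wedge m v) =
      F.wedge m (F.currentE₂ v) + F.wedge (m - n) (F.current 1 v) := by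
  obtain ⟨c, hc⟩ := exists_mem_firstLT v
  exact (F.commutesBelow (c - m) m v (by simpa using hc)).2

/-- Acting on formal pairs by the first power sum of the shifts is taking the commutator with `J₁`.
Hence the space of relations, which vanish on every `v`, is stable under it. -/
theorem pairWedge_move (v : FockSpace K) (c : ℤ × ℤ →₀ K) :
    F.pairWedge v (pairShift K n 0 c + pairShift K 0 n c) =
      F.current 1 (F.pairWedge v c) - F.pairWedge (F.current 1 v) c := by
  induction c using Finsupp.induction_linear with
  | zero => simp
  | add c d hc hd =>
    simp only [map_add] at hc hd ⊢
    linear_combination (norm := module) hc + hd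
  | single ab x =>
    simp only [pairWedge, pairShift, map_add, Finsupp.lmapDomain_apply, Finsupp.mapDomain_single,
      Finsupp.linearCombination_single, map_smul, F.current_one_wedge, sub_zero]
    module

theorem pairWedge_move_both (v : FockSpace K) (c : ℤ × ℤ →₀ K) :
    F.pairWedge v (pairShift K n n c) =
      F.currentE₂ (F.pairWedge v c) - F.pairWedge (F.currentE₂ v) c -
        F.pairWedge (F.current 1 v) (pairShift K n 0 c + pairShift K 0 n c) := by
  induction c using Finsupp.induction_linear with
  | zero => simp
  | add c d hc hd =>
    simp only [map_add] at hc hd ⊢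
    linear_combination (norm := module) hc + hd
  | single ab x =>
    simp only [pairWedge, pairShift, map_add, Finsupp.lmapDomain_apply, Finsupp.mapDomain_single,
      Finsupp.linearCombination_single, map_smul, F.currentE₂_wedge, F.current_one_wedge,
      sub_zero]
    module

variable {F} in
theorem pairShift_add_mem {c : ℤ × ℤ →₀ K} (hc : c ∈ F.pairRelations) :
    pairShift K n 0 c + pairShift K 0 n c ∈ F.pairRelations := by
  rw [mem_pairRelations] at hc ⊢
  intro v
  rw [pairWedge_move, hc, hc, map_zero, sub_zero]

variable {F} in
theorem pairShift_both_mem {c : ℤ × ℤ →₀ K} (hc : c ∈ F.pairRelations) :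
    pairShift K n n c ∈ F.pairRelations := by
  have h := pairShift_add_mem hc
  rw [mem_pairRelations] at hc h ⊢
  intro v
  rw [pairWedge_move_both, hc, hc, h, map_zero, sub_zero, sub_zero]

variable {F} in
-- Newton's identity `p_{k+2} = e₁ p_{k+1} - e₂ p_k` for the two commuting shifts: the relations are
-- stable under `e₁` and `e₂`, hence under all power sums.
theorem pairShift_powerSum_mem {c : ℤ × ℤ →₀ K} (hc : c ∈ F.pairRelations) (k : ℕ) :
    pairShift K (k * n) 0 c + pairShift K 0 (k * n) c ∈ F.pairRelations := by
  induction k using Nat.strong_induction_on with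
  | _ k ih =>
    match k with
    | 0 =>
      have h : pairShift K 0 0 c = c := by
        simp only [pairShift, Finsupp.lmapDomain_apply, sub_zero]
        exact Finsupp.mapDomain_id
      simpa [h] using F.pairRelations.add_mem hc hc
    | 1 => simpa using pairShift_add_mem hc
    | k + 2 =>
      have h1 := pairShift_add_mem (ih (k + 1) (by omega))
      have h2 := pairShift_both_mem (ih k (by omega))
      convert F.pairRelations.sub_mem h1 h2 using 1
      simp only [map_add, pairShift_pairShift]
      push_cast
      ring_nf
      abel

/-- The commutation relation of the current `J_k` with `u_m`. -/
theorem current_wedge {k : ℕ} (hk : 0 < k) (m : ℤ) (v : FockSpace K) :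
    F.current k (F.wedge m v) = F.wedge (m - k * n) v + F.wedge m (F.current k v) := by
  have hn : (0 : ℤ) < n := by exact_mod_cast Nat.pos_of_ne_zero (NeZero.ne n)
  have hk' : (0 : ℤ) < k := by exact_mod_cast hk
  have hkn : (0 : ℤ) < k * n := mul_pos hk' hn
  suffices h : ∀ j : ℕ, ∀ m, ∀ v ∈ firstLT K (m + j),
      F.current k (F.wedge m v) = F.wedge (m - k * n) v + F.wedge m (F.current k v) by
    obtain ⟨c, hc⟩ := exists_mem_firstLT v
    exact h (c - m).toNat m v (firstLT_mono (by omega) hc)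
  intro j
  induction j with
  | zero => exact fun m v hv => F.current_wedge_of_mem hk' (by simpa using hv)
  | succ j ih =>
    intro m
    refine F.eqOn_firstLT_of_wedge (f := F.current k ∘ₗ F.wedge m)
      (g := F.wedge (m - k * n) + F.wedge m ∘ₗ F.current k) (d := m + j)
      (fun v hv => ih m v hv) fun p hp hpm _ v hv => ?_
    obtain rfl : p = m + j := by push_cast at hpm; omega
    simp only [LinearMap.comp_apply, LinearMap.add_apply]
    rw [F.current_wedge_of_mem hk' hv]
    rcases Nat.eq_zero_or_pos j with rfl | hj
    · simp only [Nat.cast_zero, add_zero] at hv ⊢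
      rw [F.wedge_wedge_self hv, map_zero, map_add, F.wedge_wedge_self (F.current_mem hk' hv),
        F.wedge_wedge (by omega) hv, F.normalOrder_of_emod_eq_zero (by simp)]
      abel
    · have hlt : m < m + j := by omega
      -- The straightening relation as a formal element, so that the `k`-th power sum of the shifts
      -- can be applied to it. Its image says that moving either factor by `kn` is compatible with
      -- normal ordering.
      have hrel : Finsupp.single (m, m + (j : ℤ)) (1 : K) -
          F.normalOrder m (m + j) (fun a b => Finsupp.single (a, b) (1 : K)) ∈
            F.pairRelations := by
        rw [mem_pairRelations]
        intro u
        rw [map_sub, F.normalOrder_map]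
        simp [pairWedge, ← F.wedge_wedge_eq_normalOrder hlt]
      have h := (F.mem_pairRelations.1 (pairShift_powerSum_mem hrel k)) v
      rw [← LinearMap.add_apply, ← LinearMap.comp_apply, map_sub, F.normalOrder_map] at h
      simp only [LinearMap.comp_apply, LinearMap.add_apply, pairWedge, pairShift, map_add,
        Finsupp.lmapDomain_apply, Finsupp.mapDomain_single, Finsupp.linearCombination_single,
        one_smul, sub_zero] at h
      have h' : F.normalOrder m (m + j) (fun a b => F.current k (F.wedge a (F.wedge b v))) =
          F.normalOrder m (m + j) (fun a b => (F.wedge (a - k * n) (F.wedge b v) +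
            F.wedge a (F.wedge (b - k * n) v)) + F.wedge a (F.wedge b (F.current k v))) := by
        refine F.normalOrder_congr hlt fun a b ha hb hab _ => ?_
        rw [ih a _ (F.wedge_mem (by omega) (firstLT_mono (by omega) hv)),
          ih b v (firstLT_mono (by omega) hv), map_add, add_assoc]
      rw [F.wedge_wedge hlt hv, F.normalOrder_map, h', F.normalOrder_add,
        ← F.wedge_wedge hlt (F.current_mem hk' hv), map_add]
      linear_combination (norm := module) -h

/-- The currents `J_k`, `k ≥ 1`, commute. -/
theorem current_comm {k l : ℕ} (hk : 0 < k) (hl : 0 < l) :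
    F.current k ∘ₗ F.current l = F.current l ∘ₗ F.current k := by
  refine F.linearMap_ext_of_wedge (fun w hw => ?_) fun p v _ ih => ?_
  · simp [F.current_vacuum (by exact_mod_cast hk : (0 : ℤ) < k) hw,
      F.current_vacuum (by exact_mod_cast hl : (0 : ℤ) < l) hw]
  · simp only [LinearMap.comp_apply] at ih ⊢
    simp only [F.current_wedge hk, F.current_wedge hl, map_add, ih]
    rw [show p - l * n - k * n = p - k * n - l * (n : ℤ) by ring]
    abel

end MetaplecticData

/-! ## Exponentials of locally nilpotent operators -/

section LocallyNilpotent

variable {K V : Type*} [Field K] [AddCommGroup V] [Module K V]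

/-- The exponential series of an operator, applied to a vector. -/
noncomputable def expSeries (A : Module.End K V) (v : V) : V :=
  ∑ᶠ r : ℕ, (r.factorial : K)⁻¹ • (A ^ r) v

theorem Module.End.pow_apply_eq_zero_of_le {A : Module.End K V} {v : V} {R r : ℕ}
    (h : (A ^ R) v = 0) (hr : R ≤ r) : (A ^ r) v = 0 := by
  obtain ⟨k, rfl⟩ := Nat.exists_eq_add_of_le' hr
  rw [pow_add, Module.End.mul_apply, h, map_zero]

theorem expSeries_eq_sum {A : Module.End K V} {v : V} {R : ℕ} (h : (A ^ R) v = 0) :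
    expSeries A v = ∑ r ∈ Finset.range R, (r.factorial : K)⁻¹ • (A ^ r) v := by
  refine finsum_eq_sum_of_support_subset _ fun r hr => ?_
  by_contra hr'
  have hr' : R ≤ r := by simpa using hr'
  exact hr (by simp [Module.End.pow_apply_eq_zero_of_le h hr'])

theorem expSeries_of_apply_eq_zero {A : Module.End K V} {v : V} (h : A v = 0) :
    expSeries A v = v := by
  rw [expSeries_eq_sum (R := 1) (by simpa using h)]
  simp

/-- Every vector is annihilated by a power of the operator. -/
def IsLocallyNilpotent (A : Module.End K V) : Prop := ∀ v, ∃ R, (A ^ R) v = 0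

theorem expSeries_add {A : Module.End K V} (hA : IsLocallyNilpotent A) (v w : V) :
    expSeries A (v + w) = expSeries A v + expSeries A w := by
  obtain ⟨R, hR⟩ := hA v
  obtain ⟨S, hS⟩ := hA w
  have hR := Module.End.pow_apply_eq_zero_of_le hR (le_max_left R S)
  have hS := Module.End.pow_apply_eq_zero_of_le hS (le_max_right R S)
  rw [expSeries_eq_sum hR, expSeries_eq_sum hS,
    expSeries_eq_sum (by rw [map_add, hR, hS, add_zero])]
  simp [Finset.sum_add_distrib]

theorem expSeries_smul {A : Module.End K V} (hA : IsLocallyNilpotent A) (c : K) (v : V) :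
    expSeries A (c • v) = c • expSeries A v := by
  obtain ⟨R, hR⟩ := hA v
  rw [expSeries_eq_sum hR, expSeries_eq_sum (by rw [map_smul, hR, smul_zero]), Finset.smul_sum]
  exact Finset.sum_congr rfl fun r _ => by rw [map_smul, smul_comm]

/-- The exponential of a locally nilpotent operator. -/
noncomputable def expLinear (A : Module.End K V) (hA : IsLocallyNilpotent A) : V →ₗ[K] V where
  toFun := expSeries A
  map_add' := expSeries_add hA
  map_smul' := expSeries_smul hA

/-- The Cauchy product of two exponential series, as finite sums: terms with `i ≥ R` or `j ≥ S`
vanish, so total degree below `R + S` suffices. -/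
theorem sum_factorial_choose_eq [CharZero K] {x : ℕ → ℕ → V} {R S : ℕ}
    (hR : ∀ i j, R ≤ i → x i j = 0) (hS : ∀ i j, S ≤ j → x i j = 0) :
    ∑ r ∈ Finset.range (R + S), (r.factorial : K)⁻¹ •
      ∑ ij ∈ Finset.HasAntidiagonal.antidiagonal r, r.choose ij.1 • x ij.1 ij.2 =
    ∑ j ∈ Finset.range S, (j.factorial : K)⁻¹ •
      ∑ i ∈ Finset.range R, (i.factorial : K)⁻¹ • x i j := by
  have h1 : ∀ r, (r.factorial : K)⁻¹ •
      ∑ ij ∈ Finset.HasAntidiagonal.antidiagonal r, r.choose ij.1 • x ij.1 ij.2 =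
      ∑ i ∈ Finset.range (r + 1), ((i.factorial : K)⁻¹ * ((r - i).factorial : K)⁻¹) •
        x i (r - i) := by
    intro r
    rw [Finset.Nat.sum_antidiagonal_eq_sum_range_succ fun i j => r.choose i • x i j,
      Finset.smul_sum]
    refine Finset.sum_congr rfl fun i hi => ?_
    have hir : i ≤ r := by simpa [Nat.lt_succ_iff] using hi
    have h0 : (r.factorial : K) ≠ 0 := by exact_mod_cast r.factorial_ne_zero
    have h2 : (i.factorial : K) ≠ 0 := by exact_mod_cast i.factorial_ne_zero
    have h3 : ((r - i).factorial : K) ≠ 0 := by exact_mod_cast (r - i).factorial_ne_zero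
    rw [← Nat.cast_smul_eq_nsmul K, smul_smul, Nat.cast_choose K hir]
    congr 1
    field_simp
  rw [Finset.sum_congr rfl fun r _ => h1 r,
    Finset.sum_range_diag_flip (R + S) fun i j =>
      ((i.factorial : K)⁻¹ * (j.factorial : K)⁻¹) • x i j]
  have h2 : ∀ i ∈ Finset.range R, ∑ j ∈ Finset.range (R + S - i),
      ((i.factorial : K)⁻¹ * (j.factorial : K)⁻¹) • x i j =
      ∑ j ∈ Finset.range S, ((i.factorial : K)⁻¹ * (j.factorial : K)⁻¹) • x i j := by
    intro i hi
    have hi : i < R := by simpa using hi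
    refine (Finset.sum_subset ?_ fun j _ hj => ?_).symm
    · intro j hj
      simp only [Finset.mem_range] at hj ⊢
      omega
    · rw [hS i j (by simpa using hj), smul_zero]
  rw [← Finset.sum_subset (s₁ := Finset.range R), Finset.sum_congr rfl h2, Finset.sum_comm]
  · refine Finset.sum_congr rfl fun j _ => ?_
    rw [Finset.smul_sum]
    exact Finset.sum_congr rfl fun i _ => by rw [smul_smul, mul_comm]
  · intro i hi
    simp only [Finset.mem_range] at hi ⊢
    omega
  · intro i _ hi
    refine Finset.sum_eq_zero fun j _ => ?_
    rw [hR i j (by simpa using hi), smul_zero]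

theorem add_pow_apply {A B : Module.End K V} (hAB : Commute A B) (r : ℕ) (v : V) :
    ((A + B) ^ r) v =
      ∑ ij ∈ Finset.HasAntidiagonal.antidiagonal r, r.choose ij.1 • (A ^ ij.1) ((B ^ ij.2) v) := by
  rw [hAB.add_pow']
  simp [LinearMap.sum_apply]

theorem IsLocallyNilpotent.exists_pow_pow {A B : Module.End K V} (hA : IsLocallyNilpotent A)
    (hB : IsLocallyNilpotent B) (v : V) :
    ∃ R S, (B ^ S) v = 0 ∧ (∀ i j, R ≤ i → (A ^ i) ((B ^ j) v) = 0) ∧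
      ∀ i j, S ≤ j → (A ^ i) ((B ^ j) v) = 0 := by
  obtain ⟨S, hS⟩ := hB v
  choose R hR using fun j => hA ((B ^ j) v)
  have hS' : ∀ i j, S ≤ j → (A ^ i) ((B ^ j) v) = 0 := fun i j hj => by
    rw [Module.End.pow_apply_eq_zero_of_le hS hj, map_zero]
  refine ⟨(Finset.range S).sup R, S, hS, fun i j hi => ?_, hS'⟩
  by_cases hj : j < S
  · exact Module.End.pow_apply_eq_zero_of_le (hR j)
      ((Finset.le_sup (by simpa using hj)).trans hi)
  · exact hS' i j (by omega)

theorem IsLocallyNilpotent.add_pow_eq_zero {A B : Module.End K V} (hAB : Commute A B) {v : V}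
    {R S : ℕ} (hR : ∀ i j, R ≤ i → (A ^ i) ((B ^ j) v) = 0)
    (hS : ∀ i j, S ≤ j → (A ^ i) ((B ^ j) v) = 0) : ((A + B) ^ (R + S)) v = 0 := by
  rw [add_pow_apply hAB]
  refine Finset.sum_eq_zero fun ij hij => ?_
  have hij : ij.1 + ij.2 = R + S := by simpa using hij
  by_cases h : R ≤ ij.1
  · rw [hR _ _ h, smul_zero]
  · rw [hS _ _ (by omega), smul_zero]

theorem expSeries_add_of_commute [CharZero K] {A B : Module.End K V}
    (hA : IsLocallyNilpotent A) (hB : IsLocallyNilpotent B) (hAB : Commute A B) (v : V) :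
    expSeries (A + B) v = expSeries A (expSeries B v) := by
  obtain ⟨R, S, hBv, hR, hS⟩ := hA.exists_pow_pow hB v
  have h0 : (A ^ R) (expSeries B v) = 0 := by
    rw [expSeries_eq_sum hBv, map_sum]
    exact Finset.sum_eq_zero fun j _ => by rw [map_smul, hR R j le_rfl, smul_zero]
  rw [expSeries_eq_sum (IsLocallyNilpotent.add_pow_eq_zero hAB hR hS), expSeries_eq_sum h0,
    expSeries_eq_sum hBv]
  simp only [add_pow_apply hAB, map_sum, map_smul]
  rw [sum_factorial_choose_eq hR hS]
  simp only [Finset.smul_sum]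
  rw [Finset.sum_comm]
  exact Finset.sum_congr rfl fun i _ => Finset.sum_congr rfl fun j _ => smul_comm _ _ _

end LocallyNilpotent

/-! ## Hamiltonians -/

namespace MetaplecticData

variable {n : ℕ} {K : Type*} [Field K] (F : MetaplecticData n K)

theorem coeff_pow_eq_zero_of_lt {s : ℕ → K} (hs : s 0 = 0) {k i : ℕ} (h : k < i)
    (p : PowerSeries K) : PowerSeries.coeff k (PowerSeries.mk s ^ i * p) = 0 := by
  have hX : PowerSeries.X ∣ PowerSeries.mk s := by
    rw [PowerSeries.X_dvd_iff]
    simpa using hs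
  exact PowerSeries.X_pow_dvd_iff.1 ((pow_dvd_pow_of_dvd hX i).mul_right p) k h

/-- The operator `∑_k p_k u_{m - k n}` of a power series `p = ∑_k p_k X^k`. -/
noncomputable def seriesWedge (m : ℤ) (p : PowerSeries K) (v : FockSpace K) : FockSpace K :=
  ∑ᶠ k : ℕ, PowerSeries.coeff k p • F.wedge (m - k * n) v

variable {F} in
theorem seriesWedge_eq_sum {m : ℤ} {v : FockSpace K} {R : ℕ}
    (hR : ∀ k : ℕ, R ≤ k → F.wedge (m - k * n) v = 0) (p : PowerSeries K) :
    F.seriesWedge m p v =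
      ∑ k ∈ Finset.range R, PowerSeries.coeff k p • F.wedge (m - k * n) v := by
  refine finsum_eq_sum_of_support_subset _ fun r hr => ?_
  by_contra hr'
  have hr' : R ≤ r := by simpa using hr'
  exact hr (by simp [hR r hr'])

variable {F} in
theorem seriesWedge_congr {m : ℤ} {v : FockSpace K} {R : ℕ}
    (hR : ∀ k : ℕ, R ≤ k → F.wedge (m - k * n) v = 0) {p p' : PowerSeries K}
    (h : ∀ k < R, PowerSeries.coeff k p = PowerSeries.coeff k p') :
    F.seriesWedge m p v = F.seriesWedge m p' v := by
  rw [seriesWedge_eq_sum hR, seriesWedge_eq_sum hR]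
  exact Finset.sum_congr rfl fun k hk => by rw [h k (by simpa using hk)]

variable [NeZero n]

theorem exists_wedge_eq_zero (v : FockSpace K) : ∃ B : ℤ, ∀ j < B, F.wedge j v = 0 := by
  induction v using Finsupp.induction_linear with
  | zero => exact ⟨0, fun j _ => map_zero _⟩
  | add f g hf hg =>
    obtain ⟨B, hB⟩ := hf
    obtain ⟨C, hC⟩ := hg
    exact ⟨min B C, fun j hj => by
      rw [map_add, hB j (hj.trans_le (min_le_left _ _)), hC j (hj.trans_le (min_le_right _ _)),
        add_zero]⟩
  | single w x =>
    suffices h : ∃ B : ℤ, ∀ j < B, F.wedge j (Finsupp.single w 1) = 0 by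
      obtain ⟨B, hB⟩ := h
      refine ⟨B, fun j hj => ?_⟩
      rw [← mul_one x, ← smul_eq_mul, ← Finsupp.smul_single, map_smul, hB j hj, smul_zero]
    induction w using NormalWedge.induction_tail with
    | base w hw => exact ⟨w.m 0, fun j hj => F.wedge_vacuum hw hj.le⟩
    | step w ih =>
      obtain ⟨B, hB⟩ := ih
      -- The terms `u_a ∧ u_b` have `b < a` and `a + b = j + w.m 0`, so `j < 2B - w.m 0` forces `b <
      -- B`.
      refine ⟨min (w.m 0) (2 * B - w.m 0), fun j hj => ?_⟩
      rw [F.wedge_single_of_gt (by omega)]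
      refine (Submodule.mem_bot K).1 (F.normalOrder_mem (by omega) _ fun a b h1 h2 h3 h4 => ?_)
      rw [hB b (by omega), map_zero]
      exact Submodule.zero_mem _

theorem exists_current_eq_zero (v : FockSpace K) :
    ∃ R : ℕ, ∀ k : ℕ, R ≤ k → F.current ((k : ℤ) + 1) v = 0 := by
  have hn : (0 : ℤ) < n := by exact_mod_cast Nat.pos_of_ne_zero (NeZero.ne n)
  induction v using Finsupp.induction_linear with
  | zero => exact ⟨0, fun j _ => map_zero _⟩
  | add f g hf hg =>
    obtain ⟨B, hB⟩ := hf
    obtain ⟨C, hC⟩ := hg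
    exact ⟨max B C, fun j hj => by
      rw [map_add, hB j ((le_max_left _ _).trans hj), hC j ((le_max_right _ _).trans hj),
        add_zero]⟩
  | single w x =>
    suffices h : ∃ R : ℕ, ∀ k : ℕ, R ≤ k → F.current ((k : ℤ) + 1) (Finsupp.single w 1) = 0 by
      obtain ⟨B, hB⟩ := h
      refine ⟨B, fun j hj => ?_⟩
      rw [← mul_one x, ← smul_eq_mul, ← Finsupp.smul_single, map_smul, hB j hj, smul_zero]
    induction w using NormalWedge.induction_tail with
    | base w hw => exact ⟨0, fun k _ => F.current_vacuum (by omega) hw⟩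
    | step w ih =>
      obtain ⟨R, hR⟩ := ih
      obtain ⟨B, hB⟩ := F.exists_wedge_eq_zero (Finsupp.single w.tail 1)
      refine ⟨max R (w.m 0 - B).toNat, fun k hk => ?_⟩
      rw [← F.wedge_tail w, F.current_wedge_of_mem (by omega) (single_mem_firstLT w.tail_lt 1),
        hR k (by omega), map_zero, hB, add_zero]
      have : (w.m 0 - B) ≤ k := by omega
      nlinarith

theorem exists_hamiltonian_eq_sum (s : ℕ → K) (v : FockSpace K) :
    ∃ R : ℕ, ∀ S, R ≤ S → F.hamiltonian s v =
      ∑ k ∈ Finset.range S, s (k + 1) • F.current ((k : ℤ) + 1) v := by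
  induction v using Finsupp.induction_linear with
  | zero => exact ⟨0, fun S _ => by simp⟩
  | add f g hf hg =>
    obtain ⟨B, hB⟩ := hf
    obtain ⟨C, hC⟩ := hg
    exact ⟨max B C, fun S hS => by
      rw [map_add, hB S ((le_max_left _ _).trans hS), hC S ((le_max_right _ _).trans hS),
        ← Finset.sum_add_distrib]
      simp⟩
  | single w x =>
    obtain ⟨R, hR⟩ := F.exists_current_eq_zero (Finsupp.single w 1)
    refine ⟨R, fun S hS => ?_⟩
    rw [← mul_one x, ← smul_eq_mul, ← Finsupp.smul_single, map_smul, hamiltonian,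
      Finsupp.linearCombination_single, one_smul,
      finsum_eq_sum_of_support_subset (s := Finset.range S) _ fun k hk => ?_, Finset.smul_sum]
    · exact Finset.sum_congr rfl fun k _ => by rw [map_smul, smul_comm]
    · by_contra hk'
      have hk' : S ≤ k := by simpa using hk'
      exact hk (by simp [hR k (hS.trans hk')])

theorem hamiltonian_vacuum (s : ℕ → K) {w : NormalWedge} (hw : w.IsVacuum) :
    F.hamiltonian s (Finsupp.single w 1) = 0 := by
  obtain ⟨R, hR⟩ := F.exists_hamiltonian_eq_sum s (Finsupp.single w 1)
  rw [hR R le_rfl]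
  exact Finset.sum_eq_zero fun k _ => by rw [F.current_vacuum (by omega) hw, smul_zero]

theorem hamiltonian_add (s s' : ℕ → K) :
    F.hamiltonian (s + s') = F.hamiltonian s + F.hamiltonian s' := by
  refine LinearMap.ext fun v => ?_
  obtain ⟨R, hR⟩ := F.exists_hamiltonian_eq_sum s v
  obtain ⟨R', hR'⟩ := F.exists_hamiltonian_eq_sum s' v
  obtain ⟨R'', hR''⟩ := F.exists_hamiltonian_eq_sum (s + s') v
  rw [LinearMap.add_apply, hR (R + R' + R'') (by omega), hR' (R + R' + R'') (by omega),
    hR'' (R + R' + R'') (by omega), ← Finset.sum_add_distrib]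
  exact Finset.sum_congr rfl fun k _ => by rw [Pi.add_apply, add_smul]

theorem hamiltonian_zero : F.hamiltonian (0 : ℕ → K) = 0 := by
  refine LinearMap.ext fun v => ?_
  obtain ⟨R, hR⟩ := F.exists_hamiltonian_eq_sum 0 v
  rw [hR R le_rfl]
  simp

theorem exists_pow_X_mul_wedge (m : ℤ) (v : FockSpace K) :
    ∃ R : ℕ, ∀ k : ℕ, R ≤ k → F.wedge (m - k * n) v = 0 := by
  have hn : (0 : ℤ) < n := by exact_mod_cast Nat.pos_of_ne_zero (NeZero.ne n)
  obtain ⟨B, hB⟩ := F.exists_wedge_eq_zero v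
  refine ⟨(m - B + 1).toNat, fun k hk => hB _ ?_⟩
  have : m - B + 1 ≤ k := by omega
  nlinarith

theorem seriesWedge_add_left (m : ℤ) (p p' : PowerSeries K) (v : FockSpace K) :
    F.seriesWedge m (p + p') v = F.seriesWedge m p v + F.seriesWedge m p' v := by
  obtain ⟨R, hR⟩ := F.exists_pow_X_mul_wedge m v
  simp only [seriesWedge_eq_sum hR, map_add, add_smul, Finset.sum_add_distrib]

theorem seriesWedge_smul_left (m : ℤ) (c : K) (p : PowerSeries K) (v : FockSpace K) :
    F.seriesWedge m (c • p) v = c • F.seriesWedge m p v := by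
  obtain ⟨R, hR⟩ := F.exists_pow_X_mul_wedge m v
  simp only [seriesWedge_eq_sum hR, map_smul, smul_assoc, Finset.smul_sum]

theorem seriesWedge_add_right (m : ℤ) (p : PowerSeries K) (v v' : FockSpace K) :
    F.seriesWedge m p (v + v') = F.seriesWedge m p v + F.seriesWedge m p v' := by
  obtain ⟨R, hR⟩ := F.exists_pow_X_mul_wedge m v
  obtain ⟨R', hR'⟩ := F.exists_pow_X_mul_wedge m v'
  have h1 : ∀ k : ℕ, max R R' ≤ k → F.wedge (m - k * n) v = 0 := fun k hk => hR k (by omega)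
  have h2 : ∀ k : ℕ, max R R' ≤ k → F.wedge (m - k * n) v' = 0 := fun k hk => hR' k (by omega)
  rw [seriesWedge_eq_sum h1, seriesWedge_eq_sum h2, seriesWedge_eq_sum (R := max R R')
    fun k hk => by rw [map_add, h1 k hk, h2 k hk, add_zero]]
  simp only [map_add, smul_add, Finset.sum_add_distrib]

theorem seriesWedge_smul_right (m : ℤ) (p : PowerSeries K) (c : K) (v : FockSpace K) :
    F.seriesWedge m p (c • v) = c • F.seriesWedge m p v := by
  obtain ⟨R, hR⟩ := F.exists_pow_X_mul_wedge m v
  rw [seriesWedge_eq_sum hR, seriesWedge_eq_sum (R := R)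
    fun k hk => by rw [map_smul, hR k hk, smul_zero]]
  simp only [map_smul, Finset.smul_sum]
  exact Finset.sum_congr rfl fun k _ => smul_comm _ _ _

/-- `seriesWedge` as a bilinear map. -/
noncomputable def seriesWedgeₗ (m : ℤ) : PowerSeries K →ₗ[K] FockSpace K →ₗ[K] FockSpace K :=
  LinearMap.mk₂ K (F.seriesWedge m) (F.seriesWedge_add_left m) (F.seriesWedge_smul_left m)
    (F.seriesWedge_add_right m) fun c p v => F.seriesWedge_smul_right m p c v

theorem seriesWedgeₗ_one (m : ℤ) (v : FockSpace K) : F.seriesWedgeₗ m 1 v = F.wedge m v := by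
  obtain ⟨R, hR⟩ := F.exists_pow_X_mul_wedge m v
  change F.seriesWedge m 1 v = _
  rw [seriesWedge_eq_sum (R := R + 1) fun k hk => hR k (by omega),
    Finset.sum_eq_single_of_mem 0 (by simp)]
  · simp
  · intro k _ hk
    simp [PowerSeries.coeff_one, hk]

theorem seriesWedgeₗ_X (m : ℤ) (v : FockSpace K) :
    F.seriesWedgeₗ m PowerSeries.X v = F.wedge (m - n) v := by
  obtain ⟨R, hR⟩ := F.exists_pow_X_mul_wedge m v
  change F.seriesWedge m PowerSeries.X v = _
  rw [seriesWedge_eq_sum (R := R + 2) fun k hk => hR k (by omega),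
    Finset.sum_eq_single_of_mem 1 (by simp)]
  · simp
  · intro k _ hk
    simp [PowerSeries.coeff_X, hk]

theorem exists_seriesWedgeₗ_eq_zero {s : ℕ → K} (hs : s 0 = 0) (m : ℤ) (p : PowerSeries K)
    {v : FockSpace K} {S : ℕ} (hS : (F.hamiltonian s ^ S) v = 0) :
    ∃ R : ℕ, (∀ j k : ℕ, R ≤ k → F.wedge (m - k * n) ((F.hamiltonian s ^ j) v) = 0) ∧
      (∀ i j, R ≤ i →
        F.seriesWedgeₗ m (PowerSeries.mk s ^ i * p) ((F.hamiltonian s ^ j) v) = 0) ∧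
      ∀ i j, S ≤ j →
        F.seriesWedgeₗ m (PowerSeries.mk s ^ i * p) ((F.hamiltonian s ^ j) v) = 0 := by
  choose R hR using fun j => F.exists_pow_X_mul_wedge m ((F.hamiltonian s ^ j) v)
  have h1 : ∀ j k : ℕ, (Finset.range S).sup R ≤ k →
      F.wedge (m - k * n) ((F.hamiltonian s ^ j) v) = 0 := by
    intro j k hk
    by_cases hj : j < S
    · exact hR j k ((Finset.le_sup (f := R) (by simpa using hj)).trans hk)
    · rw [Module.End.pow_apply_eq_zero_of_le hS (by omega), map_zero]
  refine ⟨(Finset.range S).sup R, h1, fun i j hi => ?_, fun i j hj => ?_⟩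
  · change F.seriesWedge m _ _ = 0
    rw [seriesWedge_eq_sum (h1 j)]
    refine Finset.sum_eq_zero fun k hk => ?_
    rw [coeff_pow_eq_zero_of_lt hs ((Finset.mem_range.1 hk).trans_le hi), zero_smul]
  · rw [Module.End.pow_apply_eq_zero_of_le hS hj, map_zero]

variable [CharZero K]

theorem commute_hamiltonian (s s' : ℕ → K) :
    Commute (F.hamiltonian s) (F.hamiltonian s') := by
  refine LinearMap.ext fun v => ?_
  rw [Module.End.mul_apply, Module.End.mul_apply]
  obtain ⟨R, hR⟩ := F.exists_hamiltonian_eq_sum s v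
  obtain ⟨R', hR'⟩ := F.exists_hamiltonian_eq_sum s' v
  obtain ⟨S, hS⟩ := F.exists_hamiltonian_eq_sum s (F.hamiltonian s' v)
  obtain ⟨S', hS'⟩ := F.exists_hamiltonian_eq_sum s' (F.hamiltonian s v)
  rw [hS (R + S) (by omega), hS' (R' + S') (by omega), hR (R + S) (by omega),
    hR' (R' + S') (by omega)]
  simp only [map_sum, map_smul, Finset.smul_sum]
  rw [Finset.sum_comm]
  refine Finset.sum_congr rfl fun i _ => Finset.sum_congr rfl fun j _ => ?_
  have h := LinearMap.congr_fun (F.current_comm (Nat.succ_pos j) (Nat.succ_pos i)) v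
  rw [LinearMap.comp_apply, LinearMap.comp_apply] at h
  push_cast at h
  rw [h, smul_comm]

/-- The Hamiltonian `∑ s_k J_k` acts on `u(p) ∧ v` as a derivation. -/
theorem hamiltonian_seriesWedgeₗ {s : ℕ → K} (hs : s 0 = 0) (m : ℤ) (p : PowerSeries K)
    (v : FockSpace K) :
    F.hamiltonian s (F.seriesWedgeₗ m p v) =
      F.seriesWedgeₗ m (PowerSeries.mk s * p) v + F.seriesWedgeₗ m p (F.hamiltonian s v) := by
  change F.hamiltonian s (F.seriesWedge m p v) =
    F.seriesWedge m (PowerSeries.mk s * p) v + F.seriesWedge m p (F.hamiltonian s v)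
  obtain ⟨R₁, hR₁⟩ := F.exists_pow_X_mul_wedge m v
  obtain ⟨R₂, hR₂⟩ := F.exists_pow_X_mul_wedge m (F.hamiltonian s v)
  obtain ⟨R₃, hR₃⟩ := F.exists_hamiltonian_eq_sum s v
  obtain ⟨R₄, hR₄⟩ := F.exists_hamiltonian_eq_sum s (F.seriesWedge m p v)
  set R := R₁ + R₂ + R₃ + R₄
  have hR₁ : ∀ k : ℕ, R ≤ k → F.wedge (m - k * n) v = 0 := fun k hk => hR₁ k (by omega)
  have hR₂ : ∀ k : ℕ, R ≤ k → F.wedge (m - k * n) (F.hamiltonian s v) = 0 :=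
    fun k hk => hR₂ k (by omega)
  rw [hR₄ R (by omega), seriesWedge_eq_sum hR₁, seriesWedge_eq_sum hR₁, seriesWedge_eq_sum hR₂,
    hR₃ R (by omega)]
  have hcur : ∀ (j k : ℕ), F.current ((j : ℤ) + 1) (F.wedge (m - k * n) v) =
      F.wedge (m - ((j + 1 + k : ℕ) : ℤ) * n) v +
        F.wedge (m - k * n) (F.current ((j : ℤ) + 1) v) := by
    intro j k
    have h := F.current_wedge (Nat.succ_pos j) (m - k * n) v
    push_cast at h ⊢
    rw [h]
    congr 3
    ring
  simp only [map_sum, map_smul, hcur, smul_add, Finset.sum_add_distrib, Finset.smul_sum]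
  congr 1
  · have e1 : ∀ N, PowerSeries.coeff N (PowerSeries.mk s * p) • F.wedge (m - N * n) v =
        ∑ k ∈ Finset.range (N + 1), (s k * PowerSeries.coeff (N - k) p) •
          F.wedge (m - ((k + (N - k) : ℕ) : ℤ) * n) v := by
      intro N
      rw [PowerSeries.coeff_mul, Finset.Nat.sum_antidiagonal_eq_sum_range_succ
        fun i j => PowerSeries.coeff i (PowerSeries.mk s) * PowerSeries.coeff j p, Finset.sum_smul]
      refine Finset.sum_congr rfl fun k hk => ?_
      have hk : k ≤ N := by simpa [Nat.lt_succ_iff] using hk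
      rw [PowerSeries.coeff_mk, Nat.add_sub_cancel' hk]
    rw [Finset.sum_congr rfl fun N _ => e1 N, Finset.sum_range_diag_flip R fun k j =>
      (s k * PowerSeries.coeff j p) • F.wedge (m - ((k + j : ℕ) : ℤ) * n) v]
    have e2 : ∀ k ∈ Finset.range R, ∑ j ∈ Finset.range (R - k),
        (s k * PowerSeries.coeff j p) • F.wedge (m - ((k + j : ℕ) : ℤ) * n) v =
        ∑ j ∈ Finset.range R,
        (s k * PowerSeries.coeff j p) • F.wedge (m - ((k + j : ℕ) : ℤ) * n) v := by
      intro k _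
      refine Finset.sum_subset (by simp) fun j _ hj => ?_
      rw [hR₁ (k + j) (by simp at hj; omega), smul_zero]
    -- The Hamiltonian uses the coefficients `s (k+1)`, the power series starts at `s 0`; the shift
    -- of index is harmless since `s 0 = 0` and the last term is beyond the cutoff.
    have e3 : ∀ V : ℕ → FockSpace K, V 0 = 0 → V R = 0 →
        ∑ k ∈ Finset.range R, V (k + 1) = ∑ k ∈ Finset.range R, V k := by
      intro V h0 hR
      have h := Finset.sum_range_succ' V R
      rw [Finset.sum_range_succ, h0, hR, add_zero, add_zero] at h
      exact h.symm
    rw [Finset.sum_congr rfl e2, ← e3 fun k => ∑ j ∈ Finset.range R,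
        (s k * PowerSeries.coeff j p) • F.wedge (m - ((k + j : ℕ) : ℤ) * n) v]
    · exact Finset.sum_congr rfl fun j _ => Finset.sum_congr rfl fun k _ => by rw [smul_smul]
    · simp [hs]
    · exact Finset.sum_eq_zero fun j _ => by rw [hR₁ (R + j) (by omega), smul_zero]
  · rw [Finset.sum_comm]
    exact Finset.sum_congr rfl fun j _ => Finset.sum_congr rfl fun k _ => smul_comm _ _ _

theorem hamiltonian_pow_seriesWedgeₗ {s : ℕ → K} (hs : s 0 = 0) (m : ℤ) (p : PowerSeries K)
    (v : FockSpace K) (r : ℕ) :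
    (F.hamiltonian s ^ r) (F.seriesWedgeₗ m p v) =
      ∑ ij ∈ Finset.HasAntidiagonal.antidiagonal r, r.choose ij.1 •
        F.seriesWedgeₗ m (PowerSeries.mk s ^ ij.1 * p) ((F.hamiltonian s ^ ij.2) v) := by
  induction r with
  | zero => simp
  | succ r ih =>
    rw [Finset.sum_antidiagonal_choose_succ_nsmul (fun i j =>
        F.seriesWedgeₗ m (PowerSeries.mk s ^ i * p) ((F.hamiltonian s ^ j) v)) r, pow_succ',
      Module.End.mul_apply, ih, map_sum, ← Finset.sum_add_distrib]
    refine Finset.sum_congr rfl fun ij hij => ?_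
    have hij : ij.1 + ij.2 = r := by simpa using hij
    have hch : r.choose ij.2 = r.choose ij.1 := by
      rw [← hij, Nat.choose_symm_add]
    rw [map_nsmul, F.hamiltonian_seriesWedgeₗ hs, nsmul_add, hch, ← mul_assoc, ← pow_succ',
      pow_succ' (F.hamiltonian s) ij.2, Module.End.mul_apply]
    abel

/-- Induction on the number of factors above a vacuum. In the Leibniz expansion of a high power
either many derivatives fall on the front factor, whose series becomes divisible by a high power of
`X` and so kills, or many fall on the tail. -/
theorem hamiltonian_isLocallyNilpotent {s : ℕ → K} (hs : s 0 = 0) :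
    IsLocallyNilpotent (F.hamiltonian s) := by
  intro v
  induction v using Finsupp.induction_linear with
  | zero => exact ⟨0, map_zero _⟩
  | add f g hf hg =>
    obtain ⟨B, hB⟩ := hf
    obtain ⟨C, hC⟩ := hg
    exact ⟨max B C, by
      rw [map_add, Module.End.pow_apply_eq_zero_of_le hB (le_max_left _ _),
        Module.End.pow_apply_eq_zero_of_le hC (le_max_right _ _), add_zero]⟩
  | single w x =>
    suffices h : ∃ R, (F.hamiltonian s ^ R) (Finsupp.single w 1) = 0 by
      obtain ⟨B, hB⟩ := h
      refine ⟨B, ?_⟩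
      rw [← mul_one x, ← smul_eq_mul, ← Finsupp.smul_single, map_smul, hB, smul_zero]
    induction w using NormalWedge.induction_tail with
    | base w hw => exact ⟨1, by simpa using F.hamiltonian_vacuum s hw⟩
    | step w ih =>
      obtain ⟨S, hS⟩ := ih
      obtain ⟨R, -, h1, h2⟩ := F.exists_seriesWedgeₗ_eq_zero hs (w.m 0) 1 hS
      refine ⟨R + S, ?_⟩
      rw [← F.wedge_tail w, ← seriesWedgeₗ_one, F.hamiltonian_pow_seriesWedgeₗ hs]
      refine Finset.sum_eq_zero fun ij hij => ?_
      have hij : ij.1 + ij.2 = R + S := by simpa using hij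
      by_cases h : R ≤ ij.1
      · rw [h1 _ _ h, smul_zero]
      · rw [h2 _ _ (by omega), smul_zero]

/-- Conjugation of `u(p)` by the exponential of a Hamiltonian. -/
theorem expSeries_seriesWedgeₗ {s : ℕ → K} (hs : s 0 = 0) (m : ℤ) (p : PowerSeries K)
    (v : FockSpace K) :
    expSeries (F.hamiltonian s) (F.seriesWedgeₗ m p v) =
      F.seriesWedgeₗ m ((PowerSeries.exp K).subst (PowerSeries.mk s) * p)
        (expSeries (F.hamiltonian s) v) := by
  obtain ⟨S, hS⟩ := F.hamiltonian_isLocallyNilpotent hs v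
  obtain ⟨R, h0, h1, h2⟩ := F.exists_seriesWedgeₗ_eq_zero hs m p hS
  have hz : (F.hamiltonian s ^ (R + S)) (F.seriesWedgeₗ m p v) = 0 := by
    rw [F.hamiltonian_pow_seriesWedgeₗ hs]
    refine Finset.sum_eq_zero fun ij hij => ?_
    have hij : ij.1 + ij.2 = R + S := by simpa using hij
    by_cases h : R ≤ ij.1
    · rw [h1 _ _ h, smul_zero]
    · rw [h2 _ _ (by omega), smul_zero]
  rw [expSeries_eq_sum hz, expSeries_eq_sum hS]
  simp only [F.hamiltonian_pow_seriesWedgeₗ hs]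
  rw [sum_factorial_choose_eq (x := fun i j =>
    F.seriesWedgeₗ m (PowerSeries.mk s ^ i * p) ((F.hamiltonian s ^ j) v)) h1 h2, map_sum]
  refine Finset.sum_congr rfl fun j _ => ?_
  rw [map_smul]
  congr 1
  have hsum : ∑ i ∈ Finset.range R, (i.factorial : K)⁻¹ •
      F.seriesWedgeₗ m (PowerSeries.mk s ^ i * p) ((F.hamiltonian s ^ j) v) =
      F.seriesWedgeₗ m ((∑ i ∈ Finset.range R, (i.factorial : K)⁻¹ • PowerSeries.mk s ^ i) * p)
        ((F.hamiltonian s ^ j) v) := by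
    simp [Finset.sum_mul, LinearMap.sum_apply]
  rw [hsum]
  refine seriesWedge_congr (h0 j) fun k hk => ?_
  have hsub : PowerSeries.HasSubst (PowerSeries.mk s) :=
    PowerSeries.HasSubst.of_constantCoeff_zero' (by simpa using hs)
  rw [PowerSeries.coeff_mul, PowerSeries.coeff_mul]
  refine Finset.sum_congr rfl fun ij hij => ?_
  have hij : ij.1 + ij.2 = k := by simpa using hij
  congr 1
  rw [PowerSeries.coeff_subst' hsub, finsum_eq_sum_of_support_subset (s := Finset.range R)]
  · simp [PowerSeries.coeff_exp]
  · intro i hi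
    by_contra hi'
    have hi' : R ≤ i := by simpa using hi'
    refine hi ?_
    have := coeff_pow_eq_zero_of_lt hs (show ij.1 < i by omega) 1
    rw [mul_one] at this
    simp [this]

end MetaplecticData

/-! ### The exponential of a difference of power sums -/

section ExpPowerSum

variable {K : Type*} [Field K] [CharZero K]

open PowerSeries in
-- The series is `-log(1 - θX)`. Its constant term `θ ^ 0 / 0` is zero by the convention for
-- division by zero, which is also what makes the substitution into `exp` legitimate later.
theorem derivative_powerSum_mul (θ : K) :
    derivative K (mk fun k : ℕ => θ ^ k / k) * (1 - θ • X) = C θ := by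
  have h : derivative K (mk fun k : ℕ => θ ^ k / k) = mk fun k : ℕ => θ ^ (k + 1) := by
    ext k
    rw [coeff_derivative, coeff_mk, coeff_mk]
    have : ((k : K) + 1) ≠ 0 := by exact_mod_cast Nat.succ_ne_zero k
    push_cast
    field_simp
  rw [h]
  ext k
  rw [mul_sub, mul_one, mul_smul_comm, map_sub, map_smul]
  cases k with
  | zero => simp
  | succ k => simp [coeff_succ_mul_X, pow_succ' θ (k + 1)]

open PowerSeries in
/-- `exp(∑_{k ≥ 1} (θ^k - π^k) X^k / k) = (1 - π X) / (1 - θ X)`. -/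
theorem exp_subst_powerSum_mul (θ π : K) :
    (exp K).subst (mk fun k : ℕ => θ ^ k / k - π ^ k / k) * (1 - θ • X) = 1 - π • X := by
  set σ : PowerSeries K := mk fun k : ℕ => θ ^ k / k - π ^ k / k with hσ
  have hsub : HasSubst σ := HasSubst.of_constantCoeff_zero' (by simp [hσ])
  set f := (exp K).subst σ with hf
  have hf0 : constantCoeff f = 1 := by
    rw [← coeff_zero_eq_constantCoeff_apply, hf, coeff_subst' hsub, finsum_eq_single _ 0]
    · simp
    · intro j hj
      simp [hσ, hj]
  have hf' : derivative K f = f * derivative K σ := by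
    rw [hf, derivative_subst hsub, derivative_exp]
  have hσ' : derivative K σ * (1 - θ • X) * (1 - π • X) =
      C θ * (1 - π • X) - C π * (1 - θ • X) := by
    have e : σ = (mk fun k : ℕ => θ ^ k / k) - mk fun k : ℕ => π ^ k / k := by
      ext k
      simp [hσ]
    rw [e, map_sub, ← derivative_powerSum_mul θ, ← derivative_powerSum_mul π]
    ring
  set u := f * (1 - θ • X) with hu
  set v : PowerSeries K := 1 - π • X with hv
  have hv0 : constantCoeff v ≠ 0 := by simp [hv]
  have hθ : ∀ θ : K, θ • (X : PowerSeries K) = C θ * X := fun θ => smul_eq_C_mul _ _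
  have hlin : ∀ θ : K, derivative K (1 - θ • X : PowerSeries K) = -C θ := by
    intro θ
    rw [hθ, map_sub, Derivation.leibniz]
    simp
  have hu' : derivative K u * v = -C π * u := by
    rw [hu, Derivation.leibniz, hlin, hf', smul_eq_mul, smul_eq_mul, hθ] at *
    linear_combination f * hσ'
  -- Both `u` and `v` solve `y' (1 - πX) = -π y` with constant term `1`, so their quotient has
  -- derivative zero.
  have hw : u * v⁻¹ = 1 := by
    apply derivative.ext
    · rw [derivative_one, Derivation.leibniz, derivative_inv', hv, hlin, ← hv, smul_eq_mul,
        smul_eq_mul]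
      have hvv : v * v⁻¹ = 1 := PowerSeries.mul_inv_cancel _ hv0
      linear_combination (v⁻¹) ^ 2 * hu' - v⁻¹ * derivative K u * hvv
    · simp [hu, hv, hf0]
  rw [← mul_one u, ← PowerSeries.inv_mul_cancel _ hv0, ← mul_assoc, hw, one_mul]

end ExpPowerSum

namespace MetaplecticData

variable {n : ℕ} {K : Type*} [Field K] [CharZero K] (F : MetaplecticData n K) [NeZero n]

/-- Conjugation of `u_m` by `exp(L₊(θ) - L₊(π))` for one variable `θ` and one variable `π`. -/
theorem expSeries_wedge_sub (θ π : K) (m : ℤ) (v : FockSpace K) :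
    expSeries (F.hamiltonian fun k => θ ^ k / k - π ^ k / k)
        (F.wedge m v - θ • F.wedge (m - n) v) =
      F.wedge m (expSeries (F.hamiltonian fun k => θ ^ k / k - π ^ k / k) v) -
        π • F.wedge (m - n) (expSeries (F.hamiltonian fun k => θ ^ k / k - π ^ k / k) v) := by
  have h : ∀ (c : K) (u : FockSpace K), F.wedge m u - c • F.wedge (m - n) u =
      F.seriesWedgeₗ m (1 - c • PowerSeries.X) u := by
    intro c u
    rw [map_sub, map_smul, LinearMap.sub_apply, LinearMap.smul_apply, seriesWedgeₗ_one,
      seriesWedgeₗ_X]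
  rw [h, h, F.expSeries_seriesWedgeₗ (by simp), exp_subst_powerSum_mul]

end MetaplecticData

/-! ## Packed wedges -/

namespace NormalWedge

/-- A wedge is packed if it contains all factors with negative index. -/
def IsPacked (w : NormalWedge) : Prop := ∀ j < 0, ∃ i, w.m i = j

/-- The wedge `u_{-1} ∧ u_{-2} ∧ ⋯`. -/
def vac : NormalWedge := ofStrict (Fin.elim0 : Fin 0 → ℕ) fun i => i.elim0

theorem vac_m (i : ℕ) : vac.m i = -1 - i := by
  simp [vac, ofStrict]

theorem vac_isVacuum : vac.IsVacuum := fun i => by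
  rw [vac_m, vac_m]
  push_cast
  ring

theorem vac_isPacked : vac.IsPacked := fun j hj => ⟨(-1 - j).toNat, by rw [vac_m]; omega⟩

theorem IsPacked.eq_vac {w : NormalWedge} (h : w.IsPacked) (h0 : w.m 0 < 0) : w = vac := by
  ext i
  rw [vac_m]
  induction i with
  | zero =>
    obtain ⟨k, hk⟩ := h (-1) (by omega)
    have := w.strictAnti.antitone (Nat.zero_le k)
    push_cast
    omega
  | succ i ih =>
    have h1 := w.strictAnti (Nat.lt_succ_self i)
    obtain ⟨k, hk⟩ := h (-1 - (i + 1 : ℕ)) (by push_cast; omega)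
    have hik : i < k := by
      by_contra hik
      have := w.strictAnti.antitone (not_lt.1 hik)
      push_cast at hk
      omega
    have h2 := w.strictAnti.antitone (Nat.succ_le_of_lt hik)
    rw [Nat.succ_eq_add_one] at h1 h2
    push_cast at hk ⊢
    omega

theorem IsPacked.tail {w : NormalWedge} (h : w.IsPacked) (h0 : 0 ≤ w.m 0) :
    w.tail.IsPacked := by
  intro j hj
  obtain ⟨i, hi⟩ := h j hj
  cases i with
  | zero => omega
  | succ i => exact ⟨i, hi⟩

theorem IsPacked.cons {w : NormalWedge} (h : w.IsPacked) (j : ℤ) (hj : w.m 0 < j) :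
    (w.cons j hj).IsPacked := by
  intro k hk
  obtain ⟨i, hi⟩ := h k hk
  exact ⟨i + 1, hi⟩

end NormalWedge

namespace MetaplecticData

variable {n : ℕ} {K : Type*} [Field K] (F : MetaplecticData n K)

variable (K) in
/-- The span of the packed wedges whose first index is less than `c`. -/
noncomputable def packedLT (c : ℤ) : Submodule K (FockSpace K) :=
  Finsupp.supported K K {w : NormalWedge | w.IsPacked ∧ w.m 0 < c}

theorem single_mem_packedLT {w : NormalWedge} {c : ℤ} (hw : w.IsPacked) (h : w.m 0 < c) (x : K) :
    Finsupp.single w x ∈ packedLT K c :=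
  Finsupp.single_mem_supported K x ⟨hw, h⟩

theorem packedLT_mono {c d : ℤ} (h : c ≤ d) : packedLT K c ≤ packedLT K d :=
  Finsupp.supported_mono fun _ hw => ⟨hw.1, lt_of_lt_of_le hw.2 h⟩

theorem packedLT_le_firstLT (c : ℤ) : packedLT K c ≤ firstLT K c :=
  Finsupp.supported_mono fun _ hw => hw.2

theorem packedLT_le {c : ℤ} {S : Submodule K (FockSpace K)}
    (h : ∀ w : NormalWedge, w.IsPacked → w.m 0 < c → Finsupp.single w (1 : K) ∈ S) :
    packedLT K c ≤ S := by
  rw [packedLT, Finsupp.supported_eq_span_single, Submodule.span_le]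
  rintro _ ⟨w, hw, rfl⟩
  exact h w hw.1 hw.2

/-- A packed wedge without nonnegative factors is the vacuum. This starts the inductions on the
number of columns. -/
theorem packedLT_zero_le {S : Submodule K (FockSpace K)}
    (h : Finsupp.single NormalWedge.vac (1 : K) ∈ S) : packedLT K 0 ≤ S :=
  packedLT_le fun w hw h0 => by rwa [hw.eq_vac h0]

variable [NeZero n]

theorem packedLT_succ_le {c : ℕ} {S : Submodule K (FockSpace K)} (h : packedLT K c ≤ S)
    (h' : ∀ v ∈ packedLT K c, F.wedge c v ∈ S) : packedLT K ((c + 1 : ℕ) : ℤ) ≤ S :=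
  packedLT_le fun w hw hc => by
    push_cast at hc
    by_cases hwc : w.m 0 < c
    · exact h (single_mem_packedLT hw hwc 1)
    · have hwc : w.m 0 = c := by omega
      rw [← F.wedge_tail w, hwc]
      exact h' _ (single_mem_packedLT (hw.tail (by omega)) (hwc ▸ w.tail_lt) 1)

theorem eqOn_packedLT_succ {E : Type*} [AddCommGroup E] [Module K E]
    {f g : FockSpace K →ₗ[K] E} {c : ℕ} (h : ∀ v ∈ packedLT K c, f v = g v)
    (h' : ∀ v ∈ packedLT K c, f (F.wedge c v) = g (F.wedge c v)) :
    ∀ v ∈ packedLT K ((c + 1 : ℕ) : ℤ), f v = g v :=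
  F.packedLT_succ_le (S := LinearMap.eqLocus f g) h h'

theorem wedge_mem_packedLT_succ {c : ℕ} {v : FockSpace K} (hv : v ∈ packedLT K c) :
    F.wedge c v ∈ packedLT K ((c + 1 : ℕ) : ℤ) := by
  have h : packedLT K c ≤ (packedLT K ((c + 1 : ℕ) : ℤ)).comap (F.wedge c) :=
    packedLT_le fun w hw hc => by
      rw [Submodule.mem_comap, F.wedge_single_of_lt hc]
      exact single_mem_packedLT (hw.cons c hc) (by simp) 1
  exact h hv

/-- The index `j` may be negative: the exchange relation involves `u_{c-n}`, which leaves the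
lattice when `c < n`, and such a factor is absorbed by the vacuum. -/
theorem wedge_mem_packedLT {c : ℕ} {j : ℤ} (hj : j < c) {v : FockSpace K}
    (hv : v ∈ packedLT K c) : F.wedge j v ∈ packedLT K c := by
  suffices h : packedLT K c ≤ (packedLT K c).comap (F.wedge j) from h hv
  clear hv
  induction c generalizing j with
  | zero =>
    refine packedLT_zero_le ?_
    rw [Submodule.mem_comap, F.wedge_vacuum NormalWedge.vac_isVacuum]
    · exact Submodule.zero_mem _
    · rw [NormalWedge.vac_m]
      push_cast at hj ⊢
      omega
  | succ c ih =>
    have hle : packedLT K c ≤ packedLT K ((c + 1 : ℕ) : ℤ) :=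
      packedLT_mono (by push_cast; omega)
    push_cast at hj
    refine F.packedLT_succ_le (fun v hv => ?_) fun v hv => ?_
    · rw [Submodule.mem_comap]
      by_cases h : j < c
      · exact hle (ih h hv)
      · obtain rfl : j = c := by omega
        exact F.wedge_mem_packedLT_succ hv
    · rw [Submodule.mem_comap]
      have hv' := packedLT_le_firstLT _ hv
      by_cases h : j < c
      · rw [F.wedge_wedge h hv']
        refine F.normalOrder_mem h _ fun a b h1 h2 h3 _ => ?_
        have hb := ih (by omega : b < c) hv
        by_cases ha : a < c
        · exact hle (ih ha hb)
        · obtain rfl : a = c := by omega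
          exact F.wedge_mem_packedLT_succ hb
      · obtain rfl : j = c := by omega
        rw [F.wedge_wedge_self hv']
        exact Submodule.zero_mem _

end MetaplecticData

/-! ## The row transfer operator -/

namespace MetaplecticData

variable {n : ℕ} {K : Type*} [Field K] (F : MetaplecticData n K) (x : ZMod n → K) (Q : K)

/-- The weight for a horizontal path of charge `a` to cross a vertical path. -/
def crossWeight (a : ZMod n) : K := x a * if a = 0 then -Q else F.g a

/-- One row of the lattice model with columns `0, …, c - 1`, with the given spin on the right
boundary and `+` on the left boundary, as an operator from the bottom to the top boundary. -/
noncomputable def rowAux : ℕ → DecoratedSpin n → NormalWedge → FockSpace K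
  | 0, none, w => Finsupp.single w 1
  | 0, some _, _ => 0
  | c + 1, none, w =>
      if w.m 0 = c then F.wedge c (rowAux c none w.tail) +
        ((1 - Q) * x 0) • rowAux c (some 1) w.tail
      else rowAux c none w
  | c + 1, some a, w =>
      if w.m 0 = c then F.crossWeight x Q a • F.wedge c (rowAux c (some (a + 1)) w.tail)
      else x a • rowAux c (some (a + 1)) w + if a = 0 then F.wedge c (rowAux c none w) else 0

/-- The linear extension of `rowAux`. -/
noncomputable def rowOp (c : ℕ) (h : DecoratedSpin n) : FockSpace K →ₗ[K] FockSpace K :=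
  Finsupp.linearCombination K (F.rowAux x Q c h)

variable {x Q}

theorem rowOp_zero_some (a : ZMod n) : F.rowOp x Q 0 (some a) = 0 := by
  refine Finsupp.lhom_ext' fun w => LinearMap.ext_ring ?_
  simp [rowOp, rowAux]

theorem rowOp_zero_none : F.rowOp x Q 0 none = LinearMap.id := by
  refine Finsupp.lhom_ext' fun w => LinearMap.ext_ring ?_
  simp [rowOp, rowAux]

theorem eqOn_firstLT {E : Type*} [AddCommGroup E] [Module K E] {c : ℤ}
    {f g : FockSpace K →ₗ[K] E}
    (h : ∀ w : NormalWedge, w.m 0 < c → f (Finsupp.single w 1) = g (Finsupp.single w 1)) :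
    ∀ v ∈ firstLT K c, f v = g v :=
  firstLT_induction (S := LinearMap.eqLocus f g) h

theorem rowOp_succ_none {c : ℕ} : ∀ v ∈ firstLT K (c : ℤ),
    F.rowOp x Q (c + 1) none v = F.rowOp x Q c none v :=
  eqOn_firstLT fun w hw => by simp [rowOp, rowAux, hw.ne]

theorem rowOp_succ_some {c : ℕ} (a : ZMod n) : ∀ v ∈ firstLT K (c : ℤ),
    F.rowOp x Q (c + 1) (some a) v = x a • F.rowOp x Q c (some (a + 1)) v +
      if a = 0 then F.wedge c (F.rowOp x Q c none v) else 0 := by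
  by_cases ha : a = 0
  · simp only [ha, if_true]
    exact eqOn_firstLT (f := F.rowOp x Q (c + 1) (some 0))
      (g := x 0 • F.rowOp x Q c (some (0 + 1)) + F.wedge c ∘ₗ F.rowOp x Q c none)
      fun w hw => by simp [rowOp, rowAux, hw.ne]
  · simp only [ha, if_false, add_zero]
    exact eqOn_firstLT (f := F.rowOp x Q (c + 1) (some a))
      (g := x a • F.rowOp x Q c (some (a + 1)))
      fun w hw => by simp [rowOp, rowAux, hw.ne, ha]

theorem natCast_ne_zero_of_lt {b : ℕ} (h0 : 0 < b) (h1 : b < n) : (b : ZMod n) ≠ 0 := by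
  exact_mod_cast intCast_ne_zero_of_lt (n := n) (a := b) (by omega) (by omega)

variable [NeZero n]

theorem rowOp_succ_none_wedge {c : ℕ} : ∀ v ∈ firstLT K (c : ℤ),
    F.rowOp x Q (c + 1) none (F.wedge c v) = F.wedge c (F.rowOp x Q c none v) +
      ((1 - Q) * x 0) • F.rowOp x Q c (some 1) v :=
  eqOn_firstLT (f := F.rowOp x Q (c + 1) none ∘ₗ F.wedge c)
    (g := F.wedge c ∘ₗ F.rowOp x Q c none + ((1 - Q) * x 0) • F.rowOp x Q c (some 1))
    fun w hw => by
      rw [LinearMap.comp_apply, F.wedge_single_of_lt hw]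
      simp [rowOp, rowAux]

theorem rowOp_succ_some_wedge {c : ℕ} (a : ZMod n) : ∀ v ∈ firstLT K (c : ℤ),
    F.rowOp x Q (c + 1) (some a) (F.wedge c v) =
      F.crossWeight x Q a • F.wedge c (F.rowOp x Q c (some (a + 1)) v) :=
  eqOn_firstLT (f := F.rowOp x Q (c + 1) (some a) ∘ₗ F.wedge c)
    (g := F.crossWeight x Q a • (F.wedge c ∘ₗ F.rowOp x Q c (some (a + 1))))
    fun w hw => by
      rw [LinearMap.comp_apply, F.wedge_single_of_lt hw]
      simp [rowOp, rowAux]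

theorem rowOp_mem_packedLT {c : ℕ} (h : DecoratedSpin n) {v : FockSpace K}
    (hv : v ∈ packedLT K c) : F.rowOp x Q c h v ∈ packedLT K c := by
  suffices H : packedLT K c ≤ (packedLT K c).comap (F.rowOp x Q c h) from H hv
  clear hv
  induction c generalizing h with
  | zero =>
    cases h with
    | none => rw [rowOp_zero_none]; exact fun v hv => hv
    | some a => rw [rowOp_zero_some]; exact fun v _ => by simp
  | succ c ih =>
    have hle : packedLT K c ≤ packedLT K ((c + 1 : ℕ) : ℤ) :=
      packedLT_mono (by push_cast; omega)
    refine F.packedLT_succ_le (fun v hv => ?_) fun v hv => ?_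
    · rw [Submodule.mem_comap]
      have hv' := packedLT_le_firstLT _ hv
      cases h with
      | none => rw [F.rowOp_succ_none v hv']; exact hle (ih none hv)
      | some a =>
        rw [F.rowOp_succ_some a v hv']
        refine Submodule.add_mem _ (Submodule.smul_mem _ _ (hle (ih _ hv))) ?_
        split_ifs
        · exact F.wedge_mem_packedLT_succ (ih none hv)
        · exact Submodule.zero_mem _
    · rw [Submodule.mem_comap]
      have hv' := packedLT_le_firstLT _ hv
      cases h with
      | none =>
        rw [F.rowOp_succ_none_wedge v hv']
        exact Submodule.add_mem _ (F.wedge_mem_packedLT_succ (ih none hv))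
          (Submodule.smul_mem _ _ (hle (ih _ hv)))
      | some a =>
        rw [F.rowOp_succ_some_wedge a v hv']
        exact Submodule.smul_mem _ _ (F.wedge_mem_packedLT_succ (ih _ hv))

/-- Exchange of `u_s` with a row whose right boundary edge carries a charge. -/
theorem rowOp_some_wedge (hQ : ∀ a : ZMod n, a ≠ 0 → F.g a * F.g (-a) = Q) {c b : ℕ} {s : ℤ}
    (hb : 0 < b) (hs0 : c - 1 - n + b < s) (hs1 : s ≤ c - 1) :
    ∀ v ∈ packedLT K c, F.g ((s - c + 1 - b : ℤ) : ZMod n) • F.rowOp x Q c (some b) (F.wedge s v) =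
      Q • F.wedge s (F.rowOp x Q c (some b) v) := by
  induction c generalizing b with
  | zero => intro v _; simp [rowOp_zero_some]
  | succ c ih =>
    push_cast at hs0 hs1
    -- The path with charge `b` at the right end has charge `b + c - s < n` just to the right of
    -- column `s`. Its charge is therefore nonzero on all these edges: it cannot turn before column
    -- `s`, and crossing `u_s` is governed by `g(a) g(-a) = Q`.
    have hbn : b < n := by omega
    have hb0 := natCast_ne_zero_of_lt hb hbn
    have hcross : F.crossWeight x Q b = x b * F.g b := by simp [crossWeight, hb0]
    have harg : s - ((c + 1 : ℕ) : ℤ) + 1 - b = s - c + 1 - (b + 1 : ℕ) := by push_cast; ring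
    rw [harg]
    refine F.eqOn_packedLT_succ
      (f := F.g ((s - c + 1 - (b + 1 : ℕ) : ℤ) : ZMod n) •
        (F.rowOp x Q (c + 1) (some b) ∘ₗ F.wedge s))
      (g := Q • (F.wedge s ∘ₗ F.rowOp x Q (c + 1) (some b))) (fun v hv => ?_) fun v hv => ?_
    all_goals
      have hv' := packedLT_le_firstLT _ hv
      simp only [LinearMap.smul_apply, LinearMap.comp_apply]
    · by_cases hsc : s < c
      · have ih' := ih (b := b + 1) (by omega) (by push_cast; omega) (by omega) v hv
        push_cast at ih' ⊢
        rw [F.rowOp_succ_some b v hv', F.rowOp_succ_some b _ (F.wedge_mem hsc hv'),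
          if_neg hb0, if_neg hb0, add_zero, add_zero, map_smul, smul_comm, ih', smul_comm]
      · obtain rfl : s = c := by omega
        rw [F.rowOp_succ_some_wedge b v hv', F.rowOp_succ_some b v hv', if_neg hb0, add_zero,
          map_smul, hcross, smul_smul, smul_smul]
        congr 1
        have h1 : ((c - c + 1 - (b + 1 : ℕ) : ℤ) : ZMod n) = -(b : ZMod n) := by
          push_cast; ring
        rw [h1, ← hQ b hb0]
        ring
    · by_cases hsc : s < c
      · have ih' := ih (b := b + 1) (by omega) (by push_cast; omega) (by omega) v hv
        push_cast at ih' ⊢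
        have hX := packedLT_le_firstLT _ (F.rowOp_mem_packedLT (x := x) (Q := Q)
          (some ((b : ZMod n) + 1)) hv)
        rw [F.wedge_near_of_mem hsc (by omega) hv', map_smul,
          F.rowOp_succ_some_wedge b _ (F.wedge_mem hsc hv'), F.rowOp_succ_some_wedge b v hv',
          map_smul, F.wedge_near_of_mem hsc (by omega) hX]
        have ih'' := congrArg (F.wedge c) ih'
        rw [map_smul, map_smul] at ih''
        linear_combination (norm := module)
          (F.g ((s - c : ℤ) : ZMod n) * F.crossWeight x Q b) • ih''
      · obtain rfl : s = c := by omega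
        have hX := packedLT_le_firstLT _ (F.rowOp_mem_packedLT (x := x) (Q := Q)
          (some ((b : ZMod n) + 1)) hv)
        rw [F.wedge_wedge_self hv', F.rowOp_succ_some_wedge b v hv', map_smul,
          F.wedge_wedge_self hX]
        simp

/-- A row whose right boundary edge carries a charge, in terms of rows without charge. -/
theorem rowOp_some_eq (hQ : ∀ a : ZMod n, a ≠ 0 → F.g a * F.g (-a) = Q) {c a : ℕ}
    (ha : 0 < a) (han : a ≤ n) :
    ∀ v ∈ packedLT K c, (1 - Q) • F.rowOp x Q c (some a) v =
      (∏ b ∈ Finset.Ico a n, x b) • (F.rowOp x Q c none (F.wedge (c - 1 - n + a) v) -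
        Q • F.wedge (c - 1 - n + a) (F.rowOp x Q c none v)) := by
  induction c generalizing a with
  | zero =>
    refine packedLT_zero_le (S := LinearMap.eqLocus ((1 - Q) • F.rowOp x Q 0 (some a))
      ((∏ b ∈ Finset.Ico a n, x b) • (F.rowOp x Q 0 none ∘ₗ F.wedge ((0 : ℕ) - 1 - n + a) -
        Q • F.wedge ((0 : ℕ) - 1 - n + a) ∘ₗ F.rowOp x Q 0 none))) ?_
    rw [LinearMap.mem_eqLocus, rowOp_zero_some, rowOp_zero_none]
    simp only [LinearMap.smul_apply, LinearMap.sub_apply, LinearMap.comp_apply, LinearMap.id_apply,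
      LinearMap.zero_apply]
    rw [F.wedge_vacuum NormalWedge.vac_isVacuum]
    · simp
    · rw [NormalWedge.vac_m]
      push_cast
      omega
  | succ c ih =>
    have harg : ((c + 1 : ℕ) : ℤ) - 1 - n + a = c - n + a := by push_cast; ring
    rw [harg]
    refine F.eqOn_packedLT_succ (f := (1 - Q) • F.rowOp x Q (c + 1) (some a))
      (g := (∏ b ∈ Finset.Ico a n, x b) • (F.rowOp x Q (c + 1) none ∘ₗ F.wedge (c - n + a) -
        Q • F.wedge (c - n + a) ∘ₗ F.rowOp x Q (c + 1) none)) (fun v hv => ?_) fun v hv => ?_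
    all_goals
      have hv' := packedLT_le_firstLT _ hv
      have hT := packedLT_le_firstLT _ (F.rowOp_mem_packedLT (x := x) (Q := Q) none hv)
      simp only [LinearMap.smul_apply, LinearMap.comp_apply, LinearMap.sub_apply]
    -- For `a = n` the charge is `0`, the only one with which the path may turn up into column `c`.
    -- For `a < n` it passes on, contributes `x a`, and the claim reduces to `a + 1` with one column
    -- less, with the same index `c - n + a`.
    · rcases han.eq_or_lt with rfl | han
      · rw [sub_add_cancel, F.rowOp_succ_none_wedge v hv', F.rowOp_succ_none v hv',
          F.rowOp_succ_some _ v hv', if_pos (by simp)]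
        simp only [CharP.cast_eq_zero, zero_add, Finset.Ico_self, Finset.prod_empty]
        module
      · have ha0 := natCast_ne_zero_of_lt ha han
        have hlt : (c : ℤ) - n + a < c := by omega
        have ih' := ih (a := a + 1) (by omega) han v hv
        rw [show (c : ℤ) - 1 - n + (a + 1 : ℕ) = c - n + a by push_cast; ring] at ih'
        push_cast at ih'
        rw [F.rowOp_succ_some _ v hv', if_neg ha0, add_zero, F.rowOp_succ_none v hv',
          F.rowOp_succ_none _ (F.wedge_mem hlt hv'), smul_comm, ih',
          Finset.prod_eq_prod_Ico_succ_bot han, smul_smul]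
    · rcases han.eq_or_lt with rfl | han
      · rw [sub_add_cancel, F.wedge_wedge_self hv', map_zero, F.rowOp_succ_none_wedge v hv',
          F.rowOp_succ_some_wedge _ v hv', map_add, F.wedge_wedge_self hT, map_smul]
        simp only [CharP.cast_eq_zero, zero_add, Finset.Ico_self, Finset.prod_empty, crossWeight,
          if_true]
        module
      · have ha0 := natCast_ne_zero_of_lt ha han
        have hlt : (c : ℤ) - n + a < c := by omega
        have ih' := ih (a := a + 1) (by omega) han v hv
        rw [show (c : ℤ) - 1 - n + (a + 1 : ℕ) = c - n + a by push_cast; ring] at ih'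
        -- A row with `-` at the bottom of column `c` may send a path to the left with charge `1`;
        -- the factor `u_{c-n+a}` has to be exchanged with that path.
        have hex := F.rowOp_some_wedge (x := x) hQ (c := c) (b := 1) (s := c - n + a) one_pos
          (by push_cast; omega) (by omega) v hv
        have hg1 : (((c : ℤ) - n + a - c + 1 - (1 : ℕ) : ℤ) : ZMod n) = a := by
          push_cast; simp
        have hg2 : (((c : ℤ) - n + a - c : ℤ) : ZMod n) = a := by
          push_cast; simp
        rw [hg1] at hex
        push_cast at ih' hex
        rw [F.wedge_near_of_mem hlt (by omega) hv', hg2, map_smul,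
          F.rowOp_succ_none_wedge _ (F.wedge_mem hlt hv'), F.rowOp_succ_none_wedge v hv',
          F.rowOp_succ_some_wedge _ v hv', map_add, F.wedge_near_of_mem hlt (by omega) hT, hg2,
          map_smul, Finset.prod_eq_prod_Ico_succ_bot han]
        have ih'' := congrArg (F.wedge c) ih'
        simp only [map_smul, map_sub] at ih''
        simp only [crossWeight, if_neg ha0]
        linear_combination (norm := module) (x a * F.g a) • ih'' -
          (x a * (∏ b ∈ Finset.Ico (a + 1) n, x b) * ((1 - Q) * x 0)) • hex

end MetaplecticData

/-! ### The row operator as the exponential of a Hamiltonian -/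

theorem ZMod.prod_univ_eq_prod_range {K : Type*} [CommMonoid K] (n : ℕ) [NeZero n]
    (x : ZMod n → K) : ∏ a, x a = ∏ b ∈ Finset.range n, x b := by
  symm
  refine Finset.prod_bij (fun b _ => (b : ZMod n)) (fun _ _ => Finset.mem_univ _) ?_ ?_
    fun _ _ => rfl
  · intro a ha b hb hab
    rw [Finset.mem_range] at ha hb
    rw [ZMod.natCast_eq_natCast_iff', Nat.mod_eq_of_lt ha, Nat.mod_eq_of_lt hb] at hab
    exact hab
  · intro b _
    exact ⟨b.val, by simpa using ZMod.val_lt b, ZMod.natCast_zmod_val b⟩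

namespace MetaplecticData

variable {n : ℕ} {K : Type*} [Field K] (F : MetaplecticData n K) [NeZero n]
  {x : ZMod n → K} {Q : K}

/-- The exchange relation of the row operator with `u_c`. -/
theorem rowOp_none_wedge (hQ : ∀ a : ZMod n, a ≠ 0 → F.g a * F.g (-a) = Q) {c : ℕ}
    {v : FockSpace K} (hv : v ∈ packedLT K c) :
    F.rowOp x Q (c + 1) none (F.wedge c v) = F.wedge c (F.rowOp x Q c none v) +
      (∏ a, x a) • (F.rowOp x Q c none (F.wedge (c - n) v) -
        Q • F.wedge (c - n) (F.rowOp x Q c none v)) := by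
  have hn : 0 < n := Nat.pos_of_ne_zero (NeZero.ne n)
  have h := F.rowOp_some_eq (x := x) hQ (c := c) one_pos hn v hv
  rw [show (c : ℤ) - 1 - n + (1 : ℕ) = c - n by push_cast; ring] at h
  push_cast at h
  rw [F.rowOp_succ_none_wedge v (packedLT_le_firstLT _ hv), mul_comm, mul_smul, h, smul_smul,
    ZMod.prod_univ_eq_prod_range, Finset.range_eq_Ico, Finset.prod_eq_prod_Ico_succ_bot hn]
  simp

/-- The row operator is the exponential of a Hamiltonian. -/
theorem rowOp_none_eq_expSeries [CharZero K] (hQ : ∀ a : ZMod n, a ≠ 0 → F.g a * F.g (-a) = Q)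
    {θ π : K} (hθ : θ = ∏ a, x a) (hπ : π = Q * θ) (c : ℕ) :
    ∀ v ∈ packedLT K c, F.rowOp x Q c none v =
      expSeries (F.hamiltonian fun k => θ ^ k / k - π ^ k / k) v := by
  have hnil : IsLocallyNilpotent (F.hamiltonian fun k : ℕ => θ ^ k / k - π ^ k / k) :=
    F.hamiltonian_isLocallyNilpotent (by simp)
  have hn : (0 : ℤ) < n := by exact_mod_cast Nat.pos_of_ne_zero (NeZero.ne n)
  induction c with
  | zero =>
    refine packedLT_zero_le (S := LinearMap.eqLocus (F.rowOp x Q 0 none) (expLinear _ hnil)) ?_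
    rw [LinearMap.mem_eqLocus, rowOp_zero_none]
    exact (expSeries_of_apply_eq_zero
      (F.hamiltonian_vacuum _ NormalWedge.vac_isVacuum)).symm
  | succ c ih =>
    refine F.eqOn_packedLT_succ (f := F.rowOp x Q (c + 1) none) (g := expLinear _ hnil)
      (fun v hv => ?_) fun v hv => ?_
    · rw [F.rowOp_succ_none v (packedLT_le_firstLT _ hv)]
      exact ih v hv
    · have h := F.expSeries_wedge_sub θ π c v
      change expLinear _ hnil _ = _ at h
      rw [map_sub, map_smul] at h
      rw [F.rowOp_none_wedge hQ hv, ih v hv, ih _ (F.wedge_mem_packedLT (by omega) hv), ← hθ]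
      change _ = expLinear _ hnil _
      have hs : ∀ u : FockSpace K, π • u = (Q * θ) • u := fun u => by rw [hπ]
      rw [eq_add_of_sub_eq h, hs]
      change _ = _ - _ + θ • expSeries _ _
      module

end MetaplecticData

/-! ## Sums over paths -/

section PathSum

variable {α R : Type*} [Fintype α] [DecidableEq α] [CommSemiring R]

/-- The sum over all paths from `a` to `b` of the products of the weights of the steps. -/
def pathSum {k : ℕ} (w : Fin k → α → α → R) (a b : α) : R :=
  ∑ f : Fin (k + 1) → α with f 0 = a ∧ f (Fin.last k) = b,
    ∏ i, w i (f i.castSucc) (f i.succ)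

theorem pathSum_zero (w : Fin 0 → α → α → R) (a b : α) :
    pathSum w a b = if a = b then 1 else 0 := by
  rw [pathSum]
  simp only [Finset.univ_eq_empty, Finset.prod_empty, Finset.sum_const, nsmul_eq_mul, mul_one]
  split_ifs with h
  · subst h
    rw [show (Finset.univ.filter fun f : Fin 1 → α => f 0 = a ∧ f (Fin.last 0) = a) =
      {fun _ => a} from ?_]
    · simp
    · ext f
      simp only [Finset.mem_filter, Finset.mem_univ, true_and, Finset.mem_singleton]
      refine ⟨fun hf => funext fun i => ?_, fun hf => by simp [hf]⟩
      rw [Subsingleton.elim i 0, hf.1]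
  · rw [Finset.filter_false_of_mem]
    · simp
    · rintro f - ⟨h1, h2⟩
      exact h (h1.symm.trans h2)

theorem pathSum_succ {k : ℕ} (w : Fin (k + 1) → α → α → R) (a b : α) :
    pathSum w a b = ∑ c, w 0 a c * pathSum (fun i => w i.succ) c b := by
  simp only [pathSum, Finset.mul_sum, Finset.sum_filter]
  rw [Finset.sum_comm, ← (Fin.consEquiv fun _ => α).sum_comp, Fintype.sum_prod_type,
    Finset.sum_comm]
  refine Finset.sum_congr rfl fun f _ => ?_
  rw [Finset.sum_eq_single a, Finset.sum_eq_single (f 0)]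
  · simp only [Fin.consEquiv, Equiv.coe_fn_mk, Fin.cons_zero, true_and, Fin.prod_univ_succ,
      ← Fin.succ_last, Fin.cons_succ, Fin.castSucc_zero, ← Fin.succ_castSucc]
    rw [mul_ite, mul_zero]
  · intro c _ hc
    rw [if_neg fun h => hc h.1.symm, mul_zero]
  · simp
  · intro c _ hc
    rw [if_neg]
    simp only [Fin.consEquiv, Equiv.coe_fn_mk, Fin.cons_zero]
    exact fun h => hc h.1
  · simp

theorem pathSum_succ_last {k : ℕ} (w : Fin (k + 1) → α → α → R) (a b : α) :
    pathSum w a b = ∑ c, pathSum (fun i => w i.castSucc) a c * w (Fin.last k) c b := by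
  induction k generalizing a with
  | zero =>
    rw [pathSum_succ]
    simp [pathSum_zero]
  | succ k ih =>
    rw [pathSum_succ]
    simp only [ih, Finset.mul_sum, pathSum_succ (fun i : Fin (k + 1) => w i.castSucc),
      Finset.sum_mul]
    rw [Finset.sum_comm]
    refine Finset.sum_congr rfl fun d _ => Finset.sum_congr rfl fun c _ => ?_
    simp only [Fin.succ_last, Fin.succ_castSucc, Fin.castSucc_zero, mul_assoc]

end PathSum

/-! ## Wedges of boundary spins -/

/-- The number of spins `-`. -/
def countSpins {c : ℕ} (β : Fin c → Bool) : ℕ := ∑ j, (β j).toNat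

theorem NormalWedge.ext_range {w w' : NormalWedge} (h : ∀ j, (∃ i, w.m i = j) ↔ ∃ i, w'.m i = j) :
    w = w' := by
  have h1 : StrictMono fun i => OrderDual.toDual (w.m i) := fun i j hij => w.strictAnti hij
  have h2 : StrictMono fun i => OrderDual.toDual (w'.m i) := fun i j hij => w'.strictAnti hij
  refine NormalWedge.ext ((h1.range_inj h2).1 (Set.ext fun j => ?_))
  exact h (OrderDual.ofDual j)

namespace NormalWedge

variable {ℓ : ℕ} {κ : Fin ℓ → ℕ} (hκ : StrictAnti κ)

theorem ofStrict_isPacked : (ofStrict κ hκ).IsPacked := by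
  intro j hj
  refine ⟨(ℓ - 1 - j).toNat, ?_⟩
  have h : ¬ (ℓ - 1 - j).toNat < ℓ := by omega
  simp only [ofStrict, h, dif_neg, not_false_eq_true]
  omega

theorem exists_ofStrict_iff (j : ℕ) : (∃ i, (ofStrict κ hκ).m i = j) ↔ ∃ i, κ i = j := by
  constructor
  · rintro ⟨i, hi⟩
    by_cases h : i < ℓ
    · simp only [ofStrict, h, dif_pos] at hi
      exact ⟨⟨i, h⟩, by exact_mod_cast hi⟩
    · simp only [ofStrict, h, dif_neg, not_false_eq_true] at hi
      omega
  · rintro ⟨i, hi⟩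
    exact ⟨i, by simp [ofStrict, hi]⟩

end NormalWedge

theorem countSpins_boundarySpins {ℓ M : ℕ} {κ : Fin ℓ → ℕ} (hκ : StrictAnti κ)
    (hM : ∀ i, κ i ≤ M) : countSpins (boundarySpins M κ) = ℓ := by
  have h : countSpins (boundarySpins M κ) =
      (Finset.univ.image fun i : Fin ℓ => (⟨κ i, Nat.lt_succ_of_le (hM i)⟩ : Fin (M + 1))).card := by
    rw [countSpins, Finset.card_eq_sum_ones, ← Finset.sum_subset (Finset.subset_univ _)]
    · refine Finset.sum_congr rfl fun j hj => ?_
      obtain ⟨i, -, rfl⟩ := Finset.mem_image.1 hj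
      simp [boundarySpins]
    · intro j _ hj
      have : ¬ ∃ i, κ i = j := by
        rintro ⟨i, hi⟩
        exact hj (Finset.mem_image.2 ⟨i, Finset.mem_univ _, Fin.ext hi⟩)
      simp only [boundarySpins, this, decide_false, Bool.toNat_false]
  rw [h, Finset.card_image_of_injective, Finset.card_univ, Fintype.card_fin]
  intro i j hij
  exact hκ.injective (by simpa using hij)

namespace MetaplecticData

variable {n : ℕ} {K : Type*} [Field K] (F : MetaplecticData n K)

/-- The packed wedge whose factors with nonnegative index are given by the spins `-`. -/
noncomputable def spinWedge : (c : ℕ) → (Fin c → Bool) → FockSpace K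
  | 0, _ => Finsupp.single NormalWedge.vac 1
  | c + 1, β =>
      if β (Fin.last c) then F.wedge c (spinWedge c fun j => β j.castSucc)
      else spinWedge c fun j => β j.castSucc

variable [NeZero n]

theorem exists_spinWedge_eq_single (c : ℕ) (β : Fin c → Bool) :
    ∃ w : NormalWedge, F.spinWedge c β = Finsupp.single w 1 ∧ w.IsPacked ∧ w.m 0 < c ∧
      ∀ j : Fin c, (∃ i, w.m i = (j : ℕ)) ↔ β j = true := by
  induction c with
  | zero =>
    exact ⟨NormalWedge.vac, rfl, NormalWedge.vac_isPacked, by simp [NormalWedge.vac_m],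
      fun j => j.elim0⟩
  | succ c ih =>
    obtain ⟨w, h1, h2, h3, h4⟩ := ih fun j => β j.castSucc
    by_cases hβ : β (Fin.last c) = true
    · refine ⟨w.cons c h3, ?_, h2.cons c h3, by simp, fun j => ?_⟩
      · rw [spinWedge, if_pos hβ, h1, F.wedge_single_of_lt h3]
      · refine Fin.lastCases ?_ (fun j => ?_) j
        · simp only [hβ, iff_true]
          exact ⟨0, by simp⟩
        · rw [← h4 j]
          constructor
          · rintro ⟨i, hi⟩
            cases i with
            | zero =>
              have hj := j.isLt
              simp only [NormalWedge.cons_zero, Fin.val_castSucc] at hi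
              omega
            | succ i => exact ⟨i, hi⟩
          · rintro ⟨i, hi⟩
            exact ⟨i + 1, hi⟩
    · refine ⟨w, ?_, h2, by push_cast; omega, fun j => ?_⟩
      · rw [spinWedge, if_neg hβ, h1]
      · refine Fin.lastCases ?_ (fun j => ?_) j
        · refine iff_of_false ?_ hβ
          rintro ⟨i, hi⟩
          have := w.strictAnti.antitone (Nat.zero_le i)
          simp only [Fin.val_last] at hi
          omega
        · exact h4 j

theorem spinWedge_mem_packedLT (c : ℕ) (β : Fin c → Bool) :
    F.spinWedge c β ∈ packedLT K c := by
  obtain ⟨w, h1, h2, h3, -⟩ := F.exists_spinWedge_eq_single c β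
  rw [h1]
  exact single_mem_packedLT h2 h3 1

theorem spinWedge_boundarySpins {ℓ M : ℕ} {κ : Fin ℓ → ℕ} (hκ : StrictAnti κ)
    (hM : ∀ i, κ i ≤ M) : F.spinWedge (M + 1) (boundarySpins M κ) =
      Finsupp.single (NormalWedge.ofStrict κ hκ) 1 := by
  obtain ⟨w, h1, h2, h3, h4⟩ := F.exists_spinWedge_eq_single (M + 1) (boundarySpins M κ)
  rw [h1]
  congr 1
  refine NormalWedge.ext_range fun j => ?_
  by_cases hj : j < 0
  · exact iff_of_true (h2 j hj) (NormalWedge.ofStrict_isPacked hκ j hj)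
  · obtain ⟨k, rfl⟩ : ∃ k : ℕ, j = k := ⟨j.toNat, by omega⟩
    rw [NormalWedge.exists_ofStrict_iff]
    by_cases hk : k < M + 1
    · rw [h4 ⟨k, hk⟩]
      simp [boundarySpins]
    · refine iff_of_false ?_ ?_
      · rintro ⟨i, hi⟩
        have := w.strictAnti.antitone (Nat.zero_le i)
        push_cast at h3
        omega
      · rintro ⟨i, hi⟩
        have := hM i
        omega

theorem spinWedge_apply_ofStrict {ℓ M : ℕ} {κ : Fin ℓ → ℕ} (hκ : StrictAnti κ)
    (hM : ∀ i, κ i ≤ M) (β : Fin (M + 1) → Bool) :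
    F.spinWedge (M + 1) β (NormalWedge.ofStrict κ hκ) =
      if β = boundarySpins M κ then 1 else 0 := by
  split_ifs with h
  · rw [h, F.spinWedge_boundarySpins hκ hM, Finsupp.single_eq_same]
  · obtain ⟨w, h1, -, -, h4⟩ := F.exists_spinWedge_eq_single (M + 1) β
    rw [h1, Finsupp.single_eq_of_ne]
    rintro rfl
    refine h (funext fun j => ?_)
    rw [Bool.eq_iff_iff, ← h4 j, NormalWedge.exists_ofStrict_iff]
    simp [boundarySpins]

/-! ## Rows of the lattice models -/

/-- The vertex weights `V left ν right κ` are those of the row operator, up to the factor `A` for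
each vertex, the factor `B` for each spin `-` of `κ`, the factor `ε` for a horizontal path which
enters from the right, and the translation `τ` of charges. -/
structure IsRowVertex (V : DecoratedSpin n → Bool → DecoratedSpin n → Bool → K)
    (A B ε : K) (x : ZMod n → K) (Q : K) (τ : ZMod n ≃ ZMod n) : Prop where
  none_false : ∀ Φ : DecoratedSpin n → Bool → FockSpace K,
    ∑ l, ∑ b, V l b none false • Φ l b = A • Φ none false
  none_true : ∀ Φ : DecoratedSpin n → Bool → FockSpace K, ∃ σ : K,
    σ * ε = A * B * ((1 - Q) * x 0) ∧
    ∑ l, ∑ b, V l b none true • Φ l b = (A * B) • Φ none true + σ • Φ (some (τ.symm 1)) false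
  some_false : ∀ (Φ : DecoratedSpin n → Bool → FockSpace K) (r : ZMod n),
    ∑ l, ∑ b, V l b (some r) false • Φ l b =
      (A * x (τ r)) • Φ (some (τ.symm (τ r + 1))) false +
        if τ r = 0 then (A * ε) • Φ none true else 0
  some_true : ∀ (Φ : DecoratedSpin n → Bool → FockSpace K) (r : ZMod n),
    ∑ l, ∑ b, V l b (some r) true • Φ l b =
      (A * B * F.crossWeight x Q (τ r)) • Φ (some (τ.symm (τ r + 1))) true
  conserve : ∀ l b r b', V l b r b' ≠ 0 → l.isSome.toNat + b.toNat = b'.toNat + r.isSome.toNat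

/-- The partition function of a row with columns `0, …, c - 1`, with spin `+` on the left and `h`
on the right. -/
def rowSum (V : DecoratedSpin n → Bool → DecoratedSpin n → Bool → K) {c : ℕ}
    (β ν : Fin c → Bool) (h : DecoratedSpin n) : K :=
  pathSum (fun j l r => V l (ν j) r (β j)) none h

theorem rowSum_succ (V : DecoratedSpin n → Bool → DecoratedSpin n → Bool → K) {c : ℕ}
    (β ν : Fin (c + 1) → Bool) (h : DecoratedSpin n) :
    rowSum V β ν h = ∑ l, rowSum V (fun j => β j.castSucc) (fun j => ν j.castSucc) l *
      V l (ν (Fin.last c)) h (β (Fin.last c)) :=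
  pathSum_succ_last _ _ _

variable {F} {V : DecoratedSpin n → Bool → DecoratedSpin n → Bool → K} {A B ε Q : K}
  {x : ZMod n → K} {τ : ZMod n ≃ ZMod n}

/-- Summing spin conservation over the vertices of a row. With `+` at both ends every row preserves
the number of spins `-`, which is why `B` occurs with the same exponent in each row. -/
theorem IsRowVertex.countSpins_eq (hV : F.IsRowVertex V A B ε x Q τ) {c : ℕ}
    (β ν : Fin c → Bool) (h : DecoratedSpin n) (hne : rowSum V β ν h ≠ 0) :
    countSpins ν = countSpins β + h.isSome.toNat := by
  induction c generalizing h with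
  | zero =>
    rw [rowSum, pathSum_zero] at hne
    have h0 : none = h := by
      by_contra h0
      exact hne (if_neg h0)
    simp [countSpins, ← h0]
  | succ c ih =>
    rw [rowSum_succ] at hne
    obtain ⟨l, -, hl⟩ := Finset.exists_ne_zero_of_sum_ne_zero hne
    have h1 := ih _ _ l (left_ne_zero_of_mul hl)
    have h2 := hV.conserve _ _ _ _ (right_ne_zero_of_mul hl)
    simp only [countSpins, Fin.sum_univ_castSucc] at h1 ⊢
    omega

/-- Split off the rightmost column: the clauses of `IsRowVertex` match the recursion of the row
operator. The factor `ε` records the different splittings of the product `c₁ c₂` between the start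
and the end of a path. -/
theorem IsRowVertex.sum_rowSum (hV : F.IsRowVertex V A B ε x Q τ) {c : ℕ} (β : Fin c → Bool)
    (h : DecoratedSpin n) :
    ∑ ν : Fin c → Bool, rowSum V β ν h • F.spinWedge c ν =
      (A ^ c * B ^ countSpins β * if h.isSome then ε else 1) •
        F.rowOp x Q c (h.map τ) (F.spinWedge c β) := by
  induction c generalizing h with
  | zero =>
    cases h with
    | none => simp [rowSum, pathSum_zero, rowOp_zero_none, countSpins, spinWedge]
    | some r => simp [rowSum, pathSum_zero, rowOp_zero_some]
  | succ c ih =>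
    set β' : Fin c → Bool := fun j => β j.castSucc
    -- The contribution of the columns left of the last one, given the spin `l` on the edge between
    -- them and the spin `b` above the last column.
    set Φ : DecoratedSpin n → Bool → FockSpace K := fun l b =>
      (if b then F.wedge c else LinearMap.id)
        ((A ^ c * B ^ countSpins β' * if l.isSome then ε else 1) •
          F.rowOp x Q c (l.map τ) (F.spinWedge c β')) with hΦ
    have hsum : ∑ ν : Fin (c + 1) → Bool, rowSum V β ν h • F.spinWedge (c + 1) ν =
        ∑ l, ∑ b, V l b h (β (Fin.last c)) • Φ l b := by
      rw [← (Fin.snocEquiv fun _ => Bool).sum_comp, Fintype.sum_prod_type, Finset.sum_comm]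
      rw [Finset.sum_comm (s := (Finset.univ : Finset (DecoratedSpin n)))]
      rw [Finset.sum_comm]
      refine Finset.sum_congr rfl fun b _ => ?_
      simp only [hΦ, ← ih, map_sum, map_smul, Finset.smul_sum]
      rw [Finset.sum_comm]
      refine Finset.sum_congr rfl fun ν _ => ?_
      rw [rowSum_succ, Finset.sum_smul]
      refine Finset.sum_congr rfl fun l _ => ?_
      simp only [Fin.snocEquiv, Equiv.coe_fn_mk, Fin.snoc_castSucc, Fin.snoc_last, spinWedge]
      rw [mul_comm, mul_smul]
      cases b <;> rfl
    have hB : spinWedge F (c + 1) β = if β (Fin.last c) then F.wedge c (F.spinWedge c β')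
      else F.spinWedge c β' := rfl
    have hcnt : countSpins β = countSpins β' + (β (Fin.last c)).toNat := by
      simp only [countSpins, Fin.sum_univ_castSucc, β']
    have hmem := packedLT_le_firstLT _ (F.spinWedge_mem_packedLT c β')
    rw [hsum, hB, hcnt]
    cases hβ : β (Fin.last c) with
    | false =>
      simp only [Bool.false_eq_true, if_false, Bool.toNat_false, add_zero]
      cases h with
      | none =>
        rw [hV.none_false, Option.map_none, F.rowOp_succ_none _ hmem]
        simp only [hΦ, Option.isSome_none, Bool.false_eq_true, if_false, LinearMap.id_apply,
          Option.map_none, smul_smul]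
        congr 1
        ring
      | some r =>
        rw [hV.some_false, Option.map_some, F.rowOp_succ_some _ _ hmem]
        simp only [hΦ, Option.isSome_none, Bool.false_eq_true, if_false, LinearMap.id_apply,
          Option.map_none, Option.isSome_some, if_true, Option.map_some, Equiv.apply_symm_apply,
          map_smul, smul_smul, smul_add]
        congr 1
        · congr 1
          ring
        · split_ifs
          · congr 1
            ring
          · rw [smul_zero]
    | true =>
      simp only [if_true, Bool.toNat_true]
      cases h with
      | none =>
        obtain ⟨σ, hσ, hs⟩ := hV.none_true Φ
        rw [hs, Option.map_none, F.rowOp_succ_none_wedge _ hmem]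
        simp only [hΦ, Option.isSome_none, Bool.false_eq_true, if_false, LinearMap.id_apply,
          Option.map_none, Option.isSome_some, if_true, Option.map_some, Equiv.apply_symm_apply,
          map_smul, smul_smul, smul_add]
        congr 1
        · congr 1
          ring
        · congr 1
          linear_combination A ^ c * B ^ countSpins β' * hσ
      | some r =>
        rw [hV.some_true, Option.map_some, F.rowOp_succ_some_wedge _ _ hmem]
        simp only [hΦ, Option.isSome_some, if_true, Option.map_some, Equiv.apply_symm_apply,
          map_smul, smul_smul]
        congr 1
        ring

end MetaplecticData

/-! ### Composition of rows -/

namespace MetaplecticData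

variable {n : ℕ} {K : Type*} [Field K] [CharZero K] (F : MetaplecticData n K) [NeZero n]

/-- Several rows in terms of the exponentials given by each row. -/
theorem sum_pathSum_spinWedge {N c : ℕ} (T : Fin N → (Fin c → Bool) → (Fin c → Bool) → K)
    (A B : Fin N → K) (s : Fin N → ℕ → K) (hs : ∀ i, s i 0 = 0)
    (hT : ∀ i β ν, T i β ν ≠ 0 → countSpins ν = countSpins β)
    (hsum : ∀ i β, ∑ ν, T i β ν • F.spinWedge c ν =
      (A i ^ c * B i ^ countSpins β) • expSeries (F.hamiltonian (s i)) (F.spinWedge c β))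
    (β : Fin c → Bool) :
    ∑ ν, pathSum T β ν • F.spinWedge c ν =
      (∏ i, A i ^ c * B i ^ countSpins β) •
        expSeries (F.hamiltonian (∑ i, s i)) (F.spinWedge c β) := by
  induction N generalizing β with
  | zero =>
    simp only [pathSum_zero, ite_smul, one_smul, zero_smul, Finset.sum_ite_eq, Finset.mem_univ,
      if_true, Finset.univ_eq_empty, Finset.prod_empty, Finset.sum_empty, F.hamiltonian_zero]
    rw [expSeries_of_apply_eq_zero (by simp)]
  | succ N ih =>
    have hs' : (∑ i : Fin N, s i.succ) 0 = 0 := by simp [hs]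
    have h1 : ∀ γ, T 0 β γ • ∑ ν, pathSum (fun i => T i.succ) γ ν • F.spinWedge c ν =
        (∏ i : Fin N, A i.succ ^ c * B i.succ ^ countSpins β) •
          expLinear (F.hamiltonian (∑ i : Fin N, s i.succ))
            (F.hamiltonian_isLocallyNilpotent hs') (T 0 β γ • F.spinWedge c γ) := by
      intro γ
      -- For a nonzero weight `γ` has as many spins as `β`, so the scalar prefactor of the remaining
      -- rows does not depend on `γ` and comes out of the sum.
      by_cases h0 : T 0 β γ = 0
      · rw [h0, zero_smul, zero_smul, map_zero, smul_zero]
      · rw [ih (fun i => T i.succ) (fun i => A i.succ) (fun i => B i.succ) (fun i => s i.succ)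
          (fun i => hs i.succ) (fun i => hT i.succ) (fun i => hsum i.succ), hT 0 β γ h0, map_smul,
          smul_comm]
        rfl
    simp only [pathSum_succ, Finset.sum_smul, mul_smul]
    rw [Finset.sum_comm]
    simp only [← Finset.smul_sum, h1]
    rw [← map_sum, hsum, map_smul, smul_smul, Fin.prod_univ_succ, Fin.sum_univ_succ,
      F.hamiltonian_add, add_comm (F.hamiltonian (s 0)),
      expSeries_add_of_commute (F.hamiltonian_isLocallyNilpotent hs')
        (F.hamiltonian_isLocallyNilpotent (hs 0)) (F.commute_hamiltonian _ _), mul_comm]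
    rfl

/-- The partition function of a lattice model whose rows are row operators. -/
theorem pathSum_rowSum_eq {N M ℓ : ℕ}
    (V : Fin N → DecoratedSpin n → Bool → DecoratedSpin n → Bool → K)
    (A B ε Q θ π : Fin N → K) (x : Fin N → ZMod n → K) (τ : Fin N → ZMod n ≃ ZMod n)
    (hV : ∀ i, F.IsRowVertex (V i) (A i) (B i) (ε i) (x i) (Q i) (τ i))
    (hQ : ∀ i, ∀ a ≠ 0, F.g a * F.g (-a) = Q i) (hθ : ∀ i, θ i = ∏ a, x i a)
    (hπ : ∀ i, π i = Q i * θ i) (lam mu : Fin ℓ → ℕ) (hlam : Antitone lam) (hmu : Antitone mu)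
    (hMlam : ∀ i, addRho lam i ≤ M) (hMmu : ∀ i, addRho mu i ≤ M) :
    pathSum (fun i β ν => rowSum (V i) β ν none) (boundarySpins M (addRho lam))
        (boundarySpins M (addRho mu)) =
      (∏ i, A i ^ (M + 1) * B i ^ ℓ) * superLLT F lam mu hlam hmu θ π := by
  have h := F.sum_pathSum_spinWedge (c := M + 1) (fun i β ν => rowSum (V i) β ν none) A B
    (fun i k => θ i ^ k / k - π i ^ k / k) (by simp)
    (fun i β ν hne => by simpa using (hV i).countSpins_eq β ν none hne)
    (fun i β => by
      rw [(hV i).sum_rowSum, Option.map_none,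
        F.rowOp_none_eq_expSeries (hQ i) (hθ i) (hπ i) _ _ (F.spinWedge_mem_packedLT _ _)]
      simp)
    (boundarySpins M (addRho lam))
  have h' := DFunLike.congr_fun h
    (NormalWedge.ofStrict (addRho mu) (addRho_strictAnti hmu))
  rw [countSpins_boundarySpins (addRho_strictAnti hlam) hMlam,
    F.spinWedge_boundarySpins (addRho_strictAnti hlam) hMlam, Finsupp.finsetSum_apply,
    Finsupp.smul_apply, smul_eq_mul] at h'
  simp only [Finsupp.smul_apply, smul_eq_mul,
    F.spinWedge_apply_ofStrict (addRho_strictAnti hmu) hMmu, mul_ite, mul_one, mul_zero,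
    Finset.sum_ite_eq', Finset.mem_univ, if_true] at h'
  rw [h']
  congr 1
  have hsum : (∑ i, fun k : ℕ => θ i ^ k / (k : K) - π i ^ k / k) =
      fun k : ℕ => ∑ j, θ j ^ k / (k : K) - ∑ j, π j ^ k / k := by
    ext k
    rw [Finset.sum_apply, Finset.sum_sub_distrib]
  rw [hsum]
  rfl

end MetaplecticData

/-! ## Partition functions as sums over rows -/

/-- Once the vertical spins are fixed, the horizontal edges of different rows are independent, so
the sum over states is a product of row sums. -/
theorem sum_boundaryConfigurations_eq_pathSum {n N M ℓ : ℕ} [NeZero n] {K : Type*} [Field K]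
    (V : Fin N → DecoratedSpin n → Bool → DecoratedSpin n → Bool → K) (κ ν : Fin ℓ → ℕ) :
    ∑ s ∈ boundaryConfigurations n N M κ ν, ∏ i : Fin N, ∏ c : Fin (M + 1),
      V i (s.horiz i c.castSucc) (s.vert i.succ c) (s.horiz i c.succ) (s.vert i.castSucc c) =
    pathSum (fun i β ν => MetaplecticData.rowSum (V i) β ν none) (boundarySpins M κ)
      (boundarySpins M ν) := by
  have hset : boundaryConfigurations n N M κ ν =
      (Finset.univ.filter fun f : Fin (N + 1) → Fin (M + 1) → Bool =>
        f 0 = boundarySpins M κ ∧ f (Fin.last N) = boundarySpins M ν) ×ˢ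
      Fintype.piFinset fun _ : Fin N => Finset.univ.filter fun g : Fin (M + 2) → DecoratedSpin n =>
        g 0 = none ∧ g (Fin.last (M + 1)) = none := by
    ext s
    rw [boundaryConfigurations, Finset.mem_filter, Finset.mem_product, Finset.mem_filter,
      Fintype.mem_piFinset]
    simp only [Finset.mem_filter, Finset.mem_univ, true_and, and_assoc]
    rfl
  rw [hset, Finset.sum_product, pathSum]
  refine Finset.sum_congr rfl fun f _ => ?_
  simp only [MetaplecticData.rowSum, pathSum]
  rw [Finset.prod_univ_sum]
  rfl

/-! ## The two models -/

namespace ChargedParams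

variable {n N : ℕ} {K : Type*} [Field K] {P : ChargedParams n N K}

theorem Nondegenerate.g_eq (hP : P.Nondegenerate) {F : MetaplecticData n K}
    (hF : F.IsFockSpaceOf P.deltaWeights) (i : Fin N) {a : ZMod n} (ha : a ≠ 0) :
    F.g a = P.h a * P.y i / (P.f a * P.x i) := by
  obtain ⟨hx, hy, hA, hB⟩ := hP.1 i
  obtain ⟨ha1, ha2⟩ := hP.2 a
  rw [← hF i a ha]
  simp only [deltaWeights]
  field_simp

/-- This is the charge condition rewritten, and it identifies the constant `Q` of row `i`. For `n =
1` there is no nonzero charge and `Q` is not tied to `q²`; this is why the row operator carries `Q`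
as a separate parameter. -/
theorem Nondegenerate.g_mul_g_neg (hP : P.Nondegenerate)
    (hFF : GeneralizedFreeFermionic P.deltaWeights) {F : MetaplecticData n K}
    (hF : F.IsFockSpaceOf P.deltaWeights) (i : Fin N) {a : ZMod n} (ha : a ≠ 0) :
    F.g a * F.g (-a) = -(P.h 0 * P.y i / (P.f 0 * P.x i)) := by
  obtain ⟨hx, hy, hA, hB⟩ := hP.1 i
  obtain ⟨ha1, ha2⟩ := hP.2 a
  obtain ⟨hb1, hb2⟩ := hP.2 (-a)
  obtain ⟨hc1, hc2⟩ := hP.2 0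
  have h := (hFF i).2 a ha
  rw [hP.g_eq hF i ha, hP.g_eq hF i (neg_ne_zero.2 ha)]
  simp only [deltaWeights] at h
  field_simp at h ⊢
  linear_combination h

theorem Nondegenerate.inv_g_mul_g_neg (hP : P.Nondegenerate)
    (hFF : GeneralizedFreeFermionic P.deltaWeights) {F : MetaplecticData n K}
    (hF : F.IsFockSpaceOf P.deltaWeights) (i : Fin N) {a : ZMod n} (ha : a ≠ 0) :
    F.inv.g a * F.inv.g (-a) = -(P.f 0 * P.x i / (P.h 0 * P.y i)) := by
  rw [F.inv_g, F.inv_g, neg_neg, ← mul_inv, mul_comm, hP.g_mul_g_neg hFF hF i ha, inv_neg, inv_div]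

variable [NeZero n]

/-- Charges already increase to the left as in the row operator, so no translation is needed. With
`Q = -h(0)y/(f(0)x)` the crossing weight becomes `h(r) y`, and `(1 - Q) f(0) x` is the sum in `c₁`;
since `c₂ = A`, one takes `ε = 1`. -/
theorem Nondegenerate.isRowVertex_delta (hP : P.Nondegenerate) {F : MetaplecticData n K}
    (hF : F.IsFockSpaceOf P.deltaWeights) (i : Fin N) :
    F.IsRowVertex (P.deltaWeights i).deltaVertex (P.A i) (P.B i) 1 (fun a => P.f a * P.x i)
      (-(P.h 0 * P.y i / (P.f 0 * P.x i))) (Equiv.refl _) := by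
  obtain ⟨hx, hy, hA, hB⟩ := hP.1 i
  obtain ⟨hf0, hh0⟩ := hP.2 0
  refine ⟨fun Φ => ?_, fun Φ => ⟨(P.f 0 * P.x i + P.h 0 * P.y i) * P.A i * P.B i, ?_, ?_⟩,
    fun Φ r => ?_, fun Φ r => ?_, ?_⟩
  · simp [Fintype.sum_option, BoltzmannWeights.deltaVertex, deltaWeights]
  · field_simp
    ring
  · simp [Fintype.sum_option, BoltzmannWeights.deltaVertex, deltaWeights]
  · simp only [Fintype.sum_option, Fintype.sum_bool, BoltzmannWeights.deltaVertex, deltaWeights]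
    simp [mul_comm, mul_left_comm, add_comm, ite_smul]
  · have hcross : F.crossWeight (fun a => P.f a * P.x i)
        (-(P.h 0 * P.y i / (P.f 0 * P.x i))) r = P.h r * P.y i := by
      rw [MetaplecticData.crossWeight]
      split_ifs with hr
      · rw [hr]
        field_simp
      · obtain ⟨hfr, hhr⟩ := hP.2 r
        rw [hP.g_eq hF i hr]
        field_simp
    simp only [Fintype.sum_option, Fintype.sum_bool, BoltzmannWeights.deltaVertex, deltaWeights,
      Equiv.refl_apply, hcross]
    simp [mul_comm, mul_left_comm, mul_assoc]
  · rintro (_ | l) (_ | _) (_ | r) (_ | _) h <;> simp_all [BoltzmannWeights.deltaVertex]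

/-- Here `κ` is on top, so top and bottom spins are interchanged, and charges increase to the right,
so `r` is read as `1 - r`. A path entering from the right now turns with weight `c₁`, hence `ε =
f(0)x + h(0)y`. The left charge `r - 1` is minus the reflected charge, which accounts for `h(-a)`
and for `g(-a)⁻¹` in the Fock space with `q⁻¹`. -/
theorem Nondegenerate.isRowVertex_gamma (hP : P.Nondegenerate) {F : MetaplecticData n K}
    (hF : F.IsFockSpaceOf P.deltaWeights) (i : Fin N) :
    F.inv.IsRowVertex (fun l b r b' => (P.gammaWeights i).gammaVertex l b' r b) (P.A i)⁻¹
      (P.B i)⁻¹ (P.f 0 * P.x i + P.h 0 * P.y i) (fun a => P.h (-a) * P.y i)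
      (-(P.f 0 * P.x i / (P.h 0 * P.y i))) (Equiv.subLeft 1) := by
  obtain ⟨hx, hy, hA, hB⟩ := hP.1 i
  obtain ⟨hf0, hh0⟩ := hP.2 0
  refine ⟨fun Φ => ?_, fun Φ => ⟨(P.A i)⁻¹ * (P.B i)⁻¹, ?_, ?_⟩,
    fun Φ r => ?_, fun Φ r => ?_, ?_⟩
  · simp [Fintype.sum_option, BoltzmannWeights.gammaVertex, gammaWeights]
  · simp only [neg_zero]
    field_simp
    ring
  · simp [Fintype.sum_option, BoltzmannWeights.gammaVertex, gammaWeights]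
  · have hl : ∀ l : ZMod n, r = l + 1 ↔ l = r - 1 := fun l => by
      rw [eq_comm, eq_sub_iff_add_eq]
    simp only [Fintype.sum_option, Fintype.sum_bool, BoltzmannWeights.gammaVertex, gammaWeights, hl]
    simp [mul_comm, mul_left_comm, add_comm, ite_smul, sub_eq_zero, eq_comm (a := r)]
  · have hl : ∀ l : ZMod n, r = l + 1 ↔ l = r - 1 := fun l => by
      rw [eq_comm, eq_sub_iff_add_eq]
    have hcross : F.inv.crossWeight (fun a => P.h (-a) * P.y i)
        (-(P.f 0 * P.x i / (P.h 0 * P.y i))) (1 - r) = P.f (r - 1) * P.x i := by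
      rw [MetaplecticData.crossWeight]
      split_ifs with hr
      · rw [show r - 1 = -(1 - r) by ring, hr, neg_zero]
        field_simp
      · obtain ⟨hfr, hhr⟩ := hP.2 (r - 1)
        rw [F.inv_g, show -(1 - r) = r - 1 by ring, hP.g_eq hF i (by
          rwa [← neg_ne_zero, neg_sub])]
        field_simp
    simp only [Fintype.sum_option, Fintype.sum_bool, BoltzmannWeights.gammaVertex, gammaWeights,
      Equiv.subLeft_apply, hcross, hl]
    simp [mul_comm, mul_left_comm, mul_assoc]
  · rintro (_ | l) (_ | _) (_ | r) (_ | _) h <;> simp_all [BoltzmannWeights.gammaVertex]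

theorem theta_eq_prod (i : Fin N) : P.theta i = ∏ a, P.f a * P.x i := by
  rw [Finset.prod_mul_distrib, Finset.prod_const, Finset.card_univ, ZMod.card, theta, mul_comm]

theorem eta_eq_prod (i : Fin N) : P.eta i = ∏ a, P.h (-a) * P.y i := by
  rw [Finset.prod_mul_distrib, Finset.prod_const, Finset.card_univ, ZMod.card, eta, mul_comm,
    Fintype.prod_equiv (Equiv.neg (ZMod n)) P.h (fun a => P.h (-a)) (by simp)]

theorem Nondegenerate.pi_eq (hP : P.Nondegenerate) (i : Fin N) :
    P.pi i = -(P.h 0 * P.y i / (P.f 0 * P.x i)) * P.theta i := by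
  obtain ⟨hx, hy, hA, hB⟩ := hP.1 i
  obtain ⟨hf0, hh0⟩ := hP.2 0
  rw [pi, theta, ← pow_sub_one_mul (NeZero.ne n) (P.x i)]
  field_simp

theorem Nondegenerate.tau_eq (hP : P.Nondegenerate) (i : Fin N) :
    P.tau i = -(P.f 0 * P.x i / (P.h 0 * P.y i)) * P.eta i := by
  obtain ⟨hx, hy, hA, hB⟩ := hP.1 i
  obtain ⟨hf0, hh0⟩ := hP.2 0
  rw [tau, eta, ← pow_sub_one_mul (NeZero.ne n) (P.y i)]
  field_simp

end ChargedParams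

theorem mainTheorem5 {K : Type*} [Field K] [CharZero K] {n N : ℕ} [NeZero n]
    (P : ChargedParams n N K) (hP : P.Nondegenerate)
    (hFF : GeneralizedFreeFermionic P.deltaWeights)
    (F : MetaplecticData n K) (hF : F.IsFockSpaceOf P.deltaWeights)
    {ℓ : ℕ} (lam mu : Fin ℓ → ℕ) (hlam : Antitone lam) (hmu : Antitone mu)
    (M : ℕ) (hMlam : ∀ i, addRho lam i ≤ M) (hMmu : ∀ i, addRho mu i ≤ M) :
    P.deltaZ M (addRho lam) (addRho mu) =
        (∏ i, P.A i ^ (M + 1) * P.B i ^ ℓ) * superLLT F lam mu hlam hmu P.theta P.pi ∧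
      P.gammaZ M (addRho lam) (addRho mu) =
        (∏ i, P.A i ^ (-((M : ℤ) + 1)) * P.B i ^ (-(ℓ : ℤ))) *
          superLLT F.inv lam mu hlam hmu P.eta P.tau := by
  constructor
  · rw [ChargedParams.deltaZ, sum_boundaryConfigurations_eq_pathSum]
    exact F.pathSum_rowSum_eq _ P.A P.B _ _ P.theta P.pi _ _
      (fun i => hP.isRowVertex_delta hF i) (fun i a ha => hP.g_mul_g_neg hFF hF i ha)
      P.theta_eq_prod hP.pi_eq lam mu hlam hmu hMlam hMmu
  · have hpow : ∀ i, P.A i ^ (-((M : ℤ) + 1)) * P.B i ^ (-(ℓ : ℤ)) =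
        (P.A i)⁻¹ ^ (M + 1) * (P.B i)⁻¹ ^ ℓ := by
      intro i
      rw [zpow_neg, zpow_neg, inv_pow, inv_pow, ← zpow_natCast, ← zpow_natCast]
      push_cast
      rfl
    rw [ChargedParams.gammaZ, sum_boundaryConfigurations_eq_pathSum
      (fun i l b r b' => (P.gammaWeights i).gammaVertex l b' r b), Finset.prod_congr rfl
      fun i _ => hpow i]
    exact F.inv.pathSum_rowSum_eq _ (fun i => (P.A i)⁻¹) (fun i => (P.B i)⁻¹) _ _ P.eta P.tau _ _
      (fun i => hP.isRowVertex_gamma hF i) (fun i a ha => hP.inv_g_mul_g_neg hFF hF i ha)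
      P.eta_eq_prod hP.tau_eq lam mu hlam hmu hMlam hMmu
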